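/- Let $d\ge 1$, let $F$ be a real antisymmetric $d\times d$ matrix, $W\in\mathbb R$, $\Omega=[-\frac12,\frac12]^{\mathbb Z^d}$ with the product $P$ of the uniform laws, and $(\mathfrak t_m\omega)_n=\omega_{n+m}$. Let $\mathcal A=C^*(\Omega\times\mathbb Z^d,F)$ be the completion of the continuous compactly supported functions $f(\omega,n)$ on $\Omega\times\mathbb Z^d$, with product $(f*g)(\omega,n)=\sum_m f(\omega,m)\,g(\mathfrak t_m^{-1}\omega,n-m)\,e^{i\pi\, n\cdot F\cdot m}$ and involution $f^*(\omega,n)=\overline{f(\mathfrak t_n^{-1}\omega,-n)}$, in the norm $\|f\|=\sup_\omega\|\pi_\omega f\|$, where $(\pi_\omega f\,\phi)(n)=\sum_m f(\mathfrak t_n^{-1}\omega,m-n)\,e^{i\pi\, m\cdot F\cdot n}\phi(m)$ on $\ell^2(\mathbb Z^d)$. Evaluation $f(\omega,n)$ extends continuously to $\mathcal A$. Put $\mathcal T(f)=\int_\Omega f(\omega,0)\,dP(\omega)$, $(\partial_j f)(\omega,n)=i n_j f(\omega,n)$ and $\partial_{\alpha}=\partial_1^{\alpha_1}\cdots\partial_d^{\alpha_d}$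 for a multi-index $\alpha$; $\partial_\alpha f$ is defined when the resulting function is an element of $\mathcal A$. For an integer $\mathcal N\ge1$ let $\Omega^{\mathcal N}_{\rm per}=\{\omega\in\Omega:\mathfrak t_{(2\mathcal N+1)e_j}\omega=\omega,\ j=1,\dots,d\}$, with the probability measure $dP_{\rm per}=\prod_{n\in\{-\mathcal N,\dots,\mathcal N\}^d}d\omega_n$. Let $C^*(\Omega^{\mathcal N}_{\rm per}\times\mathbb Z^d,F)$ be the algebra defined by the same formulas with $\Omega^{\mathcal N}_{\rm per}$ in place of $\Omega$, let $\mathcal T_{\rm per}(f)=\int f(\omega,0)\,dP_{\rm per}(\omega)$, and let $\mathfrak P_{\mathcal N}:\mathcal A\to C^*(\Omega^{\mathcal N}_{\rm per}\times\mathbb Z^d,F)$ be the restriction of functions to $\Omega^{\mathcal N}_{\rm per}\times\mathbb Z^d$. Let $h\in\mathcal A$ be the nearest-neighbor Hamiltonian $h(\omega,n)=\delta_{|n|,1}+W\omega_n\delta_{n,0}$, with spectrum $\sigma(h)$. Let $\kappa$ be a real number, $0<\xi<\sinh^{-1}(\kappa/2d)$, and let $\alpha_1,\dots,\alpha_N$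 be multi-indices. **Theorem.** There is a finite constant $\mathfrak B_1$ (depending only on $d,F,W,\kappa,\xi$ and $\alpha_1,\dots,\alpha_N$) such that for all functions $\Phi_1,\dots,\Phi_N$ analytic on a neighborhood of $\{z\in\mathbb C:\mathrm{dist}(z,\sigma(h))\le\kappa\}$ the elements $f_j=\partial_{\alpha_j}\Phi_j(h)\in\mathcal A$ are well defined and, for every integer $\mathcal N\ge1$, $$\Big|\mathcal T\big(f_1*\cdots*f_N\big)-\mathcal T_{\rm per}\big(\mathfrak P_{\mathcal N}f_1*\cdots*\mathfrak P_{\mathcal N}f_N\big)\Big|\le \mathfrak B_1\Big(\prod_{j=1}^N\bar\Phi_j\Big)\,\mathcal N^{-1}\,e^{-\frac{2\sqrt2}{3}\,\xi\,\mathcal N},\qquad \bar\Phi_j=\frac1{2\pi}\int_{\mathrm{dist}(z,\sigma(h))=\kappa}|\Phi_j(z)|\,|dz|.$$ -/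

import Mathlib

open scoped ENNReal

noncomputable section

namespace BrillouinTorus

/-! ### Lattice, magnetic phases, Hilbert space -/

/-- The lattice `ℤ^d`. -/
abbrev Lattice (d : ℕ) := Fin d → ℤ

/-- Uniform magnetic fields: real antisymmetric `d × d` matrices. -/
abbrev MagneticField (d : ℕ) := {F : Matrix (Fin d) (Fin d) ℝ // F.transpose = -F}

/-- The pairing `x · F · y = ∑_{j,k} x_j F_{jk} y_k`. -/
def pairing {d : ℕ} (F : MagneticField d) (x y : Lattice d) : ℝ :=
  ∑ j, ∑ k, (x j : ℝ) * F.1 j k * (y k : ℝ)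

/-- The phase `exp (i π x · F · y)`. -/
def phase {d : ℕ} (F : MagneticField d) (x y : Lattice d) : ℂ :=
  Complex.exp (((Real.pi * pairing F x y : ℝ) : ℂ) * Complex.I)

/-- The Hilbert space `ℓ²(ℤ^d)`. -/
abbrev Hilb (d : ℕ) := lp (fun _ : Lattice d => ℂ) 2

instance Hilb.nontrivial (d : ℕ) : Nontrivial (Hilb d) :=
  ⟨⟨lp.single 2 (0 : Lattice d) (1 : ℂ), 0, fun h => by
    simpa using congrFun (congrArg Subtype.val h) 0⟩⟩

theorem pairing_add_left {d : ℕ} (F : MagneticField d) (x x' y : Lattice d) :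
    pairing F (x + x') y = pairing F x y + pairing F x' y := by
  simp [pairing, add_mul, Finset.sum_add_distrib]

theorem pairing_add_right {d : ℕ} (F : MagneticField d) (x y y' : Lattice d) :
    pairing F x (y + y') = pairing F x y + pairing F x y' := by
  simp [pairing, mul_add, Finset.sum_add_distrib]

theorem pairing_swap {d : ℕ} (F : MagneticField d) (x y : Lattice d) :
    pairing F y x = -pairing F x y := by
  have h : ∀ j k, F.1 j k = -F.1 k j := fun j k => by
    have := congrFun (congrFun F.2 k) j
    simpa [Matrix.transpose_apply] using this
  unfold pairing
  rw [Finset.sum_comm, ← Finset.sum_neg_distrib]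
  refine Finset.sum_congr rfl fun j _ => ?_
  rw [← Finset.sum_neg_distrib]
  refine Finset.sum_congr rfl fun k _ => ?_
  rw [h k j]
  ring

theorem norm_phase {d : ℕ} (F : MagneticField d) (x y : Lattice d) : ‖phase F x y‖ = 1 :=
  Complex.norm_exp_ofReal_mul_I _

theorem phase_zero_left {d : ℕ} (F : MagneticField d) (y : Lattice d) : phase F 0 y = 1 := by
  simp [phase, pairing]

theorem phase_zero_right {d : ℕ} (F : MagneticField d) (x : Lattice d) : phase F x 0 = 1 := by
  simp [phase, pairing]

theorem phase_self {d : ℕ} (F : MagneticField d) (x : Lattice d) : phase F x x = 1 := by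
  have h : pairing F x x = 0 := by linarith [pairing_swap F x x]
  simp [phase, h]

theorem phase_cocycle {d : ℕ} (F : MagneticField d) (n m k : Lattice d) :
    phase F (k - n) (m - n) * phase F k n = phase F m n * phase F k m := by
  have e1 : pairing F (k - n) (m - n) + pairing F (k - n) n = pairing F (k - n) m := by
    rw [← pairing_add_right, sub_add_cancel]
  have e2 : pairing F (k - n) m + pairing F n m = pairing F k m := by
    rw [← pairing_add_left, sub_add_cancel]
  have e3 : pairing F (k - n) n + pairing F n n = pairing F k n := by
    rw [← pairing_add_left, sub_add_cancel]
  have e4 := pairing_swap F n n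
  have e5 := pairing_swap F m n
  unfold phase
  rw [← Complex.exp_add, ← Complex.exp_add]
  congr 1
  rw [← add_mul, ← add_mul, ← Complex.ofReal_add, ← Complex.ofReal_add, ← mul_add, ← mul_add]
  congr 3
  linarith

theorem conj_phase {d : ℕ} (F : MagneticField d) (x y : Lattice d) :
    star (phase F x y) = phase F y x := by
  unfold phase
  rw [pairing_swap F x y, Complex.star_def, ← Complex.exp_conj]
  simp

/-- A weighted translation `(Tφ)(n) = a(n) φ(n + p)` with a bounded weight is bounded. -/
theorem exists_weightedShift {d : ℕ} (a : Lattice d → ℂ) (C : ℝ) (ha : ∀ n, ‖a n‖ ≤ C)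
    (p : Lattice d) :
    ∃ T : Hilb d →L[ℂ] Hilb d, ‖T‖ ≤ C ∧ ∀ φ n, T φ n = a n * φ (n + p) := by
  have hC : 0 ≤ C := (norm_nonneg _).trans (ha 0)
  have h2 : (0 : ℝ) < (2 : ℝ≥0∞).toReal := by norm_num
  have hle : ∀ (φ : Hilb d) n, ‖a n * φ (n + p)‖ ^ (2 : ℝ≥0∞).toReal ≤
      C ^ (2 : ℝ≥0∞).toReal * ‖φ (n + p)‖ ^ (2 : ℝ≥0∞).toReal := by
    intro φ n
    rw [norm_mul, ← Real.mul_rpow hC (norm_nonneg _)]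
    gcongr
    exact ha n
  have hs : ∀ φ : Hilb d, Summable fun n => ‖φ (n + p)‖ ^ (2 : ℝ≥0∞).toReal := fun φ =>
    ((memℓp_gen_iff h2).1 (lp.memℓp φ)).comp_injective (add_left_injective p)
  have hm : ∀ φ : Hilb d, Memℓp (fun n => a n * φ (n + p)) 2 := fun φ =>
    (memℓp_gen_iff h2).2 (Summable.of_nonneg_of_le (fun n => by positivity) (hle φ)
      ((hs φ).mul_left _))
  let L : Hilb d →ₗ[ℂ] Hilb d :=
    { toFun := fun φ => ⟨fun n => a n * φ (n + p), hm φ⟩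
      map_add' := fun φ ψ => by
        ext n
        exact mul_add _ _ _
      map_smul' := fun c φ => by
        ext n
        exact mul_left_comm _ _ _ }
  have hL : ∀ φ, ‖L φ‖ ≤ C * ‖φ‖ := by
    intro φ
    have h1 := lp.norm_rpow_eq_tsum h2 (L φ)
    have h3 := lp.norm_rpow_eq_tsum h2 φ
    have h5 : ∑' n, ‖φ (n + p)‖ ^ (2 : ℝ≥0∞).toReal = ∑' n, ‖φ n‖ ^ (2 : ℝ≥0∞).toReal :=
      (Equiv.addRight p).tsum_eq fun n => ‖φ n‖ ^ (2 : ℝ≥0∞).toReal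
    have h4 : ‖L φ‖ ^ (2 : ℝ≥0∞).toReal ≤ (C * ‖φ‖) ^ (2 : ℝ≥0∞).toReal := by
      rw [h1, Real.mul_rpow hC (norm_nonneg _), h3, ← h5, ← tsum_mul_left]
      exact Summable.tsum_le_tsum (hle φ) ((memℓp_gen_iff h2).1 (hm φ)) ((hs φ).mul_left _)
    exact (Real.rpow_le_rpow_iff (norm_nonneg _) (by positivity) h2).1 h4
  exact ⟨L.mkContinuous C hL, L.mkContinuous_norm_le hC hL, fun φ n => rfl⟩

/-! ### The algebra `𝒜₀`

`X` is a compact space on which `ℤ^d` acts by homeomorphisms `𝔱_m ω = m +ᵥ ω`. -/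

section Algebra

set_option linter.unusedSectionVars false

variable {d : ℕ}

/-- Continuous compactly supported functions `f(ω, n)` on `X × ℤ^d` (`X` compact, `ℤ^d`
discrete): continuous in `ω` and vanishing for `n` outside a finite set. -/
structure Core (d : ℕ) (X : Type*) [TopologicalSpace X] where
  toFun : X → Lattice d → ℂ
  continuous_toFun : ∀ n, Continuous fun ω => toFun ω n
  finite_support : ∃ S : Finset (Lattice d), ∀ ω, ∀ n ∉ S, toFun ω n = 0

variable {X : Type*} [TopologicalSpace X]

instance : CoeFun (Core d X) fun _ => X → Lattice d → ℂ := ⟨Core.toFun⟩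

/-- Addition `(f + g)(ω, n) = f(ω, n) + g(ω, n)`. -/
instance : Add (Core d X) where
  add f g :=
    { toFun := fun ω n => f ω n + g ω n
      continuous_toFun := fun n => (f.continuous_toFun n).add (g.continuous_toFun n)
      finite_support := by
        classical
        obtain ⟨S, hS⟩ := f.finite_support
        obtain ⟨T, hT⟩ := g.finite_support
        refine ⟨S ∪ T, fun ω n hn => ?_⟩
        simp only [Finset.mem_union, not_or] at hn
        rw [hS ω n hn.1, hT ω n hn.2, add_zero] }

/-- Scalar multiplication `(c f)(ω, n) = c f(ω, n)`. -/
instance : SMul ℂ (Core d X) where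
  smul c f :=
    { toFun := fun ω n => c * f ω n
      continuous_toFun := fun n => continuous_const.mul (f.continuous_toFun n)
      finite_support := by
        obtain ⟨S, hS⟩ := f.finite_support
        exact ⟨S, fun ω n hn => by rw [hS ω n hn, mul_zero]⟩ }

instance : Zero (Core d X) where
  zero := ⟨fun _ _ => 0, fun _ => continuous_const, ∅, fun _ _ _ => rfl⟩

/-- The identity `𝟏(ω, n) = δ_{n,0}`. -/
instance : One (Core d X) where
  one :=
    { toFun := fun _ n => if n = 0 then 1 else 0
      continuous_toFun := fun _ => continuous_const
      finite_support := ⟨{0}, fun _ n hn => if_neg (by simpa using hn)⟩ }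

theorem Core.ext' {f g : Core d X} (h : ∀ ω n, f ω n = g ω n) : f = g := by
  cases f
  cases g
  congr 1
  exact funext fun ω => funext fun n => h ω n

variable [AddAction (Lattice d) X] [ContinuousConstVAdd (Lattice d) X]

/-- The product `(f * g)(ω, n) = ∑_m f(ω, m) g(𝔱_m⁻¹ ω, n - m) e^{iπ n·F·m}`. -/
def Core.conv (F : MagneticField d) (f g : Core d X) : Core d X where
  toFun ω n := ∑' m, f ω m * g (-m +ᵥ ω) (n - m) * phase F n m
  continuous_toFun n := by
    obtain ⟨S, hS⟩ := f.finite_support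
    have h : (fun ω => ∑' m, f ω m * g (-m +ᵥ ω) (n - m) * phase F n m) =
        fun ω => ∑ m ∈ S, f ω m * g (-m +ᵥ ω) (n - m) * phase F n m := by
      funext ω
      exact tsum_eq_sum fun m hm => by rw [hS ω m hm, zero_mul, zero_mul]
    rw [h]
    exact continuous_finsetSum _ fun m _ => ((f.continuous_toFun m).mul
      ((g.continuous_toFun (n - m)).comp (continuous_const_vadd (-m)))).mul continuous_const
  finite_support := by
    classical
    obtain ⟨S, hS⟩ := f.finite_support
    obtain ⟨T, hT⟩ := g.finite_support
    refine ⟨(S ×ˢ T).image fun q => q.1 + q.2, fun ω n hn => ?_⟩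
    rw [← tsum_zero (α := ℂ) (β := Lattice d)]
    congr 1
    funext m
    by_cases hm : m ∈ S
    · have : n - m ∉ T := fun h => hn (Finset.mem_image.2
        ⟨(m, n - m), Finset.mem_product.2 ⟨hm, h⟩, by simp⟩)
      rw [hT _ _ this, mul_zero, zero_mul]
    · rw [hS ω m hm, zero_mul, zero_mul]

/-- The involution `f^*(ω, n) = conj f(𝔱_n⁻¹ ω, -n)`. -/
instance : Star (Core d X) where
  star f :=
    { toFun := fun ω n => star (f (-n +ᵥ ω) (-n))
      continuous_toFun := fun n =>
        ((f.continuous_toFun (-n)).comp (continuous_const_vadd (-n))).star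
      finite_support := by
        classical
        obtain ⟨S, hS⟩ := f.finite_support
        refine ⟨S.image fun n => -n, fun ω n hn => ?_⟩
        rw [hS _ (-n) fun h => hn (Finset.mem_image.2 ⟨-n, h, neg_neg n⟩), star_zero] }

/-! ### The covariant representations -/

theorem exists_rep [CompactSpace X] (F : MagneticField d) (f : Core d X) :
    ∃ C : ℝ, ∀ ω : X, ∃ T : Hilb d →L[ℂ] Hilb d, ‖T‖ ≤ C ∧ ∀ φ n,
      T φ n = ∑' m, f (-n +ᵥ ω) (m - n) * phase F m n * φ m := by
  obtain ⟨S, hS⟩ := f.finite_support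
  have hb : ∀ p, ∃ C : ℝ, ∀ ω, ‖f ω p‖ ≤ C := fun p => by
    obtain ⟨C, hC⟩ := (isCompact_range (f.continuous_toFun p)).isBounded.exists_norm_le
    exact ⟨C, fun ω => hC _ ⟨ω, rfl⟩⟩
  choose C hC using hb
  refine ⟨∑ p ∈ S, C p, fun ω => ?_⟩
  have hT : ∀ p, ∃ T : Hilb d →L[ℂ] Hilb d, ‖T‖ ≤ C p ∧
      ∀ φ n, T φ n = (f (-n +ᵥ ω) p * phase F (n + p) n) * φ (n + p) := fun p =>
    exists_weightedShift _ _ (fun n => by rw [norm_mul, norm_phase, mul_one]; exact hC p _) p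
  choose T hTn hTe using hT
  refine ⟨∑ p ∈ S, T p, (norm_sum_le _ _).trans (Finset.sum_le_sum fun p _ => hTn p), ?_⟩
  intro φ n
  rw [← (Equiv.addLeft n).tsum_eq, tsum_eq_sum (s := S)]
  · rw [sum_apply, lp.coeFn_sum, Finset.sum_apply]
    refine Finset.sum_congr rfl fun p _ => ?_
    rw [hTe]
    simp
  · intro p hp
    have : f (-n +ᵥ ω) p = 0 := hS _ _ hp
    simp [this]

variable [CompactSpace X]

/-- The operator `π_ω f` on `ℓ²(ℤ^d)`; it is determined by `rep_apply`. -/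
def rep (F : MagneticField d) (f : Core d X) (ω : X) : Hilb d →L[ℂ] Hilb d :=
  Classical.choose ((Classical.choose_spec (exists_rep F f)) ω)

/-- `(π_ω f φ)(n) = ∑_m f(𝔱_n⁻¹ ω, m - n) e^{iπ m·F·n} φ(m)`. -/
theorem rep_apply (F : MagneticField d) (f : Core d X) (ω : X) (φ : Hilb d) (n : Lattice d) :
    rep F f ω φ n = ∑' m, f (-n +ᵥ ω) (m - n) * phase F m n * φ m :=
  (Classical.choose_spec ((Classical.choose_spec (exists_rep F f)) ω)).2 φ n

theorem exists_norm_rep_le (F : MagneticField d) (f : Core d X) :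
    ∃ C : ℝ, ∀ ω, ‖rep F f ω‖ ≤ C :=
  ⟨_, fun ω => (Classical.choose_spec ((Classical.choose_spec (exists_rep F f)) ω)).1⟩

/-- The `C^*`-algebra of uniformly bounded families `(T_ω)_{ω ∈ X}` of operators on `ℓ²(ℤ^d)`,
with the norm `sup_ω ‖T_ω‖`. -/
abbrev Family (d : ℕ) (X : Type*) := lp (fun _ : X => Hilb d →L[ℂ] Hilb d) ∞

instance Family.cstarAlgebra (d : ℕ) (X : Type*) : CStarAlgebra (Family d X) where

/-- The family `(π_ω f)_ω`.  Its norm is `‖f‖ = sup_ω ‖π_ω f‖`. -/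
def repFamily (F : MagneticField d) (f : Core d X) : Family d X :=
  ⟨fun ω => rep F f ω, memℓp_infty (by
    obtain ⟨C, hC⟩ := exists_norm_rep_le F f
    exact ⟨C, by rintro _ ⟨ω, rfl⟩; exact hC ω⟩)⟩

theorem repFamily_apply (F : MagneticField d) (f : Core d X) (ω : X) :
    (repFamily F f : X → Hilb d →L[ℂ] Hilb d) ω = rep F f ω := rfl

theorem tsum_core_eq (f : Core d X) (F : MagneticField d) (ω : X) (φ : Lattice d → ℂ)
    (n : Lattice d) {S : Finset (Lattice d)} (hS : ∀ ω, ∀ n ∉ S, f ω n = 0) :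
    ∑' m, f (-n +ᵥ ω) (m - n) * phase F m n * φ m =
      ∑ p ∈ S, f (-n +ᵥ ω) p * phase F (n + p) n * φ (n + p) := by
  rw [← (Equiv.addLeft n).tsum_eq, tsum_eq_sum (s := S)]
  · simp
  · intro p hp
    have : f (-n +ᵥ ω) p = 0 := hS _ _ hp
    simp [this]

theorem family_ext {S T : Family d X}
    (h : ∀ ω φ n, (S : X → Hilb d →L[ℂ] Hilb d) ω φ n = (T : X → Hilb d →L[ℂ] Hilb d) ω φ n) :
    S = T :=
  lp.ext (funext fun ω => ContinuousLinearMap.ext fun φ => lp.ext (funext fun n => h ω φ n))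

theorem repFamily_add (F : MagneticField d) (f g : Core d X) :
    repFamily F (f + g) = repFamily F f + repFamily F g := by
  classical
  obtain ⟨S, hS⟩ := f.finite_support
  obtain ⟨T, hT⟩ := g.finite_support
  have hS' : ∀ ω, ∀ n ∉ S ∪ T, f ω n = 0 := fun ω n hn =>
    hS ω n fun h => hn (Finset.mem_union_left _ h)
  have hT' : ∀ ω, ∀ n ∉ S ∪ T, g ω n = 0 := fun ω n hn =>
    hT ω n fun h => hn (Finset.mem_union_right _ h)
  have hfg : ∀ ω, ∀ n ∉ S ∪ T, (f + g) ω n = 0 := fun ω n hn => by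
    show f ω n + g ω n = 0
    rw [hS' ω n hn, hT' ω n hn, add_zero]
  refine family_ext fun ω φ n => ?_
  show rep F (f + g) ω φ n = rep F f ω φ n + rep F g ω φ n
  rw [rep_apply, rep_apply, rep_apply, tsum_core_eq _ _ _ _ _ hS', tsum_core_eq _ _ _ _ _ hT',
    tsum_core_eq _ _ _ _ _ hfg, ← Finset.sum_add_distrib]
  refine Finset.sum_congr rfl fun p _ => ?_
  show (f _ p + g _ p) * _ * _ = _
  ring

theorem repFamily_smul (F : MagneticField d) (c : ℂ) (f : Core d X) :
    repFamily F (c • f) = c • repFamily F f := by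
  refine family_ext fun ω φ n => ?_
  show rep F (c • f) ω φ n = c * rep F f ω φ n
  rw [rep_apply, rep_apply, ← tsum_mul_left]
  refine tsum_congr fun m => ?_
  show (c * f _ _) * _ * _ = _
  ring

theorem repFamily_zero (F : MagneticField d) : repFamily F (0 : Core d X) = 0 := by
  refine family_ext fun ω φ n => ?_
  show rep F 0 ω φ n = 0
  rw [rep_apply, ← tsum_zero (α := ℂ) (β := Lattice d)]
  refine tsum_congr fun m => ?_
  show (0 : ℂ) * _ * _ = _
  ring

theorem repFamily_one (F : MagneticField d) : repFamily F (1 : Core d X) = 1 := by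
  refine family_ext fun ω φ n => ?_
  show rep F 1 ω φ n = φ n
  rw [rep_apply, tsum_eq_single n]
  · show (if n - n = 0 then (1 : ℂ) else 0) * _ * _ = _
    rw [if_pos (sub_self n), phase_self, one_mul, one_mul]
  · intro m hm
    show (if m - n = 0 then (1 : ℂ) else 0) * _ * _ = _
    rw [if_neg (sub_ne_zero.2 hm), zero_mul, zero_mul]

theorem repFamily_conv (F : MagneticField d) (f g : Core d X) :
    repFamily F (f.conv F g) = repFamily F f * repFamily F g := by
  obtain ⟨S, hS⟩ := f.finite_support
  obtain ⟨T, hT⟩ := g.finite_support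
  obtain ⟨U, hU⟩ := (f.conv F g).finite_support
  refine family_ext fun ω φ n => ?_
  show rep F (f.conv F g) ω φ n = rep F f ω (rep F g ω φ) n
  have hconv : ∀ q, (f.conv F g) (-n +ᵥ ω) q =
      ∑ p ∈ S, f (-n +ᵥ ω) p * g (-p +ᵥ -n +ᵥ ω) (q - p) * phase F q p := fun q =>
    tsum_eq_sum fun m hm => by rw [hS _ m hm, zero_mul, zero_mul]
  rw [rep_apply, rep_apply, tsum_core_eq _ _ _ _ _ hS]
  have hsum : ∀ p, HasSum
      (fun m => f (-n +ᵥ ω) p * g (-p +ᵥ -n +ᵥ ω) (m - n - p) * phase F (m - n) p *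
        phase F m n * φ m)
      (f (-n +ᵥ ω) p * phase F (n + p) n * rep F g ω φ (n + p)) := by
    intro p
    have h1 : HasSum (fun m => g (-(n + p) +ᵥ ω) (m - (n + p)) * phase F m (n + p) * φ m)
        (rep F g ω φ (n + p)) := by
      rw [rep_apply]
      refine Summable.hasSum ?_
      refine summable_of_ne_finset_zero (s := T.map (addRightEmbedding (n + p))) fun m hm => ?_
      have : m - (n + p) ∉ T := fun h => hm (Finset.mem_map.2 ⟨_, h, by simp⟩)
      rw [hT _ _ this, zero_mul, zero_mul]
    have h2 := h1.mul_left (f (-n +ᵥ ω) p * phase F (n + p) n)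
    refine (funext fun m => ?_ : (fun m => f (-n +ᵥ ω) p * g (-p +ᵥ -n +ᵥ ω) (m - n - p) *
      phase F (m - n) p * phase F m n * φ m) = _) ▸ h2
    have hc := phase_cocycle F n (n + p) m
    rw [add_sub_cancel_left] at hc
    rw [vadd_vadd, ← neg_add_rev, sub_sub]
    linear_combination (f (-n +ᵥ ω) p * g (-(n + p) +ᵥ ω) (m - (n + p)) * φ m) * hc
  rw [← (hasSum_sum fun p (_ : p ∈ S) => hsum p).tsum_eq]
  refine tsum_congr fun m => ?_
  rw [hconv, Finset.sum_mul, Finset.sum_mul]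

theorem repFamily_star (F : MagneticField d) (f : Core d X) :
    repFamily F (star f) = star (repFamily F f) := by
  classical
  refine family_ext fun ω φ n => ?_
  show rep F (star f) ω φ n = (ContinuousLinearMap.adjoint (rep F f ω)) φ n
  have h1 : (ContinuousLinearMap.adjoint (rep F f ω)) φ n =
      inner ℂ (rep F f ω (lp.single 2 n (1 : ℂ))) φ := by
    rw [← ContinuousLinearMap.adjoint_inner_right, lp.inner_single_left]
    simp
  rw [h1, lp.inner_eq_tsum, rep_apply]
  refine tsum_congr fun k => ?_
  have h2 : rep F f ω (lp.single 2 n (1 : ℂ)) k = f (-k +ᵥ ω) (n - k) * phase F n k := by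
    rw [rep_apply, tsum_eq_single n]
    · simp
    · intro m hm
      simp [hm]
  rw [h2]
  show star (f (-(k - n) +ᵥ -n +ᵥ ω) (-(k - n))) * _ * _ = _
  rw [vadd_vadd, neg_sub, sub_add_eq_add_sub, add_neg_cancel, zero_sub, ← conj_phase F n k]
  simp [mul_comm]

/-- The image of `𝒜₀`, a unital `*`-algebra isometric and isomorphic to `(𝒜₀, *_F, ^*, ‖ ‖)`. -/
def coreAlgebra (F : MagneticField d) (X : Type*) [TopologicalSpace X]
    [AddAction (Lattice d) X] [ContinuousConstVAdd (Lattice d) X] [CompactSpace X] :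
    StarSubalgebra ℂ (Family d X) where
  carrier := Set.range fun f : Core d X => repFamily F f
  mul_mem' := by
    rintro _ _ ⟨f, rfl⟩ ⟨g, rfl⟩
    exact ⟨f.conv F g, repFamily_conv F f g⟩
  one_mem' := ⟨1, repFamily_one F⟩
  add_mem' := by
    rintro _ _ ⟨f, rfl⟩ ⟨g, rfl⟩
    exact ⟨f + g, repFamily_add F f g⟩
  zero_mem' := ⟨0, repFamily_zero F⟩
  algebraMap_mem' c := ⟨c • 1, by
    show repFamily F _ = _
    rw [repFamily_smul, repFamily_one, Algebra.algebraMap_eq_smul_one]⟩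
  star_mem' := by
    rintro _ ⟨f, rfl⟩
    exact ⟨star f, repFamily_star F f⟩

/-- The `C^*`-algebra `C^*(X × ℤ^d, F)`: the completion of `𝒜₀` in the norm
`‖f‖ = sup_ω ‖π_ω f‖`, realised as the closure of `𝒜₀` in the complete space of bounded
operator families. -/
abbrev Observables (F : MagneticField d) (X : Type*) [TopologicalSpace X]
    [AddAction (Lattice d) X] [ContinuousConstVAdd (Lattice d) X] [CompactSpace X] :=
  (coreAlgebra F X).topologicalClosure

instance Observables.cstarAlgebra (F : MagneticField d) : CStarAlgebra (Observables F X) :=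
  StarSubalgebra.cstarAlgebra _ (h_closed := (coreAlgebra F X).isClosed_topologicalClosure)

/-- An element of `𝒜₀` as an element of `C^*(X × ℤ^d, F)`. -/
def ofCore (F : MagneticField d) (f : Core d X) : Observables F X :=
  ⟨repFamily F f, (coreAlgebra F X).le_topologicalClosure ⟨f, rfl⟩⟩

/-- The value `f(ω, n)` of an element of `C^*(X × ℤ^d, F)`, i.e. the matrix element
`⟨0| π_ω f |n⟩`.  It is the continuous extension of the evaluation on `𝒜₀`, see
`kernel_ofCore`. -/
def kernel {F : MagneticField d} (f : Observables F X) (ω : X) (n : Lattice d) : ℂ :=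
  ((f : Family d X) : X → Hilb d →L[ℂ] Hilb d) ω (lp.single 2 n (1 : ℂ)) 0

theorem kernel_ofCore (F : MagneticField d) (f : Core d X) (ω : X) (n : Lattice d) :
    kernel (ofCore F f) ω n = f ω n := by
  show rep F f ω (lp.single 2 n (1 : ℂ)) 0 = f ω n
  rw [rep_apply, tsum_eq_single n]
  · simp [phase_zero_right]
  · intro m hm
    simp [hm]

/-- `g = ∂_α f = ∂_1^{α_1} ⋯ ∂_d^{α_d} f`, where `(∂_j f)(ω, n) = i n_j f(ω, n)`: the element `f`
lies in the domain of the unbounded operator `∂_α` of `C^*(X × ℤ^d, F)` and is mapped to `g`. -/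
def IsMixedDerivative {F : MagneticField d} (α : Fin d → ℕ) (f g : Observables F X) : Prop :=
  ∀ ω n, kernel g ω n = (∏ j, (Complex.I * (n j : ℂ)) ^ α j) * kernel f ω n

/-- The trace `∫ f(ω, 0) dP(ω)` determined by an invariant probability measure on `X`. -/
def trace {F : MagneticField d} [MeasurableSpace X] (P : MeasureTheory.Measure X)
    (f : Observables F X) : ℂ :=
  ∫ ω, kernel f ω 0 ∂P

section Restriction

variable {Y : Type*} [TopologicalSpace Y] [AddAction (Lattice d) Y]
  [ContinuousConstVAdd (Lattice d) Y] [CompactSpace Y]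

/-- The family `(T_{ι y})_{y ∈ Y}`. -/
def Family.pullback (ι : Y → X) (T : Family d X) : Family d Y :=
  ⟨fun y => (T : X → Hilb d →L[ℂ] Hilb d) (ι y), memℓp_infty
    ⟨‖T‖, by rintro _ ⟨y, rfl⟩; exact lp.norm_apply_le_norm ENNReal.top_ne_zero T (ι y)⟩⟩

theorem pullback_mem (F : MagneticField d) (ι : Y → X) (hι : Continuous ι)
    (hequiv : ∀ (m : Lattice d) y, ι (m +ᵥ y) = m +ᵥ ι y) (f : Observables F X) :
    Family.pullback ι (f : Family d X) ∈ (coreAlgebra F Y).topologicalClosure := by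
  have hf : (f : Family d X) ∈ closure (coreAlgebra F X : Set (Family d X)) := f.2
  show _ ∈ closure (coreAlgebra F Y : Set (Family d Y))
  rw [Metric.mem_closure_iff] at hf ⊢
  intro ε hε
  obtain ⟨_, ⟨g, rfl⟩, hg⟩ := hf ε hε
  let g' : Core d Y :=
    { toFun := fun y n => g (ι y) n
      continuous_toFun := fun n => (g.continuous_toFun n).comp hι
      finite_support := by
        obtain ⟨S, hS⟩ := g.finite_support
        exact ⟨S, fun y n hn => hS (ι y) n hn⟩ }
  have hrep : ∀ y, rep F g' y = rep F g (ι y) := fun y =>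
    ContinuousLinearMap.ext fun φ => lp.ext (funext fun n => by
      rw [rep_apply, rep_apply]
      refine tsum_congr fun m => ?_
      show g (ι (-n +ᵥ y)) _ * _ * _ = _
      rw [hequiv])
  refine ⟨repFamily F g', ⟨g', rfl⟩, lt_of_le_of_lt ?_ hg⟩
  rw [dist_eq_norm, dist_eq_norm]
  refine lp.norm_le_of_forall_le (norm_nonneg _) fun y => ?_
  have := lp.norm_apply_le_norm ENNReal.top_ne_zero ((f : Family d X) - repFamily F g) (ι y)
  refine le_trans (le_of_eq ?_) this
  show ‖_ - rep F g' y‖ = ‖_ - rep F g (ι y)‖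
  rw [hrep]
  rfl

/-- Restriction of the functions `f(ω, n)` along an equivariant continuous map `ι : Y → X`
(the case of interest being the inclusion of a closed invariant subset). -/
def restrict {F : MagneticField d} (ι : Y → X) (hι : Continuous ι)
    (hequiv : ∀ (m : Lattice d) y, ι (m +ᵥ y) = m +ᵥ ι y) (f : Observables F X) :
    Observables F Y :=
  ⟨Family.pullback ι (f : Family d X), pullback_mem F ι hι hequiv f⟩

theorem kernel_restrict {F : MagneticField d} (ι : Y → X) (hι : Continuous ι)
    (hequiv : ∀ (m : Lattice d) y, ι (m +ᵥ y) = m +ᵥ ι y) (f : Observables F X) (y : Y)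
    (n : Lattice d) : kernel (restrict ι hι hequiv f) y n = kernel f (ι y) n := rfl

end Restriction

end Algebra

/-! ### The disorder space and its periodic configurations -/

/-- The range `[-1/2, 1/2]` of a single random amplitude. -/
abbrev Amplitude : Type := ↥(Set.Icc (-(1 / 2) : ℝ) (1 / 2))

/-- The uniform law on `[-1/2, 1/2]`: the restriction of the Lebesgue measure. -/
def uniformLaw : MeasureTheory.Measure Amplitude :=
  MeasureTheory.Measure.comap Subtype.val (MeasureTheory.volume : MeasureTheory.Measure ℝ)

instance : MeasureTheory.IsProbabilityMeasure uniformLaw where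
  measure_univ := by
    rw [uniformLaw, (MeasurableEmbedding.subtype_coe measurableSet_Icc).comap_apply,
      Set.image_univ, Subtype.range_coe, Real.volume_Icc]
    norm_num

/-- `Ω = [-1/2, 1/2]^{ℤ^d}`. -/
def Disorder (d : ℕ) := Lattice d → Amplitude

namespace Disorder

variable (d : ℕ)

instance : TopologicalSpace (Disorder d) := inferInstanceAs (TopologicalSpace (Lattice d → Amplitude))
instance : CompactSpace (Disorder d) := inferInstanceAs (CompactSpace (Lattice d → Amplitude))
instance : T2Space (Disorder d) := inferInstanceAs (T2Space (Lattice d → Amplitude))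
instance : MeasurableSpace (Disorder d) := inferInstanceAs (MeasurableSpace (Lattice d → Amplitude))

/-- The translations `(𝔱_m ω)_n = ω_{n+m}`. -/
instance : AddAction (Lattice d) (Disorder d) where
  vadd m ω := fun n => ω (n + m)
  zero_vadd ω := funext fun n => congrArg ω (add_zero n)
  add_vadd m m' ω := funext fun n => congrArg ω (add_assoc n m m').symm

instance : ContinuousConstVAdd (Lattice d) (Disorder d) where
  continuous_const_vadd m := continuous_pi fun n => continuous_apply (n + m)

/-- `dP(ω) = ∏_{n ∈ ℤ^d} dω_n`. -/
def prob : MeasureTheory.Measure (Disorder d) :=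
  MeasureTheory.Measure.infinitePi fun _ : Lattice d => uniformLaw

end Disorder

/-- `Ω_per^𝒩`: the `ω ∈ Ω` with `𝔱_{(2𝒩+1) e_j} ω = ω` for all `j`. -/
def PeriodicDisorder (d 𝒩 : ℕ) :=
  {ω : Disorder d // ∀ j : Fin d, (Pi.single j (2 * (𝒩 : ℤ) + 1) : Lattice d) +ᵥ ω = ω}

namespace PeriodicDisorder

variable {d 𝒩 : ℕ}

instance : TopologicalSpace (PeriodicDisorder d 𝒩) := inferInstanceAs (TopologicalSpace (Subtype _))
instance : MeasurableSpace (PeriodicDisorder d 𝒩) := inferInstanceAs (MeasurableSpace (Subtype _))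

instance : CompactSpace (PeriodicDisorder d 𝒩) := by
  have h : IsClosed (⋂ j : Fin d,
      {ω : Disorder d | (Pi.single j (2 * (𝒩 : ℤ) + 1) : Lattice d) +ᵥ ω = ω}) :=
    isClosed_iInter fun j => isClosed_eq (continuous_const_vadd _) continuous_id
  refine isCompact_iff_compactSpace.1 (IsClosed.isCompact (X := Disorder d) ?_)
  have he : (⋂ j : Fin d,
      {ω : Disorder d | (Pi.single j (2 * (𝒩 : ℤ) + 1) : Lattice d) +ᵥ ω = ω}) =
      {ω : Disorder d | ∀ j : Fin d, (Pi.single j (2 * (𝒩 : ℤ) + 1) : Lattice d) +ᵥ ω = ω} := by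
    ext ω
    simp
  rw [he] at h
  exact h

instance : AddAction (Lattice d) (PeriodicDisorder d 𝒩) where
  vadd m ω := ⟨m +ᵥ ω.1, fun j => by rw [vadd_vadd, add_comm, ← vadd_vadd, ω.2 j]⟩
  zero_vadd ω := Subtype.ext (zero_vadd _ ω.1)
  add_vadd m m' ω := Subtype.ext (add_vadd m m' ω.1)

instance : ContinuousConstVAdd (Lattice d) (PeriodicDisorder d 𝒩) where
  continuous_const_vadd m :=
    Continuous.subtype_mk ((continuous_const_vadd m).comp continuous_subtype_val) _

/-- The inclusion `Ω_per^𝒩 ⊂ Ω`. -/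
def incl (ω : PeriodicDisorder d 𝒩) : Disorder d := ω.1

theorem continuous_incl : Continuous (incl : PeriodicDisorder d 𝒩 → Disorder d) :=
  continuous_subtype_val

theorem incl_vadd (m : Lattice d) (ω : PeriodicDisorder d 𝒩) : incl (m +ᵥ ω) = m +ᵥ incl ω := rfl

/-- The unit cell `Λ_𝒩 = {-𝒩, …, 𝒩}^d`. -/
abbrev Cell (d 𝒩 : ℕ) := Fin d → Finset.Icc (-(𝒩 : ℤ)) (𝒩 : ℤ)

/-- The point of the unit cell that is congruent to `n` modulo `2𝒩 + 1`. -/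
def toCell (𝒩 : ℕ) (n : Lattice d) : Cell d 𝒩 := fun j =>
  ⟨Int.bmod (n j) (2 * 𝒩 + 1), by
    have h1 := Int.le_bmod (x := n j) (m := 2 * 𝒩 + 1) (by omega)
    have h2 := Int.bmod_le (x := n j) (m := 2 * 𝒩 + 1) (by omega)
    rw [Finset.mem_Icc]
    omega⟩

/-- The periodic configuration that repeats the given amplitudes on the unit cell. -/
def ofCell (η : Cell d 𝒩 → Amplitude) : PeriodicDisorder d 𝒩 :=
  ⟨fun n => η (toCell 𝒩 n), fun j => by
    funext n
    refine congrArg η (funext fun k => Subtype.ext ?_)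
    show Int.bmod ((n + Pi.single j (2 * (𝒩 : ℤ) + 1) : Lattice d) k) (2 * 𝒩 + 1) = Int.bmod (n k) (2 * 𝒩 + 1)
    rcases eq_or_ne k j with rfl | hk
    · have := Int.add_bmod_right (n k) (2 * 𝒩 + 1)
      push_cast at this
      simpa using this
    · simp [hk]⟩

theorem measurable_ofCell : Measurable (ofCell : (Cell d 𝒩 → Amplitude) → PeriodicDisorder d 𝒩) :=
  Measurable.subtype_mk (measurable_pi_lambda _ fun n => measurable_pi_apply (toCell 𝒩 n))

/-- `dP_per(ω) = ∏_{n ∈ Λ_𝒩} dω_n`, the periodic configurations being parametrised by their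
components in the unit cell. -/
def prob (d 𝒩 : ℕ) : MeasureTheory.Measure (PeriodicDisorder d 𝒩) :=
  (MeasureTheory.Measure.pi fun _ : Cell d 𝒩 => uniformLaw).map ofCell

end PeriodicDisorder

/-! ### The model -/

section Model

variable {d : ℕ}

/-- The nearest-neighbor Hamiltonian `h(ω, n) = δ_{|n|,1} + W ω_n δ_{n,0}` as an element of
`𝒜₀`. -/
def hamiltonianCore (d : ℕ) (W : ℝ) : Core d (Disorder d) where
  toFun ω n := (if ∑ j, n j ^ 2 = 1 then 1 else 0) +
    (if n = 0 then ((W * (ω n : ℝ) : ℝ) : ℂ) else 0)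
  continuous_toFun n := by
    refine continuous_const.add ?_
    by_cases hn : n = 0
    · simp only [if_pos hn]
      exact Complex.continuous_ofReal.comp
        (continuous_const.mul (continuous_subtype_val.comp (continuous_apply n)))
    · simp only [if_neg hn]
      exact continuous_const
  finite_support := by
    refine ⟨Finset.Icc (fun _ => -1) (fun _ => 1), fun ω n hn => ?_⟩
    have h0 : n ≠ 0 := by
      rintro rfl
      exact hn (Finset.mem_Icc.2 ⟨fun _ => by simp, fun _ => by simp⟩)
    have h1 : ∑ j, n j ^ 2 ≠ 1 := fun h => by
      refine hn (Finset.mem_Icc.2 ⟨fun j => ?_, fun j => ?_⟩) <;>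
      · have := Finset.single_le_sum (f := fun j => n j ^ 2) (fun i _ => sq_nonneg (n i))
          (Finset.mem_univ j)
        simp only [h] at this
        nlinarith
    rw [if_neg h0, if_neg h1, add_zero]

/-- The nearest-neighbor Hamiltonian in `C^*(Ω × ℤ^d, F)`. -/
def hamiltonian (F : MagneticField d) (W : ℝ) : Observables F (Disorder d) :=
  ofCore F (hamiltonianCore d W)

theorem isSelfAdjoint_hamiltonian (F : MagneticField d) (W : ℝ) :
    IsSelfAdjoint (hamiltonian F W) := by
  have h : star (hamiltonianCore d W) = hamiltonianCore d W := by
    refine Core.ext' fun ω n => ?_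
    show star ((if ∑ j, (-n) j ^ 2 = 1 then (1 : ℂ) else 0) +
      (if -n = 0 then ((W * ((-n +ᵥ ω) (-n) : ℝ) : ℝ) : ℂ) else 0)) =
      (if ∑ j, n j ^ 2 = 1 then (1 : ℂ) else 0) + (if n = 0 then ((W * (ω n : ℝ) : ℝ) : ℂ) else 0)
    by_cases hn : n = 0
    · subst hn
      simp
    · simp [hn, apply_ite]
  refine Subtype.ext ?_
  show star (repFamily F (hamiltonianCore d W)) = repFamily F (hamiltonianCore d W)
  rw [← repFamily_star, h]

/-- `Φ̄ = (1/2π) ∫_{𝒞_κ} |Φ(z)| |dz|` with the contour `𝒞_κ = {z | dist(z, σ) = κ}`; `|dz|` is the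
arc length, i.e. the one-dimensional Hausdorff measure. -/
def contourNorm (σ : Set ℂ) (κ : ℝ) (Φ : ℂ → ℂ) : ℝ :=
  (2 * Real.pi)⁻¹ *
    ∫ z in {z : ℂ | Metric.infDist z σ = κ}, ‖Φ z‖ ∂(MeasureTheory.Measure.hausdorffMeasure 1)

/-- The restriction map `𝔓_{Λ_𝒩} : C^*(Ω × ℤ^d, F) → C^*(Ω_per^𝒩 × ℤ^d, F)`. -/
def toPeriodic {F : MagneticField d} (𝒩 : ℕ) (f : Observables F (Disorder d)) :
    Observables F (PeriodicDisorder d 𝒩) :=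
  restrict PeriodicDisorder.incl PeriodicDisorder.continuous_incl PeriodicDisorder.incl_vadd f

end Model

end BrillouinTorus

end

open scoped ENNReal

noncomputable section

namespace BrillouinTorus

open MeasureTheory Set

/-! The origin of a configuration hardly feels the disorder beyond the cube `{-𝒩, …, 𝒩}^d`. The
periodic law is the image of `P` under the map that keeps the amplitudes of the cube and repeats
them periodically. Both traces are therefore integrals over the same space, of one function of the
configuration evaluated at `ω` and at its periodization. A bound for this function at two
configurations agreeing on the cube suffices (`norm_integral_sub_periodicProb_le`).

For a resolvent `(z - h)⁻¹` the bound is a Combes–Thomas estimate. Conjugation by an exponential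
weight shows that its matrix elements decay at every rate `r` with `2d (e^r - 1) < dist (z, σ(h))`.
The difference of the resolvents at two such configurations is a resolvent times a potential
supported off the cube times a resolvent. A path from the origin to that support and back has length
at least `2𝒩`, whence the factor `e^(-2η𝒩)` for `η` slightly below `r`. The difference `r - η` pays
for sums over the lattice, for the polynomials coming from the derivatives, and for products
(`exists_isLocalised_of_inverse`, `exists_isLocalised_mixedDerivative`, `exists_column_prod_le`).

Functions of `h` are reduced to resolvents by Cauchy's formula. The level set `dist (z, σ(h)) = κ`
can have corners, so the contour integral is not used directly. A smooth cutoff gives `Φ(h)` as an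
area integral of resolvents over an annular region `κ₁ ≤ dist ≤ κ₂ < κ` (`exists_cauchy_weight`). It
remains to bound `Φ` there by its mean over the level set (`exists_sup_le_hausdorff_integral`). As
the spectrum is real, the part of the level set over a component `(a, b)` of `{x | dist (x, S) <
κ}`, with `S` the spectrum as a subset of `ℝ`, is a pair of graphs, which are approximated by
Lipschitz graphs. The weight `(z - a)(b - z)` compensates the vertical tangents at the end points,
and `dx` is dominated by arc length because `Re` is a contraction.

The rate `ξ/2` is admissible since `e^(ξ/2) - 1 ≤ sinh ξ`. Taking `η` just below `ξ/2` gives a decay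
rate `2η` above `(2√2/3) ξ`, and the surplus yields the factor `𝒩⁻¹`. -/

/-! ### The Cauchy–Pompeiu formula -/

/-- The Wirtinger derivative `∂g/∂z̄`. -/
def wirtingerBar (g : ℂ → ℂ) (z : ℂ) : ℂ :=
  (fderiv ℝ g z 1 + Complex.I * fderiv ℝ g z Complex.I) / 2

theorem polarIntegrable {A : ℝ × ℝ → ℂ} (hA : Continuous A) {R : ℝ}
    (hR : ∀ p : ℝ × ℝ, R < p.1 → A p = 0) :
    IntegrableOn A (Ioi 0 ×ˢ Ioo (-Real.pi) Real.pi) (volume.prod volume) := by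
  have h1 : IntegrableOn A (Icc 0 R ×ˢ Icc (-Real.pi) Real.pi) (volume.prod volume) :=
    hA.continuousOn.integrableOn_compact (isCompact_Icc.prod isCompact_Icc)
  refine h1.of_forall_sdiff_eq_zero (measurableSet_Ioi.prod measurableSet_Ioo) ?_
  rintro ⟨r, θ⟩ ⟨⟨h2, h3⟩, h4⟩
  refine hR _ ?_
  by_contra h5
  exact h4 ⟨⟨le_of_lt h2, not_lt.1 h5⟩, ⟨h3.1.le, h3.2.le⟩⟩

/-- In polar coordinates the Jacobian `r` cancels the modulus of `1/z`, and the integrand becomes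
half of `∂g/∂r + (i/r) ∂g/∂θ`. The radial part integrates to `-g 0` along each ray, the angular part
to zero around each circle. -/
theorem integral_wirtingerBar_div_self {g : ℂ → ℂ} (hg : ContDiff ℝ 1 g)
    (hgs : HasCompactSupport g) :
    ∫ z, wirtingerBar g z / z = -Real.pi * g 0 := by
  obtain ⟨R, hR⟩ : ∃ R : ℝ, ∀ z : ℂ, R < ‖z‖ → g z = 0 ∧ fderiv ℝ g z = 0 := by
    obtain ⟨R, hR⟩ := hgs.isCompact.isBounded.exists_norm_le
    refine ⟨R, fun z hz => ?_⟩
    have hz' : z ∉ tsupport g := fun h => absurd (hR z h) (not_le.2 hz)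
    exact ⟨image_eq_zero_of_notMem_tsupport hz',
      image_eq_zero_of_notMem_tsupport fun h => hz' (tsupport_fderiv_subset ℝ h)⟩
  let e : ℝ → ℂ := fun θ => Complex.exp (θ * Complex.I)
  have he : ∀ θ, ‖e θ‖ = 1 := fun θ => Complex.norm_exp_ofReal_mul_I θ
  have hec : Continuous e := by fun_prop
  let A : ℝ × ℝ → ℂ := fun p => fderiv ℝ g (p.1 * e p.2) (e p.2)
  let B : ℝ × ℝ → ℂ := fun p => fderiv ℝ g (p.1 * e p.2) (Complex.I * e p.2)
  have hfd : Continuous (fderiv ℝ g) := hg.continuous_fderiv (by norm_num)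
  have hm : Continuous fun p : ℝ × ℝ => (p.1 : ℂ) * e p.2 := by fun_prop
  have hA : Continuous A := (hfd.comp hm).clm_apply (by fun_prop)
  have hB : Continuous B := (hfd.comp hm).clm_apply (by fun_prop)
  have hz0 : ∀ p : ℝ × ℝ, |R| < p.1 → fderiv ℝ g (p.1 * e p.2) = 0 := fun p hp => by
    refine (hR _ ?_).2
    rw [norm_mul, he, mul_one, Complex.norm_real]
    exact (le_abs_self R).trans_lt (hp.trans_le (le_abs_self _))
  have hAi := polarIntegrable hA (R := |R|) fun p hp => by simp [A, hz0 p hp]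
  have hBi := polarIntegrable hB (R := |R|) fun p hp => by simp [B, hz0 p hp]
  have hgd : ∀ z, HasFDerivAt g (fderiv ℝ g z) z := fun z =>
    (hg.differentiable (by norm_num) z).hasFDerivAt
  have hIA : ∫ p in Ioi 0 ×ˢ Ioo (-Real.pi) Real.pi, A p ∂(volume.prod volume) =
      -(2 * Real.pi) * g 0 := by
    rw [IntegrableOn, ← Measure.prod_restrict] at hAi
    rw [← Measure.prod_restrict]
    rw [integral_prod_symm _ hAi]
    have h1 : ∀ θ : ℝ, ∫ r in Ioi (0 : ℝ), A (r, θ) = -g 0 := by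
      intro θ
      have hd : ∀ r : ℝ, HasDerivAt (fun r : ℝ => g (r * e θ)) (A (r, θ)) r := fun r =>
        (hgd _).comp_hasDerivAt r (by
          simpa using (Complex.ofRealCLM.hasDerivAt (x := r)).mul_const (e θ))
      have := integral_Ioi_of_hasDerivAt_of_tendsto (a := (0 : ℝ)) (m := 0)
        (hd 0).continuousAt.continuousWithinAt (fun r _ => hd r) ?_ ?_
      · simpa using this
      · have : IntegrableOn (fun r => A (r, θ)) (Icc 0 |R|) :=
          (hA.comp (by fun_prop : Continuous fun r : ℝ => (r, θ))).continuousOn.integrableOn_compact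
            isCompact_Icc
        refine this.of_forall_sdiff_eq_zero measurableSet_Ioi fun r hr => ?_
        have : |R| < r := by
          by_contra h
          exact hr.2 ⟨le_of_lt hr.1, not_lt.1 h⟩
        simp [A, hz0 (r, θ) this]
      · refine tendsto_const_nhds.congr' ?_
        filter_upwards [Filter.eventually_gt_atTop |R|] with r hr
        refine ((hR _ ?_).1).symm
        rw [norm_mul, he, mul_one, Complex.norm_real]
        exact (le_abs_self R).trans_lt (hr.trans_le (le_abs_self _))
    simp_rw [h1]
    rw [setIntegral_const]
    simp only [measureReal_def, Real.volume_Ioo]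
    rw [ENNReal.toReal_ofReal (by linarith [Real.pi_pos]), Complex.real_smul]
    push_cast
    ring
  have hIB : ∫ p in Ioi 0 ×ˢ Ioo (-Real.pi) Real.pi, B p ∂(volume.prod volume) = 0 := by
    rw [IntegrableOn, ← Measure.prod_restrict] at hBi
    rw [← Measure.prod_restrict]
    rw [integral_prod _ hBi]
    refine setIntegral_eq_zero_of_forall_eq_zero fun r hr => ?_
    have hr : (0 : ℝ) < r := hr
    have hd : ∀ θ : ℝ, HasDerivAt (fun θ : ℝ => (r : ℂ)⁻¹ * g (r * e θ)) (B (r, θ)) θ := by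
      intro θ
      have he' : HasDerivAt e (Complex.I * e θ) θ := by
        have := ((Complex.ofRealCLM.hasDerivAt (x := θ)).mul_const Complex.I).cexp
        simpa [e, mul_comm] using this
      have := ((hgd (r * e θ)).comp_hasDerivAt θ (he'.const_mul (r : ℂ))).const_mul (r : ℂ)⁻¹
      refine this.congr_deriv ?_
      have h3 : (r : ℂ) * (Complex.I * e θ) = r • (Complex.I * e θ) := by simp
      rw [h3, map_smul]
      have : (r : ℂ) ≠ 0 := by exact_mod_cast hr.ne'
      simp only [B, Complex.real_smul]
      field_simp
    rw [← integral_Ioc_eq_integral_Ioo,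
      ← intervalIntegral.integral_of_le (by linarith [Real.pi_pos]),
      intervalIntegral.integral_eq_sub_of_hasDerivAt (fun θ _ => hd θ)
        ((hB.comp (by fun_prop : Continuous fun θ : ℝ => (r, θ))).intervalIntegrable _ _)]
    have : e Real.pi = e (-Real.pi) := by
      simp only [e]
      push_cast
      rw [Complex.exp_pi_mul_I, neg_mul, Complex.exp_neg, Complex.exp_pi_mul_I]
      norm_num
    rw [this, sub_self]
  rw [← Complex.integral_comp_polarCoord_symm]
  have hAB : ∀ p ∈ polarCoord.target,
      p.1 • (wirtingerBar g (Complex.polarCoord.symm p) / Complex.polarCoord.symm p) =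
        (1 / 2 : ℂ) * A p + (Complex.I / 2) * B p := by
    rintro ⟨r, θ⟩ hp
    have hr : (0 : ℝ) < r := by
      rw [polarCoord_target] at hp
      exact hp.1
    have hr' : (r : ℂ) ≠ 0 := by exact_mod_cast hr.ne'
    have hs : Complex.polarCoord.symm (r, θ) = r * e θ := by
      rw [Complex.polarCoord_symm_apply]
      simp [e, Complex.exp_mul_I]
    have he0 : e θ ≠ 0 := Complex.exp_ne_zero _
    have hcs : (Real.cos θ : ℂ) ^ 2 + (Real.sin θ : ℂ) ^ 2 = 1 := by
      have := Real.cos_sq_add_sin_sq θ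
      exact_mod_cast this
    have he1 : e θ = Real.cos θ + Real.sin θ * Complex.I := by
      simp [e, Complex.exp_mul_I]
    have heD : ∀ L : ℂ →L[ℝ] ℂ, L (e θ) = Real.cos θ * L 1 + Real.sin θ * L Complex.I := by
      intro L
      have : e θ = Real.cos θ • (1 : ℂ) + Real.sin θ • Complex.I := by simp [he1]
      rw [this, map_add, map_smul, map_smul]
      simp
    have heD' : ∀ L : ℂ →L[ℝ] ℂ,
        L (Complex.I * e θ) = -Real.sin θ * L 1 + Real.cos θ * L Complex.I := by
      intro L
      have : Complex.I * e θ = (-Real.sin θ) • (1 : ℂ) + Real.cos θ • Complex.I := by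
        simp only [he1, Complex.real_smul, Complex.ofReal_neg]
        linear_combination (Real.sin θ : ℂ) * Complex.I_mul_I
      rw [this, map_add, map_smul, map_smul]
      simp
    rw [hs]
    simp only [wirtingerBar, A, B, heD, heD', Complex.real_smul]
    generalize fderiv ℝ g (r * e θ) 1 = a
    generalize fderiv ℝ g (r * e θ) Complex.I = b
    have hinv : (e θ)⁻¹ = Real.cos θ - Real.sin θ * Complex.I := by
      refine inv_eq_of_mul_eq_one_right ?_
      rw [he1]
      linear_combination hcs - (Real.sin θ : ℂ) ^ 2 * Complex.I_sq
    rw [div_div, mul_comm (2 : ℂ), mul_div_assoc', mul_assoc, mul_div_mul_left _ _ hr',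
      div_eq_mul_inv, mul_inv, hinv]
    linear_combination (-(b * Real.sin θ) / 2) * Complex.I_sq
  rw [setIntegral_congr_fun polarCoord.open_target.measurableSet hAB,
    polarCoord_target, Measure.volume_eq_prod,
    integral_add (hAi.const_mul _) (hBi.const_mul _), integral_const_mul, integral_const_mul,
    hIA, hIB]
  ring

theorem integral_wirtingerBar_div_sub {g : ℂ → ℂ} (hg : ContDiff ℝ 1 g)
    (hgs : HasCompactSupport g) (x : ℂ) :
    ∫ z, wirtingerBar g z / (z - x) = -Real.pi * g x := by
  have h1 : ContDiff ℝ 1 fun z => g (z + x) := hg.comp (contDiff_id.add contDiff_const)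
  have h2 : HasCompactSupport fun z => g (z + x) :=
    hgs.comp_homeomorph (Homeomorph.addRight x)
  have h3 := integral_wirtingerBar_div_self h1 h2
  rw [zero_add] at h3
  rw [← h3, ← integral_add_right_eq_self _ x]
  refine integral_congr_ae (Filter.Eventually.of_forall fun z => ?_)
  simp only [wirtingerBar, add_sub_cancel_right, fderiv_comp_add_right]

/-- Cauchy's formula in the form of an area integral over the annular region
`κ₁ ≤ dist (z, σ) ≤ κ₂`. -/
theorem exists_cauchy_weight {σ : Set ℂ} (hσ : IsCompact σ) (hne : σ.Nonempty) {κ₁ κ₂ κ : ℝ}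
    (h12 : κ₁ < κ₂) (h2 : κ₂ < κ) :
    ∃ c : ℂ → ℂ, Continuous c ∧
      (∀ z, c z ≠ 0 → κ₁ ≤ Metric.infDist z σ ∧ Metric.infDist z σ ≤ κ₂) ∧
      ∀ Φ : ℂ → ℂ, AnalyticOnNhd ℂ Φ {z | Metric.infDist z σ ≤ κ} →
        ∀ x, Metric.infDist x σ < κ₁ → Φ x = ∫ z, c z * Φ z / (z - x) := by
  have hcont : Continuous fun z : ℂ => Metric.infDist z σ := Metric.continuous_infDist_pt σ
  have hcl1 : IsClosed {z : ℂ | κ₂ ≤ Metric.infDist z σ} := isClosed_le continuous_const hcont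
  have hcl2 : IsClosed {z : ℂ | Metric.infDist z σ ≤ κ₁} := isClosed_le hcont continuous_const
  have hdisj : Disjoint {z : ℂ | κ₂ ≤ Metric.infDist z σ} {z : ℂ | Metric.infDist z σ ≤ κ₁} := by
    rw [Set.disjoint_left]
    intro z hz hz'
    simp only [mem_ofPred_eq] at hz hz'
    linarith
  obtain ⟨f, hf0, hf1, -⟩ := exists_contMDiffMap_zero_one_of_isClosed (n := 1)
    (modelWithCornersSelf ℝ ℂ) hcl1 hcl2 hdisj
  have hfs : ContDiff ℝ 1 (f : ℂ → ℝ) := f.contMDiff.contDiff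
  let χ : ℂ → ℂ := fun z => (f z : ℂ)
  have hχ : ContDiff ℝ 1 χ := Complex.ofRealCLM.contDiff.comp hfs
  have hχd : Continuous (fderiv ℝ χ) := hχ.continuous_fderiv (by norm_num)
  have hχ0 : ∀ z, κ₂ < Metric.infDist z σ → χ =ᶠ[nhds z] fun _ => 0 := fun z hz => by
    filter_upwards [(isOpen_lt continuous_const hcont).mem_nhds hz] with y hy
    simp [χ, hf0 (le_of_lt hy : κ₂ ≤ Metric.infDist y σ)]
  have hχ1 : ∀ z, Metric.infDist z σ < κ₁ → χ =ᶠ[nhds z] fun _ => 1 := fun z hz => by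
    filter_upwards [(isOpen_lt hcont continuous_const).mem_nhds hz] with y hy
    simp [χ, hf1 (le_of_lt hy : Metric.infDist y σ ≤ κ₁)]
  have hχs : ∀ z ∈ tsupport χ, Metric.infDist z σ ≤ κ₂ := by
    intro z hz
    by_contra h
    exact (notMem_tsupport_iff_eventuallyEq.2 (hχ0 z (not_le.1 h))) hz
  have hbdd : Bornology.IsBounded {z : ℂ | Metric.infDist z σ ≤ κ₂} := by
    obtain ⟨C, hC⟩ := hσ.isBounded.exists_norm_le
    refine isBounded_iff_forall_norm_le.2 ⟨C + κ₂, fun z hz => ?_⟩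
    obtain ⟨s, hs, hzs⟩ := hσ.exists_infDist_eq_dist hne z
    have h1 : dist z s ≤ κ₂ := hzs ▸ hz
    rw [dist_eq_norm] at h1
    have := norm_le_norm_add_norm_sub' z s
    linarith [hC s hs]
  have hχc : HasCompactSupport χ :=
    IsCompact.of_isClosed_subset (Metric.isCompact_of_isClosed_isBounded
      (isClosed_le hcont continuous_const) hbdd) (isClosed_tsupport χ) hχs
  -- Since `Φ` is holomorphic on the support of `χ`, `∂(χΦ)/∂z̄ = Φ ∂χ/∂z̄`. The Pompeiu formula for
  -- `χΦ`, which equals `Φ` at `x`, then has this weight. It vanishes where `χ` is locally constant.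
  refine ⟨fun z => -wirtingerBar χ z / Real.pi, ?_, ?_, ?_⟩
  · unfold wirtingerBar
    fun_prop
  · intro z hz
    by_contra h
    refine hz ?_
    have : fderiv ℝ χ z = 0 := by
      rcases not_and_or.1 h with h | h
      · rw [(hχ1 z (not_le.1 h)).fderiv_eq, fderiv_fun_const]
        rfl
      · rw [(hχ0 z (not_le.1 h)).fderiv_eq, fderiv_fun_const]
        rfl
    simp [wirtingerBar, this]
  · intro Φ hΦ x hx
    have han : ∀ z, Metric.infDist z σ < κ → DifferentiableAt ℂ Φ z := fun z hz =>
      (hΦ z (le_of_lt hz)).differentiableAt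
    have hg : ContDiff ℝ 1 fun z => χ z * Φ z := by
      refine contDiff_iff_contDiffAt.2 fun z => ?_
      by_cases hz : Metric.infDist z σ ≤ κ₂
      · exact hχ.contDiffAt.mul
          ((hΦ z (hz.trans h2.le)).contDiffAt.restrict_scalars ℝ)
      · refine (contDiffAt_const (c := (0 : ℂ))).congr_of_eventuallyEq ?_
        filter_upwards [hχ0 z (not_le.1 hz)] with y hy
        rw [hy, zero_mul]
    have hgs : HasCompactSupport fun z => χ z * Φ z := hχc.mul_right
    have hbar : ∀ z, wirtingerBar (fun z => χ z * Φ z) z = wirtingerBar χ z * Φ z := by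
      intro z
      by_cases hz : Metric.infDist z σ ≤ κ₂
      · have hd := han z (hz.trans_lt h2)
        have h3 : HasFDerivAt (fun z => χ z * Φ z) _ z :=
          (hχ.differentiable (by norm_num) z).hasFDerivAt.mul
            (hd.hasFDerivAt.restrictScalars ℝ)
        have hI : fderiv ℂ Φ z Complex.I = Complex.I * fderiv ℂ Φ z 1 := by
          rw [← smul_eq_mul, ← map_smul, smul_eq_mul, mul_one]
        simp only [wirtingerBar, h3.fderiv, add_apply, smul_apply, ContinuousLinearMap.coe_restrictScalars',
          smul_eq_mul, hI]
        linear_combination (χ z * fderiv ℂ Φ z 1 / 2) * Complex.I_sq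
      · have h3 : (fun z => χ z * Φ z) =ᶠ[nhds z] fun _ => 0 := by
          filter_upwards [hχ0 z (not_le.1 hz)] with y hy
          rw [hy, zero_mul]
        simp [wirtingerBar, h3.fderiv_eq, (hχ0 z (not_le.1 hz)).fderiv_eq]
    have h4 := integral_wirtingerBar_div_sub hg hgs x
    have hpi : (Real.pi : ℂ) ≠ 0 := by exact_mod_cast Real.pi_ne_zero
    have h5 : χ x = 1 := (hχ1 x hx).self_of_nhds
    simp only [hbar, h5, one_mul] at h4
    have h6 : ∀ z, -wirtingerBar χ z / Real.pi * Φ z / (z - x) =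
        (-(Real.pi : ℂ)⁻¹) * (wirtingerBar χ z * Φ z / (z - x)) := fun z => by
      rw [div_eq_mul_inv _ (Real.pi : ℂ)]
      ring
    simp only [h6]
    rw [integral_const_mul, h4]
    field_simp

/-! ### Cauchy's formula on regions bounded by Lipschitz graphs -/

/-- Lipschitz functions are absolutely continuous, so the fundamental theorem of calculus applies to
the real and imaginary parts. -/
theorem integral_eq_sub_of_lipschitzOn {f f' : ℝ → ℂ} {a b : ℝ} (hab : a ≤ b) {K : NNReal}
    (hf : LipschitzOnWith K f (Icc a b)) (hd : ∀ᵐ x, x ∈ Ioo a b → HasDerivAt f (f' x) x) :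
    ∫ x in a..b, f' x = f b - f a := by
  have hre : AbsolutelyContinuousOnInterval (fun x => (f x).re) a b := by
    refine LipschitzOnWith.absolutelyContinuousOnInterval (K := 1 * K) ?_
    rw [uIcc_of_le hab]
    exact (Complex.reCLM.lipschitz.weaken (by simp)).comp_lipschitzOnWith hf
  have him : AbsolutelyContinuousOnInterval (fun x => (f x).im) a b := by
    refine LipschitzOnWith.absolutelyContinuousOnInterval (K := 1 * K) ?_
    rw [uIcc_of_le hab]
    exact (Complex.imCLM.lipschitz.weaken (by simp)).comp_lipschitzOnWith hf
  have hae : ∀ᵐ x, x ∈ uIoc a b → f' x =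
      ((deriv (fun x => (f x).re) x : ℝ) : ℂ) + Complex.I * ((deriv (fun x => (f x).im) x : ℝ) : ℂ) := by
    filter_upwards [hd, compl_mem_ae_iff.2 (measure_singleton (μ := (volume : Measure ℝ)) b)] with x hx hxb hx2
    rw [uIoc_of_le hab] at hx2
    have hx3 := hx ⟨hx2.1, lt_of_le_of_ne hx2.2 hxb⟩
    have h1 : HasDerivAt (fun x => (f x).re) (f' x).re x :=
      (Complex.reCLM.hasFDerivAt.comp_hasDerivAt x hx3)
    have h2 : HasDerivAt (fun x => (f x).im) (f' x).im x :=
      (Complex.imCLM.hasFDerivAt.comp_hasDerivAt x hx3)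
    rw [h1.deriv, h2.deriv, mul_comm, Complex.re_add_im]
  have hofReal : ∀ {g : ℝ → ℝ}, IntervalIntegrable g volume a b →
      IntervalIntegrable (fun x => (g x : ℂ)) volume a b := fun h =>
    ⟨Integrable.ofReal h.1, Integrable.ofReal h.2⟩
  rw [intervalIntegral.integral_congr_ae hae, intervalIntegral.integral_add
    (hofReal hre.intervalIntegrable_deriv) ((hofReal him.intervalIntegrable_deriv).const_mul _),
    intervalIntegral.integral_const_mul, intervalIntegral.integral_ofReal,
    intervalIntegral.integral_ofReal, hre.integral_deriv_eq_sub, him.integral_deriv_eq_sub]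
  apply Complex.ext <;> simp

theorem exists_lipschitzOn_comp {E : Type*} [NormedAddCommGroup E] [NormedSpace ℝ E]
    {F : E → ℂ} {γ : ℝ → E} {K : NNReal} (hγ : LipschitzWith K γ) {a b : ℝ}
    (hF : ∀ x ∈ Icc a b, ContDiffAt ℝ 1 F (γ x)) :
    ∃ K', LipschitzOnWith K' (fun x => F (γ x)) (Icc a b) := by
  refine LocallyLipschitzOn.exists_lipschitzOnWith_of_compact isCompact_Icc fun x hx => ?_
  obtain ⟨K', t, ht, h⟩ := (hF x hx).exists_lipschitzOnWith
  exact ⟨K' * K, γ ⁻¹' t, mem_nhdsWithin_of_mem_nhds (hγ.continuous.continuousAt ht),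
    h.comp hγ.lipschitzOnWith (mapsTo_preimage γ t)⟩

theorem lipschitzWith_graph {w : ℝ → ℝ} {K : NNReal} (hw : LipschitzWith K w) (s : ℝ) :
    ∃ K', LipschitzWith K' fun x : ℝ => ((x : ℂ) + Complex.I * (s * w x : ℝ)) :=
  ⟨_, Complex.ofRealCLM.lipschitz.add (((lipschitzWith_smul Complex.I).comp
    (Complex.ofRealCLM.lipschitz.comp ((lipschitzWith_smul s).comp hw))))⟩

/-- The graph is deformed to the real axis through `z = x + i s w(x)`. The function `k` is both
`∂/∂x` of `H(z) i w` and `∂/∂s` of `H(z) (1 + i s w')`. Its integral over the rectangle is zero in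
the first form, as `w` vanishes at the end points, and is the difference of the two sides in the
second. Only the first derivative of `w` enters, so Lipschitz regularity is enough. -/
theorem integral_graph_eq_integral_real {H : ℂ → ℂ} {w : ℝ → ℝ} {K : NNReal}
    (hw : LipschitzWith K w) {a b : ℝ} (hab : a ≤ b) (ha : w a = 0) (hb : w b = 0)
    (hH : ∀ x ∈ Icc a b, ∀ s ∈ Icc (0 : ℝ) 1, AnalyticAt ℂ H (x + Complex.I * (s * w x : ℝ))) :
    ∫ x in a..b, H (x + Complex.I * w x) * (1 + Complex.I * deriv w x) = ∫ x in a..b, H x := by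
  let z : ℝ → ℝ → ℂ := fun x s => x + Complex.I * (s * w x : ℝ)
  let k : ℝ → ℝ → ℂ := fun x s => deriv H (z x s) * (1 + Complex.I * (s * deriv w x : ℝ)) *
    (Complex.I * w x) + H (z x s) * (Complex.I * deriv w x)
  have hwc := hw.continuous
  have hzc : Continuous fun p : ℝ × ℝ => z p.1 p.2 := by fun_prop
  have hHc : ContinuousOn (fun p : ℝ × ℝ => H (z p.1 p.2)) (Icc a b ×ˢ Icc 0 1) := fun p hp =>
    ((hH p.1 hp.1 p.2 hp.2).continuousAt.comp (f := fun p : ℝ × ℝ => z p.1 p.2)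
      hzc.continuousAt).continuousWithinAt
  have hH'c : ContinuousOn (fun p : ℝ × ℝ => deriv H (z p.1 p.2)) (Icc a b ×ˢ Icc 0 1) :=
    fun p hp => ((hH p.1 hp.1 p.2 hp.2).deriv.continuousAt.comp (f := fun p : ℝ × ℝ => z p.1 p.2)
      hzc.continuousAt).continuousWithinAt
  have hx : ∀ s ∈ Icc (0 : ℝ) 1, ∫ x in a..b, k x s = 0 := by
    intro s hs
    obtain ⟨K', hK'⟩ := lipschitzWith_graph hw s
    have hiw : LipschitzWith _ fun x : ℝ => Complex.I * (w x : ℂ) :=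
      (lipschitzWith_smul Complex.I).comp (Complex.ofRealCLM.lipschitz.comp hw)
    obtain ⟨K'', hK''⟩ := exists_lipschitzOn_comp (F := fun q : ℂ × ℂ => H q.1 * q.2)
      (hK'.prodMk hiw) (a := a) (b := b) fun x hx =>
        (((hH x hx s hs).contDiffAt.restrict_scalars ℝ).comp
          ((x + Complex.I * (s * w x : ℝ) : ℂ), Complex.I * (w x : ℂ)) contDiffAt_fst).mul
            contDiffAt_snd
    rw [integral_eq_sub_of_lipschitzOn hab hK'' (f' := fun x => k x s)]
    · simp [ha, hb]
    · filter_upwards [hw.ae_differentiableAt_real] with x hx hxI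
      have hw' : HasDerivAt (fun x => (w x : ℂ)) ((deriv w x : ℝ) : ℂ) x := hx.hasDerivAt.ofReal_comp
      have hz' : HasDerivAt (fun x => z x s) (1 + Complex.I * (s * deriv w x : ℝ)) x := by
        have := (Complex.ofRealCLM.hasDerivAt (x := x)).fun_add
          (((hx.hasDerivAt.const_mul s).ofReal_comp).const_mul Complex.I)
        simpa [z] using this
      have h1 := (hH x (Ioo_subset_Icc_self hxI) s hs).differentiableAt.hasDerivAt.comp x hz'
      exact h1.mul (hw'.const_mul Complex.I)
  have hs : ∀ x ∈ Icc a b, ∫ s in (0 : ℝ)..1, k x s =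
      H (x + Complex.I * w x) * (1 + Complex.I * deriv w x) - H x := by
    intro x hx
    rw [intervalIntegral.integral_eq_sub_of_hasDerivAt
      (f := fun s => H (z x s) * (1 + Complex.I * (s * deriv w x : ℝ)))]
    · simp [z]
    · intro s hs
      rw [uIcc_of_le zero_le_one] at hs
      have h0 := (Complex.ofRealCLM.hasDerivAt (x := s))
      have hz' : HasDerivAt (fun s => z x s) (Complex.I * w x) s := by
        have := ((h0.mul_const (w x : ℂ)).const_mul Complex.I).const_add (x : ℂ)
        simpa [z] using this
      have hd' : HasDerivAt (fun s : ℝ => (1 + Complex.I * (s * deriv w x : ℝ) : ℂ))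
          (Complex.I * deriv w x) s := by
        have := ((h0.mul_const ((deriv w x : ℝ) : ℂ)).const_mul Complex.I).const_add (1 : ℂ)
        simpa using this
      have h1 := (hH x hx s hs).differentiableAt.hasDerivAt.comp s hz'
      refine (h1.mul hd').congr_deriv ?_
      simp only [k, z, Function.comp]
      ring
    · have hi : ∀ s ∈ Icc (0 : ℝ) 1, (x, s) ∈ Icc a b ×ˢ Icc (0 : ℝ) 1 := fun s hs => ⟨hx, hs⟩
      have hp : ContinuousOn (fun s : ℝ => (x, s)) (Icc 0 1) := by fun_prop
      refine ContinuousOn.intervalIntegrable ?_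
      rw [uIcc_of_le zero_le_one]
      exact (((hH'c.comp hp hi).mul (by fun_prop)).mul (by fun_prop)).add
        ((hHc.comp hp hi).mul (by fun_prop))
  have hki : Integrable (Function.uncurry k)
      ((volume.restrict (uIoc a b)).prod (volume.restrict (uIoc (0 : ℝ) 1))) := by
    rw [Measure.prod_restrict, uIoc_of_le hab, uIoc_of_le zero_le_one]
    have hm : Measurable fun p : ℝ × ℝ => ((deriv w p.1 : ℝ) : ℂ) :=
      Complex.measurable_ofReal.comp ((measurable_deriv w).comp measurable_fst)
    have hb' : ∀ p : ℝ × ℝ, ‖((deriv w p.1 : ℝ) : ℂ)‖ ≤ K := fun p => by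
      rw [Complex.norm_real]
      exact norm_deriv_le_of_lipschitz hw
    -- `k` is affine in `deriv w x`, which is merely bounded and measurable; the two coefficients
    -- are continuous on the closed rectangle.
    have h1 : IntegrableOn (fun p : ℝ × ℝ => deriv H (z p.1 p.2) * (Complex.I * w p.1))
        (Icc a b ×ˢ Icc 0 1) (volume.prod volume) :=
      (hH'c.mul (by fun_prop)).integrableOn_compact (isCompact_Icc.prod isCompact_Icc)
    have h2 : IntegrableOn (fun p : ℝ × ℝ => deriv H (z p.1 p.2) * (Complex.I * p.2) *
        (Complex.I * w p.1) + H (z p.1 p.2) * Complex.I)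
        (Icc a b ×ˢ Icc 0 1) (volume.prod volume) :=
      (((hH'c.mul (by fun_prop)).mul (by fun_prop)).add
        (hHc.mul (by fun_prop))).integrableOn_compact (isCompact_Icc.prod isCompact_Icc)
    have h3 := h2.mul_bdd hm.aestronglyMeasurable (Filter.Eventually.of_forall hb')
    have h4 := (h1.add h3).mono_set (prod_mono Ioc_subset_Icc_self Ioc_subset_Icc_self)
    refine h4.congr (Filter.Eventually.of_forall fun p => ?_)
    simp only [k, Function.uncurry, Pi.add_apply]
    push_cast
    ring
  have hF := integral_integral_swap hki
  rw [uIoc_of_le hab, uIoc_of_le zero_le_one] at hF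
  simp only [← intervalIntegral.integral_of_le hab,
    ← intervalIntegral.integral_of_le (zero_le_one' ℝ)] at hF
  rw [intervalIntegral.integral_congr (a := (0 : ℝ)) (b := 1) (g := fun _ => (0 : ℂ))
    (fun s hs => hx s (by rwa [uIcc_of_le zero_le_one] at hs)),
    intervalIntegral.integral_congr (a := a) (b := b) 
    (fun x hx => hs x (by rwa [uIcc_of_le hab] at hx)), intervalIntegral.integral_zero] at hF
  have hz1 : Continuous fun x : ℝ => (x + Complex.I * w x : ℂ) := by fun_prop
  have hi1 : IntervalIntegrable (fun x : ℝ => H (x + Complex.I * w x)) volume a b := by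
    refine ContinuousOn.intervalIntegrable ?_
    rw [uIcc_of_le hab]
    intro x hx
    have := (hH x hx 1 (by simp)).continuousAt
    rw [one_mul] at this
    exact (this.comp (f := fun x : ℝ => (x + Complex.I * w x : ℂ))
      hz1.continuousAt).continuousWithinAt
  have hi0 : IntervalIntegrable (fun x : ℝ => H x) volume a b := by
    refine ContinuousOn.intervalIntegrable ?_
    rw [uIcc_of_le hab]
    intro x hx
    have := (hH x hx 0 (by simp)).continuousAt
    simp only [zero_mul, Complex.ofReal_zero, mul_zero, add_zero] at this
    exact (this.comp (f := fun x : ℝ => (x : ℂ)) (by fun_prop)).continuousWithinAt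
  have hi2 : IntervalIntegrable (fun x : ℝ => H (x + Complex.I * w x) *
      (1 + Complex.I * deriv w x)) volume a b := by
    rw [intervalIntegrable_iff] at hi1 ⊢
    refine hi1.mul_bdd (c := 1 + K) ?_ (Filter.Eventually.of_forall fun x => ?_)
    · exact (measurable_const.add (measurable_const.mul
        (Complex.measurable_ofReal.comp (measurable_deriv w)))).aestronglyMeasurable
    · refine (norm_add_le _ _).trans ?_
      rw [norm_mul, Complex.norm_I, norm_one, one_mul, Complex.norm_real]
      exact add_le_add le_rfl (norm_deriv_le_of_lipschitz hw)
  rw [intervalIntegral.integral_sub hi2 hi0] at hF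
  exact sub_eq_zero.1 hF

/-- The factor `θ` rotates the curve away from the branch cut, so that `log (θ (ζ - z₀))` is a
primitive of `1 / (ζ - z₀)` along it. -/
theorem integral_graph_inv {w : ℝ → ℝ} {K : NNReal} (hw : LipschitzWith K w) {a b : ℝ}
    (hab : a ≤ b) {z₀ θ : ℂ} 
    (hz : ∀ x ∈ Icc a b, θ * (x + Complex.I * w x - z₀) ∈ Complex.slitPlane) :
    ∫ x in a..b, (1 + Complex.I * deriv w x) / (x + Complex.I * w x - z₀) =
      Complex.log (θ * (b + Complex.I * w b - z₀)) -
        Complex.log (θ * (a + Complex.I * w a - z₀)) := by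
  obtain ⟨K', hK'⟩ := lipschitzWith_graph hw 1
  simp only [one_mul] at hK'
  have han : ∀ ζ, θ * (ζ - z₀) ∈ Complex.slitPlane →
      AnalyticAt ℂ (fun ζ => Complex.log (θ * (ζ - z₀))) ζ := fun ζ hζ =>
    AnalyticAt.clog (by fun_prop) hζ
  obtain ⟨K'', hK''⟩ := exists_lipschitzOn_comp (F := fun ζ => Complex.log (θ * (ζ - z₀)))
      hK' (a := a) (b := b) fun x hx => (han _ (hz x hx)).contDiffAt.restrict_scalars ℝ
  rw [← integral_eq_sub_of_lipschitzOn hab hK'']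
  filter_upwards [hw.ae_differentiableAt_real] with x hx hxI
  have hz' : HasDerivAt (fun x : ℝ => (x + Complex.I * w x : ℂ)) (1 + Complex.I * (deriv w x : ℝ)) x := by
    have := (Complex.ofRealCLM.hasDerivAt (x := x)).fun_add
      ((hx.hasDerivAt.ofReal_comp).const_mul Complex.I)
    simpa using this
  have hs := hz x (Ioo_subset_Icc_self hxI)
  have h2 := ((hz'.sub_const z₀).const_mul θ).clog_real hs
  refine h2.congr_deriv ?_
  have hθ : θ ≠ 0 := fun h => Complex.slitPlane_ne_zero hs (by rw [h, zero_mul])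
  rw [mul_div_mul_left _ _ hθ]

theorem log_sub_log_neg {z : ℂ} (hz : 0 < z.im) :
    Complex.log z - Complex.log (-z) = Real.pi * Complex.I := by
  rw [Complex.log, Complex.log, norm_neg, Complex.arg_neg_eq_arg_sub_pi_of_im_pos hz]
  push_cast
  ring

/-- Cauchy's formula for the region `{x + i y | |y| ≤ w(x)}` below the graph of a Lipschitz
function. -/
theorem integral_graph_cauchy {G : ℂ → ℂ} {w : ℝ → ℝ} {K : NNReal} (hw : LipschitzWith K w)
    {a b : ℝ} (hw0 : ∀ x ∈ Icc a b, 0 ≤ w x) (ha : w a = 0) (hb : w b = 0)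
    (hG : ∀ x ∈ Icc a b, ∀ y, |y| ≤ w x → AnalyticAt ℂ G (x + Complex.I * (y : ℝ)))
    {z₀ : ℂ} (haz : a < z₀.re) (hzb : z₀.re < b) (hz₀ : |z₀.im| < w z₀.re) :
    (∫ x in a..b, G (x - Complex.I * w x) / (x - Complex.I * w x - z₀) *
        (1 - Complex.I * deriv w x)) -
      (∫ x in a..b, G (x + Complex.I * w x) / (x + Complex.I * w x - z₀) *
        (1 + Complex.I * deriv w x)) =
      2 * Real.pi * Complex.I * G z₀ := by
  have hab : a ≤ b := (haz.trans hzb).le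
  have hwn : LipschitzWith K fun x => -w x := hw.neg
  -- The splitting `G(ζ)/(ζ - z₀) = H(ζ) + G(z₀)/(ζ - z₀)` isolates the pole. The integrals of the
  -- analytic part `H` over the two graphs both equal that over `[a, b]` and cancel.
  let H := dslope G z₀
  have hHan : ∀ ζ, AnalyticAt ℂ G ζ → AnalyticAt ℂ H ζ := by
    intro ζ hζ
    have hGz : AnalyticAt ℂ G z₀ := by
      have := hG z₀.re ⟨haz.le, hzb.le⟩ z₀.im hz₀.le
      rwa [mul_comm, Complex.re_add_im] at this
    have hU : IsOpen {ζ | AnalyticAt ℂ G ζ} := isOpen_analyticAt ℂ G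
    have hd : DifferentiableOn ℂ H {ζ | AnalyticAt ℂ G ζ} :=
      (Complex.differentiableOn_dslope (hU.mem_nhds hGz)).2 fun ζ hζ =>
        hζ.differentiableAt.differentiableWithinAt
    exact hd.analyticAt (hU.mem_nhds hζ)
  have hup := integral_graph_eq_integral_real hw hab ha hb (H := H) fun x hx s hs =>
    hHan _ (hG x hx _ (by
      rw [abs_mul, abs_of_nonneg hs.1, abs_of_nonneg (hw0 x hx)]
      exact mul_le_of_le_one_left (hw0 x hx) hs.2))
  have hlo := integral_graph_eq_integral_real hwn hab (by simp [ha]) (by simp [hb])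
    (H := H) fun x hx s hs => hHan _ (hG x hx _ (by
      rw [abs_mul, abs_neg, abs_of_nonneg hs.1, abs_of_nonneg (hw0 x hx)]
      exact mul_le_of_le_one_left (hw0 x hx) hs.2))
  -- The upper graph avoids the vertical ray going down from `z₀` and the lower graph the ray going
  -- up. The rotations by `-i` and `i` carry these rays to the cut of the logarithm. At each of `a`
  -- and `b` the two branches differ by `πi` up to sign, and together they give `2πi`.
  have hslit : ∀ x : ℝ, x ∈ Icc a b →
      -Complex.I * (x + Complex.I * w x - z₀) ∈ Complex.slitPlane ∧
      Complex.I * (x + Complex.I * (-w x : ℝ) - z₀) ∈ Complex.slitPlane := by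
    intro x hx
    rw [Complex.mem_slitPlane_iff, Complex.mem_slitPlane_iff]
    simp only [neg_mul, Complex.neg_re, Complex.mul_re, Complex.I_re, Complex.sub_re,
      Complex.add_re, Complex.ofReal_re, Complex.ofReal_im, Complex.I_im, Complex.sub_im,
      Complex.add_im, Complex.mul_im, Complex.neg_im, zero_mul, one_mul, mul_zero]
    by_cases hxz : x = z₀.re
    · rw [hxz]
      have := abs_lt.1 hz₀
      constructor <;> left <;> linarith
    · constructor <;> right
      · intro h
        apply hxz
        linarith
      · intro h
        apply hxz
        linarith
  have hpu := integral_graph_inv hw hab fun x hx => (hslit x hx).1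
  have hpl := integral_graph_inv hwn hab fun x hx => (hslit x hx).2
  have hl1 : Complex.log (Complex.I * (b - z₀)) - Complex.log (-Complex.I * (b - z₀)) =
      Real.pi * Complex.I := by
    rw [neg_mul]
    exact log_sub_log_neg (by simpa using hzb)
  have hl2 : Complex.log (-Complex.I * (a - z₀)) - Complex.log (Complex.I * (a - z₀)) =
      Real.pi * Complex.I := by
    have := log_sub_log_neg (z := -Complex.I * (a - z₀)) (by simpa using haz)
    rw [neg_mul, neg_neg] at this
    rwa [neg_mul]
  have hne : ∀ ζ θ : ℂ, θ * (ζ - z₀) ∈ Complex.slitPlane → ζ - z₀ ≠ 0 := fun ζ θ h h0 =>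
    Complex.slitPlane_ne_zero h (by rw [h0, mul_zero])
  have hsplit : ∀ ζ, ζ - z₀ ≠ 0 → ∀ D : ℂ,
      G ζ / (ζ - z₀) * D = H ζ * D + G z₀ * (D / (ζ - z₀)) := by
    intro ζ h D
    have : H ζ = (ζ - z₀)⁻¹ * (G ζ - G z₀) := by
      simp only [H]
      rw [dslope_of_ne _ (sub_ne_zero.1 h), slope_def_module, smul_eq_mul]
    rw [this]
    field_simp
    ring
  have hbd : ∀ (v : ℝ → ℝ), LipschitzWith K v → (∀ x ∈ Icc a b, |v x| ≤ w x) →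
      (∀ x ∈ Icc a b, (x + Complex.I * v x - z₀ : ℂ) ≠ 0) →
      ∫ x in a..b, G (x + Complex.I * v x) / (x + Complex.I * v x - z₀) *
        (1 + Complex.I * deriv v x) =
      (∫ x in a..b, H (x + Complex.I * v x) * (1 + Complex.I * deriv v x)) +
        G z₀ * ∫ x in a..b, (1 + Complex.I * deriv v x) / (x + Complex.I * v x - z₀) := by
    intro v hv hvw hvz
    have hvc := hv.continuous
    have hz1 : Continuous fun x : ℝ => (x + Complex.I * v x : ℂ) := by fun_prop
    have hmul : ∀ f : ℝ → ℂ, ContinuousOn f (Icc a b) →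
        IntervalIntegrable (fun x => f x * (1 + Complex.I * deriv v x)) volume a b := by
      intro f hf
      have hf' : IntervalIntegrable f volume a b :=
        ContinuousOn.intervalIntegrable (by rwa [uIcc_of_le hab])
      rw [intervalIntegrable_iff] at hf' ⊢
      refine hf'.mul_bdd (c := 1 + K) ?_ (Filter.Eventually.of_forall fun x => ?_)
      · exact (measurable_const.add (measurable_const.mul
          (Complex.measurable_ofReal.comp (measurable_deriv v)))).aestronglyMeasurable
      · refine (norm_add_le _ _).trans ?_
        rw [norm_mul, Complex.norm_I, norm_one, one_mul, Complex.norm_real]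
        exact add_le_add le_rfl (norm_deriv_le_of_lipschitz hv)
    rw [intervalIntegral.integral_congr fun x hx =>
      hsplit _ (hvz x (by rwa [uIcc_of_le hab] at hx)) _, intervalIntegral.integral_add,
      intervalIntegral.integral_const_mul]
    · exact hmul _ fun x hx => ((hHan _ (hG x hx _ (hvw x hx))).continuousAt.comp
        (f := fun x : ℝ => (x + Complex.I * v x : ℂ)) hz1.continuousAt).continuousWithinAt
    · refine IntervalIntegrable.const_mul ?_ _
      have := hmul (fun x => (x + Complex.I * v x - z₀ : ℂ)⁻¹)
        ((hz1.sub continuous_const).continuousOn.inv₀ hvz)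
      simpa only [div_eq_mul_inv, mul_comm] using this
  have e1 := hbd w hw (fun x hx => (abs_of_nonneg (hw0 x hx)).le)
    fun x hx => hne _ _ (hslit x hx).1
  have e2 := hbd (fun x => -w x) hwn (fun x hx => (by rw [abs_neg, abs_of_nonneg (hw0 x hx)]))
    fun x hx => hne _ _ (hslit x hx).2
  rw [hup, hpu] at e1
  rw [hlo, hpl] at e2
  rw [e1]
  have hd : ∀ x, deriv (fun x => -w x) x = -deriv w x := fun x => deriv.fun_neg
  simp only [hd, Complex.ofReal_neg, mul_neg, ← sub_eq_add_neg] at e2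
  rw [e2]
  simp only [ha, hb, Complex.ofReal_zero, mul_zero, add_zero, sub_zero]
  linear_combination G z₀ * (hl1 + hl2)

/-! ### The level sets of the distance function have finite length -/

open scoped MeasureTheory in
theorem hausdorffMeasure_unitCircle_lt_top :
    (Measure.hausdorffMeasure 1 : Measure ℂ) (Metric.sphere 0 1) < ∞ := by
  have hc : ContDiff ℝ 1 fun θ : ℝ => Complex.exp (θ * Complex.I) :=
    (Complex.ofRealCLM.contDiff.mul contDiff_const).cexp
  obtain ⟨K, hK⟩ := hc.contDiffOn.exists_lipschitzOnWith (s := Icc (-Real.pi) Real.pi) one_ne_zero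
    (convex_Icc _ _) isCompact_Icc
  have hsub : Metric.sphere (0 : ℂ) 1 ⊆
      (fun θ : ℝ => Complex.exp (θ * Complex.I)) '' Icc (-Real.pi) Real.pi := by
    intro z hz
    refine ⟨z.arg, ⟨(Complex.neg_pi_lt_arg z).le, Complex.arg_le_pi z⟩, ?_⟩
    have := Complex.norm_mul_exp_arg_mul_I z
    rw [mem_sphere_zero_iff_norm.1 hz] at this
    simpa using this
  refine (measure_mono hsub).trans_lt ((hK.hausdorffMeasure_image_le zero_le_one).trans_lt ?_)
  rw [hausdorffMeasure_real, Real.volume_Icc]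
  exact ENNReal.mul_lt_top (by simp) ENNReal.ofReal_lt_top

/-- Seen from `c`, the level set is a Lipschitz radial graph. Let `y` be the point of the segment
from `c` to `z'` at the same radius as `z`, and `s ∈ T` nearest to `z'`. Moving from `z'` to `y`
shortens the distance to `s` by at least a fixed fraction of `‖y - z'‖`, because `T` is concentrated
near `c`. As `z` stays at distance `κ` from `s`, this forces `‖y - z'‖ ≤ (9/7) ‖z - y‖`, and `‖z -
y‖` is the radius times the distance of the directions. -/
theorem dist_le_of_infDist_eq {T : Set ℂ} (hT : IsCompact T) (hne : T.Nonempty) {c : ℂ} {κ : ℝ}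
    (hκ : 0 < κ) (hTc : T ⊆ Metric.closedBall c (κ / 8)) {z z' : ℂ}
    (hz : Metric.infDist z T = κ) (hz' : Metric.infDist z' T = κ) (hr : ‖z - c‖ ≤ ‖z' - c‖) :
    ‖z - z'‖ ≤ 4 * κ * ‖(‖z - c‖⁻¹ : ℂ) * (z - c) - (‖z' - c‖⁻¹ : ℂ) * (z' - c)‖ := by
  have hge : ∀ s ∈ T, κ ≤ ‖z - s‖ := fun s hs => by
    rw [← hz, ← dist_eq_norm]
    exact Metric.infDist_le_dist_of_mem hs
  have hsc : ∀ s ∈ T, ‖s - c‖ ≤ κ / 8 := fun s hs => by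
    rw [← dist_eq_norm]
    exact hTc hs
  obtain ⟨s, hs, hzs⟩ := hT.exists_infDist_eq_dist hne z'
  obtain ⟨s₁, hs₁, hzs₁⟩ := hT.exists_infDist_eq_dist hne z
  rw [hz', dist_eq_norm] at hzs
  rw [hz, dist_eq_norm] at hzs₁
  set r := ‖z - c‖ with hrdef
  set r' := ‖z' - c‖ with hr'def
  have h1 : 7 * κ / 8 ≤ r := by
    have h2 : ‖z - s₁‖ ≤ r + ‖s₁ - c‖ := by
      rw [hrdef, show z - s₁ = (z - c) - (s₁ - c) by ring]
      exact norm_sub_le _ _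
    linarith [hsc s₁ hs₁]
  have h1' : r ≤ 9 * κ / 8 := by
    have h2 : r ≤ ‖z - s₁‖ + ‖s₁ - c‖ := by
      rw [hrdef, show z - c = (z - s₁) + (s₁ - c) by ring]
      exact norm_add_le _ _
    linarith [hsc s₁ hs₁]
  have hr0 : 0 < r := by linarith
  have hr'0 : 0 < r' := hr0.trans_le hr
  have hrc : (r : ℂ) ≠ 0 := by exact_mod_cast hr0.ne'
  have hrc' : (r' : ℂ) ≠ 0 := by exact_mod_cast hr'0.ne'
  set t := r / r' with ht
  have htc : (t : ℂ) = r / r' := by rw [ht]; push_cast; rfl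
  have ht1 : t ≤ 1 := (div_le_one hr'0).2 hr
  have ht0 : 0 ≤ t := by positivity
  set y := c + (t : ℂ) * (z' - c) with hy
  have e1 : ‖z - y‖ = r * ‖(r⁻¹ : ℂ) * (z - c) - (r'⁻¹ : ℂ) * (z' - c)‖ := by
    have : z - y = (r : ℂ) * ((r⁻¹ : ℂ) * (z - c) - (r'⁻¹ : ℂ) * (z' - c)) := by
      rw [hy, htc]
      field_simp
      ring
    rw [this, norm_mul, Complex.norm_real, Real.norm_of_nonneg hr0.le]
  have e2 : ‖y - z'‖ = r' - r := by
    have : y - z' = ((t - 1 : ℝ) : ℂ) * (z' - c) := by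
      rw [hy]
      push_cast
      ring
    rw [this, norm_mul, Complex.norm_real, Real.norm_of_nonpos (by linarith), ← hr'def, ht]
    field_simp
    ring
  have e3 : ‖y - s‖ ≤ (1 - t) * ‖s - c‖ + t * ‖z' - s‖ := by
    have : y - s = ((1 - t : ℝ) : ℂ) * (c - s) + (t : ℂ) * (z' - s) := by
      rw [hy]
      push_cast
      ring
    rw [this]
    refine (norm_add_le _ _).trans ?_
    rw [norm_mul, norm_mul, Complex.norm_real, Complex.norm_real,
      Real.norm_of_nonneg (by linarith), Real.norm_of_nonneg ht0, norm_sub_rev c s]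
  have e4 : r' - κ / 8 ≤ κ := by
    have h2 : r' ≤ ‖z' - s‖ + ‖s - c‖ := by
      rw [hr'def, show z' - c = (z' - s) + (s - c) by ring]
      exact norm_add_le _ _
    linarith [hsc s hs]
  have e5 : ‖z - s‖ ≤ ‖z - y‖ + ‖y - s‖ := by
    rw [show z - s = (z - y) + (y - s) by ring]
    exact norm_add_le _ _
  have e6 : (1 - t) * r' = r' - r := by
    rw [ht]
    field_simp
  have e7 : (1 - t) * (7 * κ / 8) ≤ ‖z - y‖ := by
    rw [← hzs] at e3
    nlinarith [hge s hs, hsc s hs, norm_nonneg (s - c), mul_le_mul_of_nonneg_left (hsc s hs) (sub_nonneg.2 ht1)]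
  have e8 : r' - r ≤ 9 / 7 * ‖z - y‖ := by
    rw [← e6]
    nlinarith [mul_le_mul_of_nonneg_left e4 (sub_nonneg.2 ht1)]
  have e9 : ‖z - z'‖ ≤ ‖z - y‖ + ‖y - z'‖ := by
    rw [show z - z' = (z - y) + (y - z') by ring]
    exact norm_add_le _ _
  have e10 := norm_nonneg ((r⁻¹ : ℂ) * (z - c) - (r'⁻¹ : ℂ) * (z' - c))
  have e11 := mul_le_mul_of_nonneg_right h1' e10
  rw [← e1] at e11
  linarith

/-- The projection to directions from `c` is injective on the level set with Lipschitz inverse, so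
the level set is a Lipschitz image of a part of the unit circle. -/
theorem hausdorffMeasure_infDist_eq_lt_top_of_small {T : Set ℂ} (hT : IsCompact T)
    (hne : T.Nonempty) {c : ℂ} {κ : ℝ} (hκ : 0 < κ) (hTc : T ⊆ Metric.closedBall c (κ / 8)) :
    (Measure.hausdorffMeasure 1 : Measure ℂ) {z | Metric.infDist z T = κ} < ∞ := by
  let p : ℂ → ℂ := fun z => (‖z - c‖⁻¹ : ℂ) * (z - c)
  set A := {z : ℂ | Metric.infDist z T = κ}
  have hdist : ∀ z ∈ A, ∀ z' ∈ A, ‖z - z'‖ ≤ 4 * κ * ‖p z - p z'‖ := by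
    intro z hz z' hz'
    rcases le_total ‖z - c‖ ‖z' - c‖ with h | h
    · exact dist_le_of_infDist_eq hT hne hκ hTc hz hz' h
    · rw [norm_sub_rev z, norm_sub_rev (p z)]
      exact dist_le_of_infDist_eq hT hne hκ hTc hz' hz h
  have hinj : InjOn p A := fun z hz z' hz' h => by
    have := hdist z hz z' hz'
    rw [h, sub_self, norm_zero, mul_zero] at this
    exact sub_eq_zero.1 (norm_le_zero_iff.1 this)
  have hL : LipschitzOnWith (Real.toNNReal (4 * κ)) (Function.invFunOn p A) (p '' A) := by
    refine LipschitzOnWith.of_dist_le_mul ?_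
    rintro _ ⟨z, hz, rfl⟩ _ ⟨z', hz', rfl⟩
    rw [hinj.leftInvOn_invFunOn hz, hinj.leftInvOn_invFunOn hz',
      Real.coe_toNNReal _ (by positivity), dist_eq_norm, dist_eq_norm]
    exact hdist z hz z' hz'
  have hA : Function.invFunOn p A '' (p '' A) = A := hinj.leftInvOn_invFunOn.image_image
  -- The extra point `0` is the value of `p` at `c` itself, where the inverse of the norm is `0` by
  -- convention.
  have hp : p '' A ⊆ Metric.sphere 0 1 ∪ {0} := by
    rintro _ ⟨z, -, rfl⟩
    by_cases h : z - c = 0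
    · right
      simp [p, h]
    · left
      rw [mem_sphere_zero_iff_norm]
      simp only [p]
      rw [norm_mul, norm_inv, Complex.norm_real, norm_norm, inv_mul_cancel₀ (norm_ne_zero_iff.2 h)]
  have h1 := hL.hausdorffMeasure_image_le (d := 1) zero_le_one
  rw [hA] at h1
  refine h1.trans_lt (ENNReal.mul_lt_top (by simp) ((measure_mono hp).trans_lt
    ((measure_union_le _ _).trans_lt (ENNReal.add_lt_top.2
      ⟨hausdorffMeasure_unitCircle_lt_top, ?_⟩))))
  have := Measure.nullSingletonClass_hausdorff ℂ (d := 1) one_pos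
  simp

/-- Cut `σ` into finitely many pieces of radius `κ/8`: a point at distance `κ` from `σ` is at
distance `κ` from the piece containing its nearest point. Finiteness makes the integral in
`contourNorm` a genuine one for functions continuous on the level set; a divergent Bochner integral
would be `0` by convention and bound nothing. -/
theorem hausdorffMeasure_infDist_eq_lt_top {σ : Set ℂ} (hσ : IsCompact σ) (hne : σ.Nonempty)
    {κ : ℝ} (hκ : 0 < κ) :
    (Measure.hausdorffMeasure 1 : Measure ℂ) {z | Metric.infDist z σ = κ} < ∞ := by
  obtain ⟨t, hts, htf, ht⟩ := hσ.finite_cover_balls (e := κ / 8) (by positivity)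
  have hsub : {z : ℂ | Metric.infDist z σ = κ} ⊆
      ⋃ c ∈ t, {z | Metric.infDist z (σ ∩ Metric.closedBall c (κ / 8)) = κ} := by
    intro z hz
    obtain ⟨s, hs, hzs⟩ := hσ.exists_infDist_eq_dist hne z
    obtain ⟨c, hc, hsc⟩ := mem_iUnion₂.1 (ht hs)
    have hs' : s ∈ σ ∩ Metric.closedBall c (κ / 8) := ⟨hs, Metric.ball_subset_closedBall hsc⟩
    refine mem_iUnion₂.2 ⟨c, hc, le_antisymm ?_ ?_⟩
    · exact (Metric.infDist_le_dist_of_mem hs').trans (hzs ▸ (le_of_eq hz))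
    · exact (le_of_eq hz.symm).trans
        (Metric.infDist_le_infDist_of_subset inter_subset_left ⟨s, hs'⟩)
  refine (measure_mono hsub).trans_lt ((measure_biUnion_lt_top htf fun c hc => ?_))
  exact hausdorffMeasure_infDist_eq_lt_top_of_small (hσ.inter_right Metric.isClosed_closedBall)
    ⟨c, hts hc, Metric.mem_closedBall_self (by positivity)⟩ hκ inter_subset_right

/-- The integral over a graph with respect to the abscissa is bounded by the integral with respect
to the arc length. -/
theorem integral_graph_le_hausdorff {Γ : Set ℂ} (hΓ : IsCompact Γ)
    (hfin : (Measure.hausdorffMeasure 1 : Measure ℂ) Γ < ∞) {f : ℂ → ℝ} (hf : ContinuousOn f Γ)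
    (hf0 : ∀ z, 0 ≤ f z) {g : ℝ → ℂ} (hg : Continuous g) (hgre : ∀ x, (g x).re = x) {a b : ℝ}
    (hab : a ≤ b) (hgΓ : ∀ x ∈ Icc a b, g x ∈ Γ) :
    ∫ x in a..b, f (g x) ≤ ∫ z in Γ, f z ∂(Measure.hausdorffMeasure 1) := by
  let μ : Measure ℂ := Measure.hausdorffMeasure 1
  -- Clamping the abscissa to `[a, b]` makes the integrand continuous and bounded on the whole line.
  let F : ℝ → ℝ := fun x => f (g (projIcc a b hab x))
  have hF : Continuous F := by
    refine hf.comp_continuous (hg.comp (continuous_subtype_val.comp continuous_projIcc)) fun x => ?_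
    exact hgΓ _ (projIcc a b hab x).2
  have hΓm : MeasurableSet Γ := hΓ.measurableSet
  have hΓ'c : IsCompact (g '' Icc a b) := isCompact_Icc.image hg
  have hsub : g '' Icc a b ⊆ Γ := by
    rintro _ ⟨x, hx, rfl⟩
    exact hgΓ x hx
  have hfin' : IsFiniteMeasure (μ.restrict (g '' Icc a b)) :=
    ⟨by rw [Measure.restrict_apply_univ]; exact (measure_mono hsub).trans_lt hfin⟩
  have hre : Measurable Complex.re := Complex.measurable_re
  -- `Re` is 1-Lipschitz and does not increase one-dimensional Hausdorff measure; on the line this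
  -- measure is Lebesgue measure.
  have hle : volume.restrict (Icc a b) ≤ (μ.restrict (g '' Icc a b)).map Complex.re := by
    refine Measure.le_iff.2 fun A hA => ?_
    rw [Measure.restrict_apply hA, Measure.map_apply hre hA, Measure.restrict_apply (hre hA)]
    have h1 : A ∩ Icc a b ⊆ Complex.re '' (Complex.re ⁻¹' A ∩ g '' Icc a b) := fun x hx =>
      ⟨g x, ⟨by rw [mem_preimage, hgre]; exact hx.1, mem_image_of_mem g hx.2⟩, hgre x⟩
    refine (measure_mono h1).trans ?_
    have h2 : LipschitzWith 1 Complex.re := Complex.reCLM.lipschitz.weaken (by simp)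
    have := h2.hausdorffMeasure_image_le (d := 1) zero_le_one (Complex.re ⁻¹' A ∩ g '' Icc a b)
    rw [hausdorffMeasure_real] at this
    simpa using this
  have hFb : ∃ C, ∀ x, ‖F x‖ ≤ C := by
    obtain ⟨C, hC⟩ := hΓ.exists_bound_of_continuousOn hf
    exact ⟨C, fun x => hC _ (hgΓ _ (projIcc a b hab x).2)⟩
  obtain ⟨C, hC⟩ := hFb
  have hFi : Integrable F ((μ.restrict (g '' Icc a b)).map Complex.re) :=
    have := Measure.isFiniteMeasure_map (μ.restrict (g '' Icc a b)) Complex.re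
    Integrable.of_bound hF.aestronglyMeasurable C (Filter.Eventually.of_forall hC)
  calc ∫ x in a..b, f (g x) = ∫ x in Icc a b, F x := by
        rw [intervalIntegral.integral_of_le hab, integral_Icc_eq_integral_Ioc]
        refine setIntegral_congr_fun measurableSet_Ioc fun x hx => ?_
        simp only [F]
        rw [projIcc_of_mem hab (Ioc_subset_Icc_self hx)]
    _ ≤ ∫ x, F x ∂((μ.restrict (g '' Icc a b)).map Complex.re) :=
        integral_mono_measure hle (Filter.Eventually.of_forall fun x => hf0 _) hFi
    _ = ∫ z in g '' Icc a b, F z.re ∂μ := integral_map hre.aemeasurable hF.aestronglyMeasurable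
    _ = ∫ z in g '' Icc a b, f z ∂μ := by
        refine setIntegral_congr_fun hΓ'c.measurableSet ?_
        rintro _ ⟨x, hx, rfl⟩
        simp only [F]
        rw [hgre, projIcc_of_mem hab hx]
    _ ≤ ∫ z in Γ, f z ∂μ := by
        have : IsFiniteMeasure (μ.restrict Γ) := ⟨by rwa [Measure.restrict_apply_univ]⟩
        obtain ⟨C, hC⟩ := hΓ.exists_bound_of_continuousOn hf
        refine setIntegral_mono_set ?_ (Filter.Eventually.of_forall hf0)
          (Filter.Eventually.of_forall hsub)
        refine Integrable.of_bound (hf.aestronglyMeasurable hΓm) C ?_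
        exact (ae_restrict_mem hΓm).mono hC

/-! ### Bounds near a real compact set by integrals over the level set of the distance -/

/-- Pythagoras for each real point, followed by minimisation. It describes the level set as the two
graphs `±√(κ² - dist (x, S)²)`. -/
theorem infDist_ofReal_image_sq {S : Set ℝ} (hS : IsCompact S) (hne : S.Nonempty) (z : ℂ) :
    Metric.infDist z (Complex.ofReal '' S) ^ 2 = Metric.infDist z.re S ^ 2 + z.im ^ 2 := by
  have hsq : ∀ s : ℝ, dist z s ^ 2 = dist z.re s ^ 2 + z.im ^ 2 := fun s => by
    rw [Complex.dist_eq, Complex.sq_norm, Complex.normSq_apply, Real.dist_eq, sq_abs]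
    simp
    ring
  obtain ⟨s, hs, h1⟩ := hS.exists_infDist_eq_dist hne z.re
  obtain ⟨_, ⟨t, ht, rfl⟩, h2⟩ :=
    (hS.image Complex.continuous_ofReal).exists_infDist_eq_dist (hne.image _) z
  refine le_antisymm ?_ ?_
  · rw [h1, ← hsq]
    exact pow_le_pow_left₀ Metric.infDist_nonneg
      (Metric.infDist_le_dist_of_mem (mem_image_of_mem _ hs)) 2
  · rw [h2, hsq]
    have := pow_le_pow_left₀ Metric.infDist_nonneg (Metric.infDist_le_dist_of_mem (x := z.re) ht) 2
    linarith

/-- The squared height `κ² - dist (x, S)²` of the level set over the point `x`. -/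
def heightSq (S : Set ℝ) (κ x : ℝ) : ℝ := κ ^ 2 - min (Metric.infDist x S) κ ^ 2

theorem heightSq_nonneg (S : Set ℝ) {κ : ℝ} (hκ : 0 < κ) (x : ℝ) : 0 ≤ heightSq S κ x := by
  have h1 : 0 ≤ min (Metric.infDist x S) κ := le_min Metric.infDist_nonneg hκ.le
  have h2 : min (Metric.infDist x S) κ ≤ κ := min_le_right _ _
  unfold heightSq
  nlinarith

theorem heightSq_le (S : Set ℝ) (κ x : ℝ) : heightSq S κ x ≤ κ ^ 2 := by
  unfold heightSq
  nlinarith [sq_nonneg (min (Metric.infDist x S) κ)]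

theorem lipschitzWith_heightSq (S : Set ℝ) {κ : ℝ} (hκ : 0 < κ) :
    LipschitzWith (Real.toNNReal (2 * κ)) (heightSq S κ) := by
  refine LipschitzWith.of_dist_le_mul fun x y => ?_
  rw [Real.coe_toNNReal _ (by positivity)]
  have h := ((Metric.lipschitz_infDist_pt S).min_const κ).dist_le_mul x y
  have hb : ∀ x, 0 ≤ min (Metric.infDist x S) κ ∧ min (Metric.infDist x S) κ ≤ κ := fun x =>
    ⟨le_min Metric.infDist_nonneg hκ.le, min_le_right _ _⟩
  rw [NNReal.coe_one, one_mul] at h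
  rw [Real.dist_eq] at h ⊢
  have e : heightSq S κ x - heightSq S κ y =
      -((min (Metric.infDist x S) κ - min (Metric.infDist y S) κ) *
      (min (Metric.infDist x S) κ + min (Metric.infDist y S) κ)) := by
    unfold heightSq
    ring
  rw [e, abs_neg, abs_mul, abs_of_nonneg (add_nonneg (hb x).1 (hb y).1), mul_comm]
  exact mul_le_mul (by linarith [(hb x).2, (hb y).2]) h (abs_nonneg _) (by positivity)

/-- A Lipschitz approximation of the height `√(heightSq S κ x)` of the level set. -/
def smoothHeight (S : Set ℝ) (κ ε x : ℝ) : ℝ := Real.sqrt (heightSq S κ x + ε ^ 2) - |ε|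

theorem continuous_smoothHeight (S : Set ℝ) {κ : ℝ} (hκ : 0 < κ) (ε : ℝ) :
    Continuous (smoothHeight S κ ε) := by
  have := (lipschitzWith_heightSq S hκ).continuous
  unfold smoothHeight
  fun_prop

theorem continuous_smoothHeight_left (S : Set ℝ) (κ x : ℝ) :
    Continuous fun ε : ℝ => smoothHeight S κ ε x := by
  unfold smoothHeight
  fun_prop

theorem smoothHeight_nonneg (S : Set ℝ) {κ : ℝ} (hκ : 0 < κ) (ε x : ℝ) :
    0 ≤ smoothHeight S κ ε x := by
  unfold smoothHeight
  rw [sub_nonneg, ← Real.sqrt_sq_eq_abs]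
  exact Real.sqrt_le_sqrt (by linarith [heightSq_nonneg S hκ x])

/-- Subtracting `|ε|` keeps the approximating graphs within the true ones, hence in the region where
`Φ` is analytic. -/
theorem smoothHeight_le (S : Set ℝ) {κ : ℝ} (hκ : 0 < κ) (ε x : ℝ) :
    smoothHeight S κ ε x ≤ Real.sqrt (heightSq S κ x) := by
  unfold smoothHeight
  have h0 := heightSq_nonneg S hκ x
  rw [sub_le_iff_le_add, Real.sqrt_le_left (by positivity)]
  nlinarith [Real.sq_sqrt h0, sq_abs ε, mul_nonneg (Real.sqrt_nonneg (heightSq S κ x)) (abs_nonneg ε)]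

/-- Keeps the approximating contour at distance nearly `κ` from the set, hence away from the points
at which `Φ` is estimated. -/
theorem le_smoothHeight_sq (S : Set ℝ) {κ : ℝ} (hκ : 0 < κ) {ε : ℝ} (hε : 0 ≤ ε) (x : ℝ) :
    heightSq S κ x - 2 * ε * (κ + ε) ≤ smoothHeight S κ ε x ^ 2 := by
  have h0 := heightSq_nonneg S hκ x
  have h1 : Real.sqrt (heightSq S κ x + ε ^ 2) ^ 2 = heightSq S κ x + ε ^ 2 :=
    Real.sq_sqrt (by positivity)
  have h2 : Real.sqrt (heightSq S κ x + ε ^ 2) ≤ κ + ε := by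
    rw [Real.sqrt_le_left (by positivity)]
    nlinarith [heightSq_le S κ x]
  unfold smoothHeight
  rw [abs_of_nonneg hε]
  nlinarith [Real.sqrt_nonneg (heightSq S κ x + ε ^ 2)]

theorem lipschitzWith_smoothHeight (S : Set ℝ) {κ ε : ℝ} (hκ : 0 < κ) (hε : 0 < ε) :
    LipschitzWith (Real.toNNReal (κ / ε)) (smoothHeight S κ ε) := by
  refine LipschitzWith.of_dist_le_mul fun x y => ?_
  rw [Real.coe_toNNReal _ (by positivity)]
  have h := (lipschitzWith_heightSq S hκ).dist_le_mul x y
  rw [Real.coe_toNNReal _ (by positivity), Real.dist_eq (heightSq S κ x)] at h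
  set A := Real.sqrt (heightSq S κ x + ε ^ 2) with hA
  set B := Real.sqrt (heightSq S κ y + ε ^ 2) with hB
  have hA1 : A ^ 2 = heightSq S κ x + ε ^ 2 :=
    Real.sq_sqrt (by linarith [heightSq_nonneg S hκ x, sq_nonneg ε])
  have hB1 : B ^ 2 = heightSq S κ y + ε ^ 2 :=
    Real.sq_sqrt (by linarith [heightSq_nonneg S hκ y, sq_nonneg ε])
  have hA2 : ε ≤ A := Real.le_sqrt_of_sq_le (by linarith [heightSq_nonneg S hκ x])
  have hB2 : ε ≤ B := Real.le_sqrt_of_sq_le (by linarith [heightSq_nonneg S hκ y])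
  have e : heightSq S κ x - heightSq S κ y = (A - B) * (A + B) := by linarith
  rw [e, abs_mul, abs_of_nonneg (show 0 ≤ A + B by linarith)] at h
  have e2 : dist (smoothHeight S κ ε x) (smoothHeight S κ ε y) = |A - B| := by
    rw [Real.dist_eq]
    unfold smoothHeight
    congr 1
    ring
  rw [e2, div_mul_eq_mul_div, le_div_iff₀ hε]
  nlinarith [abs_nonneg (A - B)]

/-- Unlike the Lipschitz constant `κ/ε`, this bound becomes uniform in `ε` after multiplication by a
weight of order `√(heightSq S κ x)`. -/
theorem abs_deriv_smoothHeight_le (S : Set ℝ) {κ ε : ℝ} (hκ : 0 < κ) (hε : 0 < ε) :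
    ∀ᵐ x, |deriv (smoothHeight S κ ε) x| ≤ κ / Real.sqrt (heightSq S κ x + ε ^ 2) := by
  filter_upwards [(lipschitzWith_heightSq S hκ).ae_differentiableAt_real] with x hx
  have h0 : 0 < heightSq S κ x + ε ^ 2 := by
    have := heightSq_nonneg S hκ x
    positivity
  have h1 : HasDerivAt (smoothHeight S κ ε) _ x :=
    ((hx.hasDerivAt.add_const (ε ^ 2)).sqrt h0.ne').sub_const |ε|
  have h2 := norm_deriv_le_of_lipschitz (lipschitzWith_heightSq S hκ) (x₀ := x)
  rw [Real.coe_toNNReal _ (by positivity), Real.norm_eq_abs] at h2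
  have h3 := Real.sqrt_pos.2 h0
  rw [h1.deriv, abs_div, abs_of_pos (show 0 < 2 * Real.sqrt (heightSq S κ x + ε ^ 2) by positivity),
    div_le_div_iff₀ (by positivity) h3]
  nlinarith

/-- The connected component of `{dist (x, S) < κ}` at a point, with the rate at which the distance
approaches `κ` at the end points. -/
theorem exists_component {S : Set ℝ} (hS : IsCompact S) (hne : S.Nonempty) {κ : ℝ} (hκ : 0 < κ)
    {x₀ : ℝ} (hx₀ : Metric.infDist x₀ S < κ) :
    ∃ a b, a < x₀ ∧ x₀ < b ∧ Metric.infDist a S = κ ∧ Metric.infDist b S = κ ∧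
      ∃ c, 0 < c ∧ ∀ x ∈ Icc a b, c * ((x - a) * (b - x)) ≤ κ - Metric.infDist x S := by
  have hcont : Continuous fun x : ℝ => Metric.infDist x S := Metric.continuous_infDist_pt S
  obtain ⟨R, hR0, hR⟩ : ∃ R : ℝ, 0 < R ∧ ∀ s ∈ S, |s| ≤ R := by
    obtain ⟨R, hR⟩ := hS.isBounded.exists_norm_le
    exact ⟨max R 1, by positivity, fun s hs => (hR s hs).trans (le_max_left _ _)⟩
  have hfar : ∀ x : ℝ, R + κ ≤ |x| → κ ≤ Metric.infDist x S := by
    intro x hx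
    rw [Metric.le_infDist hne]
    intro s hs
    rw [Real.dist_eq]
    have := abs_sub_abs_le_abs_sub x s
    linarith [hR s hs]
  have hx₀R : |x₀| < R + κ := by
    by_contra h
    exact absurd (hfar x₀ (not_lt.1 h)) (not_le.2 hx₀)
  have hx₀R' := abs_lt.1 hx₀R
  obtain ⟨a, ⟨⟨ha1, ha2⟩, ha3⟩, hamax⟩ := (isCompact_Icc.inter_right
    (isClosed_le continuous_const hcont) : IsCompact (Icc (-(R + κ)) x₀ ∩
      {x | κ ≤ Metric.infDist x S})).exists_isGreatest
    ⟨-(R + κ), ⟨le_rfl, by linarith⟩, hfar _ (by rw [abs_neg, abs_of_pos (by linarith)])⟩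
  obtain ⟨b, ⟨⟨hb1, hb2⟩, hb3⟩, hbmin⟩ := (isCompact_Icc.inter_right
    (isClosed_le continuous_const hcont) : IsCompact (Icc x₀ (R + κ) ∩
      {x | κ ≤ Metric.infDist x S})).exists_isLeast
    ⟨R + κ, ⟨by linarith, le_rfl⟩, hfar _ (by rw [abs_of_pos (by linarith)])⟩
  have ha3 : κ ≤ Metric.infDist a S := ha3
  have hb3 : κ ≤ Metric.infDist b S := hb3
  have hax : a < x₀ := lt_of_le_of_ne ha2 fun h => by subst h; linarith
  have hxb : x₀ < b := lt_of_le_of_ne hb1 fun h => by subst h; linarith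
  have hlt : ∀ x ∈ Ioo a b, Metric.infDist x S < κ := by
    intro x hx
    by_contra h
    rw [not_lt] at h
    rcases le_total x x₀ with h1 | h1
    · exact absurd (hamax ⟨⟨ha1.trans hx.1.le, h1⟩, h⟩) (not_le.2 hx.1)
    · exact absurd (hbmin ⟨⟨h1, hx.2.le.trans hb2⟩, h⟩) (not_le.2 hx.2)
  have hab : a < b := hax.trans hxb
  have hle : ∀ x ∈ Icc a b, Metric.infDist x S ≤ κ := by
    intro x hx
    rw [← closure_Ioo hab.ne] at hx
    exact closure_minimal (fun y hy => (hlt y hy).le) (isClosed_le hcont continuous_const) hx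
  have hae : Metric.infDist a S = κ := le_antisymm (hle a ⟨le_rfl, hab.le⟩) ha3
  have hbe : Metric.infDist b S = κ := le_antisymm (hle b ⟨hab.le, le_rfl⟩) hb3
  have hdist : ∀ {y : ℝ}, κ ≤ Metric.infDist y S → ∀ s ∈ S, κ ≤ |y - s| := fun hy s hs => by
    rw [← Real.dist_eq]
    exact hy.trans (Metric.infDist_le_dist_of_mem hs)
  -- Just to the right of `a` the distance is below `κ`, while `S` has no point within less than `κ`
  -- of `a`. The responsible points of `S` lie arbitrarily close to `a + κ`, and `S` is closed.
  -- Hence the distance drops with slope one to the right of `a`, and symmetrically at `b`.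
  have haS : a + κ ∈ S := by
    by_contra h
    obtain ⟨r, hr, hball⟩ := Metric.isOpen_iff.1 hS.isClosed.isOpen_compl (a + κ) h
    set r' := min r (b - a)
    have hr' : 0 < r' := lt_min hr (by linarith)
    have h1 := hlt (a + r' / 2) ⟨by linarith, by linarith [min_le_right r (b - a)]⟩
    obtain ⟨s, hs, hs2⟩ := hS.exists_infDist_eq_dist hne (a + r' / 2)
    rw [hs2, Real.dist_eq, abs_lt] at h1
    have h2 : ¬ |s - (a + κ)| < r := fun h3 => hball (by rwa [Metric.mem_ball, Real.dist_eq]) hs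
    have h4 := hdist ha3 s hs
    rw [abs_lt, not_and_or] at h2
    have := min_le_left r (b - a)
    rcases le_abs'.1 h4 with h5 | h5 <;> rcases h2 with h6 | h6 <;> linarith
  have hbS : b - κ ∈ S := by
    by_contra h
    obtain ⟨r, hr, hball⟩ := Metric.isOpen_iff.1 hS.isClosed.isOpen_compl (b - κ) h
    set r' := min r (b - a)
    have hr' : 0 < r' := lt_min hr (by linarith)
    have h1 := hlt (b - r' / 2) ⟨by linarith [min_le_right r (b - a)], by linarith⟩
    obtain ⟨s, hs, hs2⟩ := hS.exists_infDist_eq_dist hne (b - r' / 2)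
    rw [hs2, Real.dist_eq, abs_lt] at h1
    have h2 : ¬ |s - (b - κ)| < r := fun h3 => hball (by rwa [Metric.mem_ball, Real.dist_eq]) hs
    have h4 := hdist hb3 s hs
    rw [abs_lt, not_and_or] at h2
    have := min_le_left r (b - a)
    rcases le_abs'.1 h4 with h5 | h5 <;> rcases h2 with h6 | h6 <;> linarith
  have hleft : ∀ x ∈ Icc a b, x ≤ a + κ → x - a ≤ κ - Metric.infDist x S := by
    intro x hx hxκ
    have := Metric.infDist_le_dist_of_mem (x := x) haS
    rw [Real.dist_eq, abs_of_nonpos (by linarith)] at this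
    linarith
  have hright : ∀ x ∈ Icc a b, b - κ ≤ x → b - x ≤ κ - Metric.infDist x S := by
    intro x hx hxκ
    have := Metric.infDist_le_dist_of_mem (x := x) hbS
    rw [Real.dist_eq, abs_of_nonneg (by linarith)] at this
    linarith
  obtain ⟨m, hm, hmid⟩ : ∃ m, 0 < m ∧ ∀ x ∈ Icc (a + κ) (b - κ), m ≤ κ - Metric.infDist x S := by
    rcases (Icc (a + κ) (b - κ)).eq_empty_or_nonempty with h | h
    · exact ⟨1, one_pos, fun x hx => by rw [h] at hx; exact hx.elim⟩
    · obtain ⟨y, hy, hymin⟩ := isCompact_Icc.exists_isMinOn h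
        (f := fun x => κ - Metric.infDist x S) (by fun_prop)
      refine ⟨κ - Metric.infDist y S, ?_, fun x hx => hymin hx⟩
      linarith [hlt y ⟨by linarith [hy.1], by linarith [hy.2]⟩]
  have hL : 0 < b - a := by linarith
  -- Near the ends the gap `κ - dist` is at least `x - a` or `b - x`, and the other factor is at
  -- most `b - a`. In the middle the gap is at least its minimum `m`, and the product is at most `(b
  -- - a)²`.
  refine ⟨a, b, hax, hxb, hae, hbe, min (1 / (b - a)) (m / (b - a) ^ 2), by positivity, ?_⟩
  intro x hx
  have hxa : 0 ≤ x - a := by linarith [hx.1]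
  have hbx : 0 ≤ b - x := by linarith [hx.2]
  have hprod : 0 ≤ (x - a) * (b - x) := mul_nonneg hxa hbx
  rcases le_total x (a + κ) with h1 | h1
  · refine le_trans ?_ (hleft x hx h1)
    refine (mul_le_mul_of_nonneg_right (min_le_left _ _) hprod).trans ?_
    rw [div_mul_eq_mul_div, div_le_iff₀ hL]
    nlinarith
  rcases le_total (b - κ) x with h2 | h2
  · refine le_trans ?_ (hright x hx h2)
    refine (mul_le_mul_of_nonneg_right (min_le_left _ _) hprod).trans ?_
    rw [div_mul_eq_mul_div, div_le_iff₀ hL]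
    nlinarith
  · refine le_trans ?_ (hmid x ⟨h1, h2⟩)
    refine (mul_le_mul_of_nonneg_right (min_le_right _ _) hprod).trans ?_
    rw [div_mul_eq_mul_div, div_le_iff₀ (by positivity)]
    refine mul_le_mul_of_nonneg_left ?_ hm.le
    nlinarith

/-- Cauchy's formula for `q Φ` with `q(z) = (z - a)(b - z)` on the region between the approximating
graphs. On the contour `|q|` is `O(√heightSq)`, which compensates the slope, so `|q| (1 + |w'|)` is
bounded independently of `ε`. At `z₀` one has `|q| ≥ (κ - κ₂)²`, since `a` and `b` are at distance
`κ` from the set and `z₀` at most at distance `κ₂`. -/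
theorem norm_le_integral_smoothHeight {S : Set ℝ} (hS : IsCompact S) (hne : S.Nonempty)
    {κ κ₂ : ℝ} (hκ : 0 < κ) (h2 : κ₂ < κ) {a b : ℝ} (hab : a < b) (ha : Metric.infDist a S = κ)
    (hb : Metric.infDist b S = κ) {c : ℝ} (hc : 0 < c)
    (hcab : ∀ x ∈ Icc a b, c * ((x - a) * (b - x)) ≤ κ - Metric.infDist x S)
    {Φ : ℂ → ℂ} (hΦ : AnalyticOnNhd ℂ Φ {z | Metric.infDist z (Complex.ofReal '' S) ≤ κ})
    {z₀ : ℂ} (haz : a < z₀.re) (hzb : z₀.re < b)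
    (hz₀ : Metric.infDist z₀ (Complex.ofReal '' S) ≤ κ₂) {ε : ℝ} (hε : 0 < ε) (hεκ : ε ≤ κ)
    (hε2 : 4 * ε * κ ≤ κ ^ 2 - ((κ + κ₂) / 2) ^ 2) :
    2 * Real.pi * (κ - κ₂) ^ 2 * ‖Φ z₀‖ ≤ 2 * κ * (1 / c + (b - a) + κ) / ((κ - κ₂) / 2) *
      ((∫ x in a..b, ‖Φ (x - Complex.I * smoothHeight S κ ε x)‖) +
        ∫ x in a..b, ‖Φ (x + Complex.I * smoothHeight S κ ε x)‖) := by
  set σ := Complex.ofReal '' S with hσ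
  set w := smoothHeight S κ ε with hw
  have hκ2 : 0 ≤ κ₂ := Metric.infDist_nonneg.trans hz₀
  have hwL := lipschitzWith_smoothHeight S hκ hε
  have hwc := hwL.continuous
  have hw0 : ∀ x, 0 ≤ w x := smoothHeight_nonneg S hκ ε
  have hin : ∀ x ∈ Icc a b, Metric.infDist x S ≤ κ := fun x hx => by
    have := hcab x hx
    have h3 : 0 ≤ c * ((x - a) * (b - x)) :=
      mul_nonneg hc.le (mul_nonneg (by linarith [hx.1]) (by linarith [hx.2]))
    linarith
  have hP : ∀ x ∈ Icc a b, heightSq S κ x = κ ^ 2 - Metric.infDist x S ^ 2 := fun x hx => by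
    rw [heightSq, min_eq_left (hin x hx)]
  have hPs : ∀ x, Real.sqrt (heightSq S κ x) ^ 2 = heightSq S κ x := fun x =>
    Real.sq_sqrt (heightSq_nonneg S hκ x)
  have hws : ∀ x, w x ≤ Real.sqrt (heightSq S κ x) := smoothHeight_le S hκ ε
  have hPκ : ∀ x, Real.sqrt (heightSq S κ x) ≤ κ := fun x => by
    rw [Real.sqrt_le_left hκ.le]
    exact heightSq_le S κ x
  have hwend : ∀ x, Metric.infDist x S = κ → w x = 0 := fun x hx => by
    have : heightSq S κ x = 0 := by rw [heightSq, hx, min_self, sub_self]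
    rw [hw, smoothHeight, this, zero_add, Real.sqrt_sq_eq_abs, sub_self]
  have hdz : ∀ x y : ℝ, Metric.infDist (x + Complex.I * (y : ℝ)) σ ^ 2 =
      Metric.infDist x S ^ 2 + y ^ 2 := fun x y => by
    rw [infDist_ofReal_image_sq hS hne]
    simp
  have hD : ∀ x ∈ Icc a b, ∀ y : ℝ, |y| ≤ w x → Metric.infDist (x + Complex.I * (y : ℝ)) σ ≤ κ := by
    intro x hx y hy
    refine (sq_le_sq₀ Metric.infDist_nonneg hκ.le).1 ?_
    rw [hdz]
    have h3 := pow_le_pow_left₀ (abs_nonneg y) (hy.trans (hws x)) 2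
    rw [sq_abs, hPs, hP x hx] at h3
    linarith
  -- With `ε ≤ κ` the error `2ε(κ + ε)` is at most `4εκ`. So the contour stays beyond distance `(κ +
  -- κ₂)/2` from the set, and `(κ - κ₂)/2` away from `z₀`.
  have hfar : ∀ x ∈ Icc a b, ((κ + κ₂) / 2) ^ 2 ≤ Metric.infDist x S ^ 2 + w x ^ 2 := by
    intro x hx
    have h3 := le_smoothHeight_sq S hκ hε.le x
    rw [hP x hx] at h3
    nlinarith
  have hfar' : ∀ x ∈ Icc a b, ∀ y : ℝ, y ^ 2 = w x ^ 2 →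
      (κ - κ₂) / 2 ≤ ‖(x + Complex.I * (y : ℝ) : ℂ) - z₀‖ := by
    intro x hx y hy
    have h3 : (κ + κ₂) / 2 ≤ Metric.infDist (x + Complex.I * (y : ℝ)) σ := by
      refine (sq_le_sq₀ (by linarith) Metric.infDist_nonneg).1 ?_
      rw [hdz, hy]
      exact hfar x hx
    have h4 := Metric.infDist_le_infDist_add_dist (s := σ) (x := (x + Complex.I * (y : ℝ) : ℂ)) (y := z₀)
    rw [dist_eq_norm] at h4
    linarith
  have hz₀w : |z₀.im| < w z₀.re := by
    refine abs_lt_of_sq_lt_sq ?_ (hw0 _)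
    have h3 := hfar z₀.re ⟨haz.le, hzb.le⟩
    have h4 := infDist_ofReal_image_sq hS hne z₀
    have h5 := pow_le_pow_left₀ Metric.infDist_nonneg hz₀ 2
    nlinarith
  have hqend : ∀ e : ℝ, Metric.infDist e S = κ → κ - κ₂ ≤ ‖z₀ - e‖ := by
    intro e he
    have h3 : Metric.infDist (e : ℂ) σ ^ 2 = κ ^ 2 := by
      rw [infDist_ofReal_image_sq hS hne]
      simp [he]
    have h3' : Metric.infDist (e : ℂ) σ = κ :=
      (pow_left_inj₀ Metric.infDist_nonneg hκ.le two_ne_zero).1 h3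
    have h4 := Metric.infDist_le_infDist_add_dist (s := σ) (x := (e : ℂ)) (y := z₀)
    rw [dist_eq_norm, norm_sub_rev] at h4
    linarith
  let q : ℂ → ℂ := fun z => (z - a) * (b - z)
  have hqz : (κ - κ₂) ^ 2 ≤ ‖q z₀‖ := by
    rw [norm_mul, norm_sub_rev (b : ℂ), sq]
    exact mul_le_mul (hqend a ha) (hqend b hb) (by linarith) (norm_nonneg _)
  have hC := integral_graph_cauchy (G := fun z => q z * Φ z) hwL (a := a) (b := b)
    (fun x _ => hw0 x) (hwend a ha) (hwend b hb)
    (fun x hx y hy => (by fun_prop : AnalyticAt ℂ q _).mul (hΦ _ (hD x hx y hy))) haz hzb hz₀w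
  set M := 2 * κ * (1 / c + (b - a) + κ) with hM
  have hM0 : 0 ≤ M := by
    have : 0 < 1 / c := by positivity
    have : 0 < b - a := by linarith
    positivity
  have hr0 : 0 < (κ - κ₂) / 2 := by linarith
  have hqb : ∀ x ∈ Icc a b, ∀ y : ℝ, |y| = w x →
      |deriv w x| ≤ κ / Real.sqrt (heightSq S κ x + ε ^ 2) →
      ‖q (x + Complex.I * (y : ℝ))‖ * (1 + |deriv w x|) ≤ M := by
    intro x hx y hy hdw
    set p := Real.sqrt (heightSq S κ x) with hp
    have hp0 : 0 ≤ p := Real.sqrt_nonneg _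
    have hpκ : p ≤ κ := hPκ x
    have hxa : 0 ≤ x - a := by linarith [hx.1]
    have hbx : 0 ≤ b - x := by linarith [hx.2]
    -- With `D = dist (x, S)`: `(κ - D)² ≤ (κ - D)(κ + D) = p²`, hence `κ - D ≤ p`.
    have h3 : (x - a) * (b - x) ≤ p / c := by
      rw [le_div_iff₀ hc, mul_comm]
      refine (hcab x hx).trans ?_
      have h4 : p ^ 2 = κ ^ 2 - Metric.infDist x S ^ 2 := by rw [hPs, hP x hx]
      have h5 : κ * (κ - Metric.infDist x S) ≤ p * κ := by
        have := hin x hx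
        have h6 : 0 ≤ Metric.infDist x S := Metric.infDist_nonneg
        nlinarith
      nlinarith
    have hyn : ‖Complex.I * (y : ℂ)‖ = w x := by
      rw [norm_mul, Complex.norm_I, one_mul, Complex.norm_real, Real.norm_eq_abs, hy]
    have h4 : ‖(x + Complex.I * (y : ℝ) : ℂ) - a‖ ≤ (x - a) + p := by
      rw [show (x + Complex.I * (y : ℝ) : ℂ) - a = ((x - a : ℝ) : ℂ) + Complex.I * (y : ℝ) by
        push_cast; ring]
      refine (norm_add_le _ _).trans ?_
      rw [hyn, Complex.norm_real, Real.norm_of_nonneg hxa]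
      linarith [hws x]
    have h5 : ‖(b : ℂ) - (x + Complex.I * (y : ℝ) : ℂ)‖ ≤ (b - x) + p := by
      rw [show (b : ℂ) - (x + Complex.I * (y : ℝ) : ℂ) = ((b - x : ℝ) : ℂ) - Complex.I * (y : ℝ) by
        push_cast; ring]
      refine (norm_sub_le _ _).trans ?_
      rw [hyn, Complex.norm_real, Real.norm_of_nonneg hbx]
      linarith [hws x]
    -- Expand `((x - a) + p)((b - x) + p) = (x - a)(b - x) + p (b - a) + p²` and use `p ≤ κ`.
    have h6 : ‖q (x + Complex.I * (y : ℝ))‖ ≤ p * (1 / c + (b - a) + κ) := by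
      rw [norm_mul]
      refine (mul_le_mul h4 h5 (norm_nonneg _) (by linarith)).trans ?_
      have : p / c = p * (1 / c) := by ring
      nlinarith
    have h7 : p ≤ Real.sqrt (heightSq S κ x + ε ^ 2) :=
      Real.sqrt_le_sqrt (by linarith [sq_nonneg ε])
    have h8 : 0 < Real.sqrt (heightSq S κ x + ε ^ 2) := by
      have := heightSq_nonneg S hκ x
      positivity
    have h9 : p * (1 + |deriv w x|) ≤ 2 * κ := by
      have : p * |deriv w x| ≤ κ := by
        refine (mul_le_mul_of_nonneg_left hdw hp0).trans ?_
        rw [mul_div_assoc', div_le_iff₀ h8, mul_comm]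
        exact mul_le_mul_of_nonneg_left h7 hκ.le
      linarith
    have h10 : 0 ≤ 1 / c + (b - a) + κ := by
      have : 0 < 1 / c := by positivity
      linarith
    calc _ ≤ p * (1 / c + (b - a) + κ) * (1 + |deriv w x|) :=
          mul_le_mul_of_nonneg_right h6 (by positivity)
      _ = p * (1 + |deriv w x|) * (1 / c + (b - a) + κ) := by ring
      _ ≤ M := mul_le_mul_of_nonneg_right h9 h10
  have hint : ∀ y : ℝ → ℝ, Continuous y → (∀ x, |y x| = w x) → (D : ℝ → ℂ) →
      (∀ x, ‖D x‖ ≤ 1 + |deriv w x|) →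
      ‖∫ x in a..b, q (x + Complex.I * y x) * Φ (x + Complex.I * y x) /
        (x + Complex.I * y x - z₀) * D x‖ ≤
      M / ((κ - κ₂) / 2) * ∫ x in a..b, ‖Φ (x + Complex.I * y x)‖ := by
    intro y hyc hyw D hDb
    rw [← intervalIntegral.integral_const_mul]
    refine intervalIntegral.norm_integral_le_of_norm_le hab.le ?_ ?_
    · filter_upwards [abs_deriv_smoothHeight_le S hκ hε] with x hx hxI
      have hxI' := Ioc_subset_Icc_self hxI
      have h3 := hqb x hxI' (y x) (hyw x) hx
      have h4 := hfar' x hxI' (y x) (by rw [← sq_abs, hyw])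
      rw [norm_mul, norm_div, norm_mul, div_mul_eq_mul_div, div_mul_eq_mul_div]
      refine div_le_div₀ (by positivity) ?_ hr0 h4
      calc _ = ‖q (x + Complex.I * y x)‖ * ‖D x‖ * ‖Φ (x + Complex.I * y x)‖ := by ring
        _ ≤ _ := mul_le_mul_of_nonneg_right
          ((mul_le_mul_of_nonneg_left (hDb x) (norm_nonneg _)).trans h3) (norm_nonneg _)
    · refine (ContinuousOn.intervalIntegrable ?_).const_mul _
      rw [uIcc_of_le hab.le]
      intro x hx
      refine ContinuousAt.continuousWithinAt (ContinuousAt.norm ?_)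
      exact (hΦ _ (hD x hx (y x) (hyw x).le)).continuousAt.comp
        (f := fun x : ℝ => (x + Complex.I * y x : ℂ)) (by fun_prop)
  have h1 := hint w hwc (fun x => abs_of_nonneg (hw0 x)) (fun x => 1 + Complex.I * deriv w x)
    fun x => (norm_add_le _ _).trans (by simp)
  have h1' := hint (fun x => -w x) hwc.neg (fun x => by rw [abs_neg, abs_of_nonneg (hw0 x)])
    (fun x => 1 - Complex.I * deriv w x) fun x => (norm_sub_le _ _).trans (by simp)
  simp only [Complex.ofReal_neg, mul_neg, ← sub_eq_add_neg] at h1'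
  have h3 := congrArg norm hC
  simp only [norm_mul, Complex.norm_I, mul_one, Complex.norm_real, Complex.norm_ofNat,
    Real.norm_of_nonneg Real.pi_pos.le] at h3
  have h4 : 2 * Real.pi * (κ - κ₂) ^ 2 * ‖Φ z₀‖ ≤ 2 * Real.pi * (‖q z₀‖ * ‖Φ z₀‖) := by
    rw [mul_assoc]
    refine mul_le_mul_of_nonneg_left ?_ (by positivity)
    exact mul_le_mul_of_nonneg_right hqz (norm_nonneg _)
  rw [norm_mul] at h3
  rw [norm_mul, ← h3] at h4
  refine h4.trans ((norm_sub_le _ _).trans ?_)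
  rw [mul_add]
  exact add_le_add h1' h1

/-- Dominated convergence: all the graphs lie in the compact set `{dist ≤ κ}`, on which `Φ` is
bounded. The sign `θ` selects the upper or the lower graph. -/
theorem tendsto_integral_smoothHeight {S : Set ℝ} (hS : IsCompact S) (hne : S.Nonempty) {κ : ℝ}
    (hκ : 0 < κ) {a b : ℝ} (hab : a < b) (hin : ∀ x ∈ Icc a b, Metric.infDist x S ≤ κ)
    (hDc : IsCompact {z : ℂ | Metric.infDist z (Complex.ofReal '' S) ≤ κ}) {Φ : ℂ → ℂ}
    (hΦ : AnalyticOnNhd ℂ Φ {z | Metric.infDist z (Complex.ofReal '' S) ≤ κ}) {θ : ℝ}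
    (hθ : |θ| = 1) :
    Filter.Tendsto
      (fun ε => ∫ x in a..b, ‖Φ (x + Complex.I * (θ * smoothHeight S κ ε x : ℝ))‖)
      (nhdsWithin 0 (Ioi 0))
      (nhds (∫ x in a..b, ‖Φ (x + Complex.I * (θ * Real.sqrt (heightSq S κ x) : ℝ))‖)) := by
  have hD : ∀ ε, ∀ x ∈ Icc a b, Metric.infDist
      (x + Complex.I * (θ * smoothHeight S κ ε x : ℝ)) (Complex.ofReal '' S) ≤ κ := by
    intro ε x hx
    refine (sq_le_sq₀ Metric.infDist_nonneg hκ.le).1 ?_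
    have h3 := pow_le_pow_left₀ (smoothHeight_nonneg S hκ ε x) (smoothHeight_le S hκ ε x) 2
    rw [Real.sq_sqrt (heightSq_nonneg S hκ x), heightSq, min_eq_left (hin x hx)] at h3
    rw [infDist_ofReal_image_sq hS hne]
    simp only [Complex.add_re, Complex.ofReal_re, Complex.mul_re, Complex.I_re, zero_mul,
      Complex.I_im, Complex.ofReal_im, mul_zero, sub_zero, add_zero, Complex.add_im,
      Complex.mul_im, one_mul, zero_add]
    rw [mul_pow, ← sq_abs θ, hθ]
    linarith
  obtain ⟨B, hB⟩ := hDc.exists_bound_of_continuousOn hΦ.continuousOn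
  refine intervalIntegral.tendsto_integral_filter_of_dominated_convergence (fun _ => B) ?_ ?_ ?_ ?_
  · refine Filter.Eventually.of_forall fun ε => ContinuousOn.aestronglyMeasurable ?_
      measurableSet_uIoc
    rw [uIoc_of_le hab.le]
    intro x hx
    refine ContinuousAt.continuousWithinAt (ContinuousAt.norm ?_)
    have h1 := continuous_smoothHeight S hκ ε
    have h2 : Continuous fun x : ℝ => (x + Complex.I * (θ * smoothHeight S κ ε x : ℝ) : ℂ) := by
      fun_prop
    have h4 : AnalyticAt ℂ Φ (x + Complex.I * (θ * smoothHeight S κ ε x : ℝ)) :=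
      hΦ _ (hD ε x (Ioc_subset_Icc_self hx))
    exact ContinuousAt.comp' (g := Φ) h4.continuousAt h2.continuousAt
  · refine Filter.Eventually.of_forall fun ε => Filter.Eventually.of_forall fun x hx => ?_
    rw [uIoc_of_le hab.le] at hx
    rw [norm_norm]
    exact hB _ (hD ε x (Ioc_subset_Icc_self hx))
  · exact intervalIntegrable_const
  · refine Filter.Eventually.of_forall fun x hx => ?_
    rw [uIoc_of_le hab.le] at hx
    have h0 : smoothHeight S κ 0 x = Real.sqrt (heightSq S κ x) := by simp [smoothHeight]
    have h1 := continuous_smoothHeight_left S κ x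
    have h2 : Continuous fun ε : ℝ => (x + Complex.I * (θ * smoothHeight S κ ε x : ℝ) : ℂ) := by
      fun_prop
    have h4 : AnalyticAt ℂ Φ (x + Complex.I * (θ * smoothHeight S κ 0 x : ℝ)) :=
      hΦ _ (hD 0 x (Ioc_subset_Icc_self hx))
    have h3 := (ContinuousAt.comp' (g := Φ)
      (f := fun ε : ℝ => (x + Complex.I * (θ * smoothHeight S κ ε x : ℝ) : ℂ)) (x := 0)
      h4.continuousAt h2.continuousAt).norm
    rw [ContinuousAt, h0] at h3
    exact h3.mono_left nhdsWithin_le_nhds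

/-- A quantitative mean value estimate with a constant independent of `Φ`. Letting `ε → 0` in the
bound over one component replaces the Lipschitz graphs by the level set itself. Finitely many
components meet the compact set `{x | dist (x, S) ≤ κ₂}`. -/
theorem exists_sup_le_hausdorff_integral {S : Set ℝ} (hS : IsCompact S) (hne : S.Nonempty)
    {κ κ₂ : ℝ} (hκ : 0 < κ) (h2 : κ₂ < κ) :
    ∃ C, 0 ≤ C ∧ ∀ Φ : ℂ → ℂ,
      AnalyticOnNhd ℂ Φ {z | Metric.infDist z (Complex.ofReal '' S) ≤ κ} →
      ∀ z₀, Metric.infDist z₀ (Complex.ofReal '' S) ≤ κ₂ →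
        ‖Φ z₀‖ ≤ C * ∫ z in {z | Metric.infDist z (Complex.ofReal '' S) = κ},
          ‖Φ z‖ ∂(Measure.hausdorffMeasure 1) := by
  set σ := Complex.ofReal '' S with hσ
  have hσc : IsCompact σ := hS.image Complex.continuous_ofReal
  have hσn : σ.Nonempty := hne.image _
  have hcd : Continuous fun z : ℂ => Metric.infDist z σ := Metric.continuous_infDist_pt σ
  have hbdd : ∀ r, Bornology.IsBounded {z : ℂ | Metric.infDist z σ ≤ r} := by
    intro r
    obtain ⟨C, hC⟩ := hσc.isBounded.exists_norm_le
    refine isBounded_iff_forall_norm_le.2 ⟨C + r, fun z hz => ?_⟩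
    obtain ⟨s, hs, hzs⟩ := hσc.exists_infDist_eq_dist hσn z
    have h1 : dist z s ≤ r := hzs ▸ hz
    rw [dist_eq_norm] at h1
    have := norm_le_norm_add_norm_sub' z s
    linarith [hC s hs]
  have hDc : IsCompact {z : ℂ | Metric.infDist z σ ≤ κ} :=
    Metric.isCompact_of_isClosed_isBounded (isClosed_le hcd continuous_const) (hbdd κ)
  have hΓc : IsCompact {z : ℂ | Metric.infDist z σ = κ} :=
    hDc.of_isClosed_subset (isClosed_eq hcd continuous_const) fun z hz => le_of_eq hz
  have hfin := hausdorffMeasure_infDist_eq_lt_top hσc hσn hκ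
  have hI0 : ∀ Φ : ℂ → ℂ, 0 ≤ ∫ z in {z | Metric.infDist z σ = κ},
      ‖Φ z‖ ∂(Measure.hausdorffMeasure 1) := fun Φ => integral_nonneg fun _ => norm_nonneg _
  have hcS : Continuous fun x : ℝ => Metric.infDist x S := Metric.continuous_infDist_pt S
  have hKc : IsCompact {x : ℝ | Metric.infDist x S ≤ κ₂} := by
    refine Metric.isCompact_of_isClosed_isBounded (isClosed_le hcS continuous_const) ?_
    obtain ⟨C, hC⟩ := hS.isBounded.exists_norm_le
    refine isBounded_iff_forall_norm_le.2 ⟨C + κ₂, fun z hz => ?_⟩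
    obtain ⟨s, hs, hzs⟩ := hS.exists_infDist_eq_dist hne z
    have h1 : dist z s ≤ κ₂ := hzs ▸ hz
    rw [dist_eq_norm] at h1
    have := norm_le_norm_add_norm_sub' z s
    linarith [hC s hs]
  suffices h : ∃ C, 0 ≤ C ∧ ∀ Φ : ℂ → ℂ, AnalyticOnNhd ℂ Φ {z | Metric.infDist z σ ≤ κ} →
      ∀ z₀ : ℂ, z₀.re ∈ {x : ℝ | Metric.infDist x S ≤ κ₂} → Metric.infDist z₀ σ ≤ κ₂ →
        ‖Φ z₀‖ ≤ C * ∫ z in {z | Metric.infDist z σ = κ},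
          ‖Φ z‖ ∂(Measure.hausdorffMeasure 1) by
    obtain ⟨C, hC0, hC⟩ := h
    refine ⟨C, hC0, fun Φ hΦ z₀ hz₀ => hC Φ hΦ z₀ ?_ hz₀⟩
    refine (sq_le_sq₀ Metric.infDist_nonneg (Metric.infDist_nonneg.trans hz₀)).1 ?_
    have h3 := infDist_ofReal_image_sq hS hne z₀
    have h4 := pow_le_pow_left₀ Metric.infDist_nonneg hz₀ 2
    nlinarith [sq_nonneg z₀.im]
  -- Compactness induction: the constant depends only on the component `(a, b)` containing the real
  -- part, so it suffices to find one near each `x₀`.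
  refine hKc.induction_on (p := fun K => ∃ C, 0 ≤ C ∧ ∀ Φ : ℂ → ℂ,
      AnalyticOnNhd ℂ Φ {z | Metric.infDist z σ ≤ κ} →
      ∀ z₀ : ℂ, z₀.re ∈ K → Metric.infDist z₀ σ ≤ κ₂ →
        ‖Φ z₀‖ ≤ C * ∫ z in {z | Metric.infDist z σ = κ},
          ‖Φ z‖ ∂(Measure.hausdorffMeasure 1)) ?_ ?_ ?_ ?_
  · exact ⟨0, le_rfl, fun _ _ _ h => h.elim⟩
  · rintro s t hst ⟨C, hC0, hC⟩
    exact ⟨C, hC0, fun Φ hΦ z hz => hC Φ hΦ z (hst hz)⟩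
  · rintro s t ⟨C, hC0, hC⟩ ⟨C', hC0', hC'⟩
    refine ⟨max C C', le_max_of_le_left hC0, fun Φ hΦ z hz hzσ => ?_⟩
    rcases hz with hz | hz
    · exact (hC Φ hΦ z hz hzσ).trans (mul_le_mul_of_nonneg_right (le_max_left _ _) (hI0 Φ))
    · exact (hC' Φ hΦ z hz hzσ).trans (mul_le_mul_of_nonneg_right (le_max_right _ _) (hI0 Φ))
  intro x₀ hx₀
  obtain ⟨a, b, hax, hxb, ha, hb, c, hc, hcab⟩ := exists_component hS hne hκ
    (lt_of_le_of_lt hx₀ h2)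
  have hab := hax.trans hxb
  set M := 2 * κ * (1 / c + (b - a) + κ) / ((κ - κ₂) / 2) with hM
  have hd : 0 < κ - κ₂ := by linarith
  have hM0 : 0 ≤ M := by
    have : 0 < 1 / c := by positivity
    have : 0 < b - a := by linarith
    positivity
  refine ⟨Ioo a b, mem_nhdsWithin_of_mem_nhds (Ioo_mem_nhds hax hxb),
    M * 2 / (2 * Real.pi * (κ - κ₂) ^ 2), by positivity, fun Φ hΦ z₀ hz₀ hzσ => ?_⟩
  have hκ2 : 0 ≤ κ₂ := Metric.infDist_nonneg.trans hzσ
  rw [div_mul_eq_mul_div, le_div_iff₀ (by positivity), mul_comm]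
  have hin : ∀ x ∈ Icc a b, Metric.infDist x S ≤ κ := fun x hx => by
    have := hcab x hx
    have h3 : 0 ≤ c * ((x - a) * (b - x)) :=
      mul_nonneg hc.le (mul_nonneg (by linarith [hx.1]) (by linarith [hx.2]))
    linarith
  have hPc := (lipschitzWith_heightSq S hκ).continuous
  have hdz : ∀ x y : ℝ, Metric.infDist (x + Complex.I * (y : ℝ)) σ ^ 2 =
      Metric.infDist x S ^ 2 + y ^ 2 := fun x y => by
    rw [infDist_ofReal_image_sq hS hne]
    simp
  have hlim := fun θ : ℝ => tendsto_integral_smoothHeight hS hne hκ hab hin hDc hΦ (θ := θ)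
  have hΓ : ∀ θ : ℝ, |θ| = 1 →
      ∫ x in a..b, ‖Φ (x + Complex.I * (θ * Real.sqrt (heightSq S κ x) : ℝ))‖ ≤
        ∫ z in {z | Metric.infDist z σ = κ}, ‖Φ z‖ ∂(Measure.hausdorffMeasure 1) := by
    intro θ hθ
    refine integral_graph_le_hausdorff hΓc hfin (f := fun z => ‖Φ z‖)
      (hΦ.continuousOn.mono fun z hz => le_of_eq hz).norm (fun _ => norm_nonneg _)
      (g := fun x : ℝ => (x + Complex.I * (θ * Real.sqrt (heightSq S κ x) : ℝ) : ℂ))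
      (by fun_prop) (fun x => by simp) hab.le fun x hx => ?_
    refine (pow_left_inj₀ Metric.infDist_nonneg hκ.le two_ne_zero).1 ?_
    rw [hdz, mul_pow, ← sq_abs θ, hθ, Real.sq_sqrt (heightSq_nonneg S hκ x), heightSq,
      min_eq_left (hin x hx)]
    ring
  have hmain := ge_of_tendsto (((hlim (-1) (by simp)).add (hlim 1 (by simp))).const_mul M)
    (b := 2 * Real.pi * (κ - κ₂) ^ 2 * ‖Φ z₀‖) (by
      have hpos : 0 < min κ ((κ ^ 2 - ((κ + κ₂) / 2) ^ 2) / (4 * κ)) := by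
        refine lt_min hκ (div_pos ?_ (by positivity))
        nlinarith
      filter_upwards [Ioo_mem_nhdsGT hpos] with ε hε
      have h3 := norm_le_integral_smoothHeight hS hne hκ h2 hab ha hb hc hcab hΦ hz₀.1 hz₀.2 hzσ
        hε.1 (hε.2.le.trans (min_le_left _ _)) (by
          have := (lt_min_iff.1 hε.2).2.le
          rw [le_div_iff₀ (by positivity)] at this
          linarith)
      simpa only [neg_mul, one_mul, Complex.ofReal_neg, mul_neg, ← sub_eq_add_neg] using h3)
  refine hmain.trans ?_
  rw [mul_assoc]
  refine mul_le_mul_of_nonneg_left ?_ hM0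
  linarith [hΓ (-1) (by simp), hΓ 1 (by simp)]

/-! ### Matrix elements of the covariant representations -/

section Entries

variable {d : ℕ}

/-- The basis vector `δ_n` of `ℓ²(ℤ^d)`. -/
def basisVec (n : Lattice d) : Hilb d := lp.single 2 n (1 : ℂ)

theorem basisVec_apply (n k : Lattice d) : basisVec n k = if k = n then 1 else 0 := by
  rw [basisVec, lp.single_apply, Pi.single_apply]

theorem norm_basisVec (n : Lattice d) : ‖basisVec n‖ = 1 := by
  rw [basisVec, lp.norm_single (by norm_num), norm_one]

theorem norm_coord_le (φ : Hilb d) (n : Lattice d) : ‖φ n‖ ≤ ‖φ‖ :=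
  lp.norm_apply_le_norm two_ne_zero φ n

/-- The matrix element `⟨δ_l, T δ_n⟩`. -/
def entry (T : Hilb d →L[ℂ] Hilb d) (l n : Lattice d) : ℂ := T (basisVec n) l

theorem norm_entry_le (T : Hilb d →L[ℂ] Hilb d) (l n : Lattice d) : ‖entry T l n‖ ≤ ‖T‖ := by
  refine (norm_coord_le _ _).trans ((T.le_opNorm _).trans ?_)
  rw [norm_basisVec, mul_one]

theorem hasSum_entry (T : Hilb d →L[ℂ] Hilb d) (φ : Hilb d) (l : Lattice d) :
    HasSum (fun n => entry T l n * φ n) (T φ l) := by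
  have h1 := lp.hasSum_single (p := 2) (by norm_num) φ
  have h2 := ((lp.evalCLM ℂ (fun _ : Lattice d => ℂ) 2 l).comp T).hasSum h1
  refine h2.congr_fun fun n => ?_
  have : lp.single 2 n (φ n) = φ n • basisVec n := by
    rw [basisVec, ← lp.single_smul, smul_eq_mul, mul_one]
  show entry T l n * φ n = T (lp.single 2 n (φ n)) l
  rw [this, map_smul, lp.coeFn_smul, Pi.smul_apply, smul_eq_mul, mul_comm]
  rfl

theorem ext_entry {T T' : Hilb d →L[ℂ] Hilb d} (h : ∀ l n, entry T l n = entry T' l n) : T = T' :=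
  ContinuousLinearMap.ext fun φ => lp.ext (funext fun l =>
    (hasSum_entry T φ l).unique (by simpa only [h] using hasSum_entry T' φ l))

variable {X : Type*} [TopologicalSpace X] [AddAction (Lattice d) X]
  [ContinuousConstVAdd (Lattice d) X] [CompactSpace X] {F : MagneticField d}

/-- The operator `π_ω f`. -/
def op (f : Observables F X) (ω : X) : Hilb d →L[ℂ] Hilb d :=
  ((f : Family d X) : X → Hilb d →L[ℂ] Hilb d) ω

theorem op_mul (f g : Observables F X) (ω : X) : op (f * g) ω = op f ω * op g ω := rfl

theorem op_one (ω : X) : op (1 : Observables F X) ω = 1 := rfl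

theorem op_sub (f g : Observables F X) (ω : X) : op (f - g) ω = op f ω - op g ω := rfl

theorem op_smul (c : ℂ) (f : Observables F X) (ω : X) : op (c • f) ω = c • op f ω := rfl

theorem norm_op_le (f : Observables F X) (ω : X) : ‖op f ω‖ ≤ ‖f‖ :=
  lp.norm_apply_le_norm ENNReal.top_ne_zero (f : Family d X) ω

theorem norm_le_of_op {f : Observables F X} {C : ℝ} (hC : 0 ≤ C) (h : ∀ ω, ‖op f ω‖ ≤ C) :
    ‖f‖ ≤ C :=
  lp.norm_le_of_forall_le hC h

theorem kernel_eq_entry (f : Observables F X) (ω : X) (n : Lattice d) :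
    kernel f ω n = entry (op f ω) 0 n := rfl

/-- Matrix elements as linear functionals. -/
def entryLinear (F : MagneticField d) (ω : X) (l n : Lattice d) : Observables F X →ₗ[ℂ] ℂ where
  toFun f := entry (op f ω) l n
  map_add' _ _ := rfl
  map_smul' _ _ := rfl

theorem norm_entryLinear_le (ω : X) (l n : Lattice d) (f : Observables F X) :
    ‖entryLinear F ω l n f‖ ≤ 1 * ‖f‖ :=
  ((norm_entry_le (op f ω) l n).trans (norm_op_le f ω)).trans (one_mul ‖f‖).ge

/-- Matrix elements as continuous linear functionals. -/
def entryCLM (F : MagneticField d) (ω : X) (l n : Lattice d) : Observables F X →L[ℂ] ℂ :=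
  LinearMap.mkContinuous (entryLinear F ω l n) 1 (norm_entryLinear_le ω l n)

theorem entryCLM_apply (ω : X) (l n : Lattice d) (f : Observables F X) :
    entryCLM F ω l n f = entry (op f ω) l n := rfl

theorem norm_kernel_le (f : Observables F X) (ω : X) (n : Lattice d) : ‖kernel f ω n‖ ≤ ‖f‖ :=
  (norm_entry_le _ _ _).trans (norm_op_le f ω)

theorem denseRange_ofCore : DenseRange (ofCore F : Core d X → Observables F X) := by
  rw [Metric.denseRange_iff]
  intro f ε hε
  have hf : (f : Family d X) ∈ closure (coreAlgebra F X : Set (Family d X)) := f.2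
  rw [Metric.mem_closure_iff] at hf
  obtain ⟨_, ⟨g, rfl⟩, hg⟩ := hf ε hε
  exact ⟨g, hg⟩

theorem entry_rep (f : Core d X) (ω : X) (l n : Lattice d) :
    entry (rep F f ω) l n = f (-l +ᵥ ω) (n - l) * phase F n l := by
  rw [entry, rep_apply, tsum_eq_single n]
  · simp [basisVec_apply]
  · intro m hm
    simp [basisVec_apply, hm]

/-- Covariance: the kernel determines all matrix elements. -/
theorem entry_op (f : Observables F X) (ω : X) (l n : Lattice d) :
    entry (op f ω) l n = kernel f (-l +ᵥ ω) (n - l) * phase F n l := by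
  refine denseRange_ofCore.induction_on (p := fun f : Observables F X =>
    entry (op f ω) l n = kernel f (-l +ᵥ ω) (n - l) * phase F n l) f ?_ fun g => ?_
  · exact isClosed_eq (entryCLM F ω l n).continuous
      ((entryCLM F (-l +ᵥ ω) 0 (n - l)).continuous.mul continuous_const)
  · rw [kernel_ofCore]
    exact entry_rep g ω l n

theorem kernel_injective {f g : Observables F X} (h : ∀ ω n, kernel f ω n = kernel g ω n) :
    f = g := by
  refine Subtype.ext (lp.ext (funext fun ω => ?_))
  show op f ω = op g ω
  exact ext_entry fun l n => by rw [entry_op, entry_op, h]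

/-- The kernel is a uniform limit of kernels from `𝒜₀`, by density and `norm_kernel_le`. -/
theorem continuous_kernel (f : Observables F X) (n : Lattice d) :
    Continuous fun ω => kernel f ω n := by
  refine continuous_of_uniform_approx_of_continuous fun u hu => ?_
  obtain ⟨ε, hε, hu⟩ := Metric.mem_uniformity_dist.1 hu
  obtain ⟨g, hg⟩ := Metric.denseRange_iff.1 denseRange_ofCore f ε hε
  refine ⟨fun ω => g ω n, g.continuous_toFun n, fun ω => hu ?_⟩
  show dist (kernel f ω n) (g ω n) < ε
  rw [← kernel_ofCore F, dist_eq_norm]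
  rw [dist_eq_norm] at hg
  refine lt_of_le_of_lt ?_ hg
  exact norm_kernel_le (f - ofCore F g) ω n

/-- The element of `𝒜₀` supported on a single translation. -/
def singleCore (a : X → ℂ) (ha : Continuous a) (n : Lattice d) : Core d X where
  toFun ω m := if m = n then a ω else 0
  continuous_toFun m := by
    by_cases h : m = n
    · simpa only [if_pos h] using ha
    · simpa only [if_neg h] using continuous_const
  finite_support := ⟨{n}, fun ω m hm => if_neg (by simpa using hm)⟩

theorem norm_ofCore_singleCore_le {a : X → ℂ} (ha : Continuous a) (n : Lattice d) {C : ℝ}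
    (hC0 : 0 ≤ C) (hC : ∀ ω, ‖a ω‖ ≤ C) : ‖ofCore F (singleCore a ha n)‖ ≤ C := by
  refine norm_le_of_op hC0 fun ω => ?_
  obtain ⟨T, hT, hTa⟩ := exists_weightedShift (fun k => a (-k +ᵥ ω) * phase F (k + n) k) C
    (fun k => by rw [norm_mul, norm_phase, mul_one]; exact hC _) n
  have : op (ofCore F (singleCore a ha n)) ω = T := by
    refine ContinuousLinearMap.ext fun φ => lp.ext (funext fun k => ?_)
    show rep F (singleCore a ha n) ω φ k = T φ k
    rw [rep_apply, hTa, tsum_eq_single (k + n)]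
    · show (if k + n - k = n then a (-k +ᵥ ω) else 0) * _ * _ = _
      rw [if_pos (by abel)]
    · intro m hm
      show (if m - k = n then a (-k +ᵥ ω) else 0) * _ * _ = _
      rw [if_neg fun h => hm (by rw [← h]; abel), zero_mul, zero_mul]
  rw [this]
  exact hT

/-- The terms supported on single translations have norm at most `b n`, so their sum converges in
the algebra. This is how the derivatives are shown to lie in it. -/
theorem exists_kernel_eq_of_summable {a : Lattice d → X → ℂ} (ha : ∀ n, Continuous (a n))
    {b : Lattice d → ℝ} (hb : ∀ n, 0 ≤ b n) (hab : ∀ n ω, ‖a n ω‖ ≤ b n) (hs : Summable b) :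
    ∃ g : Observables F X, ∀ ω n, kernel g ω n = a n ω := by
  have hsum : Summable fun n => ofCore F (singleCore (a n) (ha n) n) :=
    hs.of_norm_bounded fun n => norm_ofCore_singleCore_le (ha n) n (hb n) (hab n)
  refine ⟨∑' n, ofCore F (singleCore (a n) (ha n) n), fun ω n => ?_⟩
  rw [kernel_eq_entry, ← entryCLM_apply, ContinuousLinearMap.map_tsum _ hsum, tsum_eq_single n]
  · rw [entryCLM_apply, ← kernel_eq_entry, kernel_ofCore]
    exact if_pos rfl
  · intro m hm
    rw [entryCLM_apply, ← kernel_eq_entry, kernel_ofCore]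
    exact if_neg (Ne.symm hm)

end Entries

/-! ### The length function on the lattice -/

section Length

variable {d : ℕ}

/-- The norm `∑_j |n_j|` on the lattice. -/
def len (n : Lattice d) : ℝ := ∑ j, |(n j : ℝ)|

theorem len_nonneg (n : Lattice d) : 0 ≤ len n := Finset.sum_nonneg fun _ _ => abs_nonneg _

theorem len_zero : len (0 : Lattice d) = 0 := by simp [len]

theorem len_neg (n : Lattice d) : len (-n) = len n := by simp [len]

theorem len_add_le (m n : Lattice d) : len (m + n) ≤ len m + len n := by
  unfold len
  rw [← Finset.sum_add_distrib]
  refine Finset.sum_le_sum fun j _ => ?_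
  rw [Pi.add_apply, Int.cast_add]
  exact abs_add_le _ _

theorem len_sub_comm (m n : Lattice d) : len (m - n) = len (n - m) := by
  rw [← len_neg, neg_sub]

theorem len_sub_le (l m n : Lattice d) : len (l - n) ≤ len (l - m) + len (m - n) := by
  rw [← sub_add_sub_cancel l m n]
  exact len_add_le _ _

theorem len_le_add_len_sub (m n : Lattice d) : len m ≤ len n + len (m - n) := by
  have := len_add_le n (m - n)
  rwa [add_sub_cancel] at this

theorem abs_coord_le_len (n : Lattice d) (j : Fin d) : |(n j : ℝ)| ≤ len n :=
  Finset.single_le_sum (f := fun j => |(n j : ℝ)|) (fun _ _ => abs_nonneg _) (Finset.mem_univ j)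

theorem summable_exp_neg_abs {δ : ℝ} (hδ : 0 < δ) :
    Summable fun n : ℤ => Real.exp (-δ * |(n : ℝ)|) := by
  have h : Summable fun n : ℕ => Real.exp (-δ * (n : ℝ)) := by
    have := Real.summable_exp_nat_mul_iff.2 (neg_lt_zero.2 hδ)
    simpa only [mul_comm] using this
  refine Summable.of_nat_of_neg ?_ ?_
  · simpa using h
  · simpa using h

theorem summable_exp_neg_len {δ : ℝ} (hδ : 0 < δ) :
    Summable fun n : Lattice d => Real.exp (-δ * len n) := by
  induction d with
  | zero => exact (hasSum_fintype _).summable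
  | succ d ih =>
    have h := (summable_exp_neg_abs hδ).mul_of_nonneg ih (fun _ => (Real.exp_pos _).le)
      (fun _ => (Real.exp_pos _).le)
    rw [← (Fin.consEquiv fun _ : Fin (d + 1) => ℤ).summable_iff]
    refine h.congr fun p => ?_
    rw [← Real.exp_add]
    congr 1
    simp only [len, Fin.sum_univ_succ, Fin.consEquiv_apply, Fin.cons_zero, Fin.cons_succ]
    ring

/-- Polynomials are dominated by exponentials of the length. -/
theorem exists_prod_pow_le_exp_len (α : Fin d → ℕ) {γ : ℝ} (hγ : 0 < γ) :
    ∃ C, 0 ≤ C ∧ ∀ n : Lattice d, ‖∏ j, (Complex.I * (n j : ℂ)) ^ α j‖ ≤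
      C * Real.exp (γ * len n) := by
  set a := ∑ j, α j with ha
  refine ⟨(a.factorial : ℝ) / γ ^ a, by positivity, fun n => ?_⟩
  have h1 : ‖∏ j, (Complex.I * (n j : ℂ)) ^ α j‖ ≤ len n ^ a := by
    rw [norm_prod, ha, ← Finset.prod_pow_eq_pow_sum]
    refine Finset.prod_le_prod (fun _ _ => norm_nonneg _) fun j _ => ?_
    rw [norm_pow, norm_mul, Complex.norm_I, one_mul, Complex.norm_intCast]
    exact pow_le_pow_left₀ (abs_nonneg _) (abs_coord_le_len n j) _
  have h2 := Real.pow_div_factorial_le_exp (γ * len n) (mul_nonneg hγ.le (len_nonneg n)) a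
  rw [div_le_iff₀ (by positivity), mul_pow] at h2
  refine h1.trans ?_
  rw [div_mul_eq_mul_div, le_div_iff₀ (by positivity)]
  linarith

end Length

/-! ### Combes–Thomas estimates for finite-range operators -/

section CombesThomas

variable {d : ℕ}

/-- `H` acts as a potential `V` plus finitely many weighted hops of length at most one. -/
structure IsHopping (H : Hilb d →L[ℂ] Hilb d) (V : Lattice d → ℂ) (U : Finset (Lattice d))
    (b : Lattice d → Lattice d → ℂ) : Prop where
  len_le : ∀ p ∈ U, len p ≤ 1
  norm_le : ∀ p k, ‖b p k‖ ≤ 1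
  apply : ∀ φ k, H φ k = V k * φ k + ∑ p ∈ U, b p k * φ (k + p)

theorem abs_exp_sub_one_le_of_abs_le {t s : ℝ} (h : |t| ≤ s) : |Real.exp t - 1| ≤ Real.exp s - 1 := by
  have h0 : 0 ≤ s := (abs_nonneg t).trans h
  obtain ⟨h1, h2⟩ := abs_le.1 h
  have h3 := Real.exp_le_exp.2 h1
  have h4 := Real.exp_le_exp.2 h2
  have h5 := Real.add_one_le_exp s
  have h6 := Real.add_one_le_exp (-s)
  have h7 : Real.exp s * Real.exp (-s) = 1 := by rw [← Real.exp_add]; simp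
  have h8 := Real.exp_pos (-s)
  rw [abs_le]
  refine ⟨?_, by linarith⟩
  nlinarith [sq_nonneg (Real.exp s - 1)]

theorem norm_sum_shift_le {U : Finset (Lattice d)} {a : Lattice d → Lattice d → ℂ} {C : ℝ}
    (ha : ∀ p ∈ U, ∀ k, ‖a p k‖ ≤ C) (ψ : Hilb d) :
    ∃ χ : Hilb d, ‖χ‖ ≤ U.card * C * ‖ψ‖ ∧ ∀ k, χ k = ∑ p ∈ U, a p k * ψ (k + p) := by
  classical
  have hT : ∀ p : U, ∃ T : Hilb d →L[ℂ] Hilb d, ‖T‖ ≤ C ∧ ∀ φ n, T φ n = a p n * φ (n + p) :=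
    fun p => exists_weightedShift _ _ (ha p p.2) p
  choose T hTn hTa using hT
  refine ⟨∑ p : U, T p ψ, ?_, fun k => ?_⟩
  · refine (norm_sum_le _ _).trans ?_
    refine (Finset.sum_le_card_nsmul _ _ (C * ‖ψ‖) fun p _ => ?_).trans ?_
    · exact ((T p).le_opNorm ψ).trans (mul_le_mul_of_nonneg_right (hTn p) (norm_nonneg _))
    · rw [nsmul_eq_mul, Finset.card_univ, Fintype.card_coe, mul_assoc]
  · rw [lp.coeFn_sum, Finset.sum_apply, ← Finset.sum_coe_sort U]
    exact Finset.sum_congr rfl fun p _ => hTa p ψ k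

/-- The Combes–Thomas estimate: exponential decay of the matrix elements of the resolvent. -/
theorem IsHopping.norm_entry_resolvent_le {H : Hilb d →L[ℂ] Hilb d} {V : Lattice d → ℂ}
    {U : Finset (Lattice d)} {b : Lattice d → Lattice d → ℂ} (hH : IsHopping H V U b)
    {T : Hilb d →L[ℂ] Hilb d} {z : ℂ} (h1 : T * (z • 1 - H) = 1) (h2 : (z • 1 - H) * T = 1)
    {κ η : ℝ} (hη : 0 ≤ η) (hT : ‖T‖ ≤ κ⁻¹) (hκ : U.card * (Real.exp η - 1) < κ)
    (l n : Lattice d) :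
    ‖entry T l n‖ ≤ (κ - U.card * (Real.exp η - 1))⁻¹ * Real.exp (-η * len (l - n)) := by
  set c := U.card * (Real.exp η - 1) with hc
  have hc0 : 0 ≤ c := mul_nonneg (Nat.cast_nonneg _) (by linarith [Real.add_one_le_exp η])
  have hκ0 : 0 < κ := hc0.trans_lt hκ
  set M := len (l - n) with hM
  -- The weight is truncated at `M` so that `e^u` is a bounded operator. The truncation does not
  -- affect the value at the site `l` of interest, where `u l = η M`.
  set u : Lattice d → ℝ := fun k => η * min (len (k - n)) M with hu
  have hu0 : ∀ k, u k ≤ η * M := fun k => mul_le_mul_of_nonneg_left (min_le_right _ _) hη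
  have hlip : ∀ p ∈ U, ∀ k, |u k - u (k + p)| ≤ η := by
    intro p hp k
    have hp1 := hH.len_le p hp
    have e1 : len (k + p - n) ≤ len (k - n) + len p := by
      rw [add_sub_right_comm]
      exact len_add_le _ _
    have e2 : len (k - n) ≤ len (k + p - n) + len p := by
      have := len_add_le (k + p - n) (-p)
      rw [len_neg] at this
      refine le_trans (le_of_eq ?_) this
      congr 1
      abel
    rw [hu]
    simp only
    rw [← mul_sub, abs_mul, abs_of_nonneg hη]
    refine mul_le_of_le_one_right hη ?_
    refine (abs_min_sub_min_le_max _ _ _ _).trans (max_le ?_ (by simp))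
    rw [abs_le]
    constructor <;> linarith
  obtain ⟨D, -, hD⟩ := exists_weightedShift (d := d) (fun k => (Real.exp (u k) : ℂ))
    (Real.exp (η * M)) (fun k => by
      rw [Complex.norm_real, Real.norm_of_nonneg (Real.exp_pos _).le]
      exact Real.exp_le_exp.2 (hu0 k)) 0
  set φ := T (basisVec n) with hφ
  set ψ := D φ with hψ
  have hψk : ∀ k, ψ k = (Real.exp (u k) : ℂ) * φ k := fun k => by rw [hψ, hD, add_zero]
  have heq : ∀ k, z * φ k - (V k * φ k + ∑ p ∈ U, b p k * φ (k + p)) = basisVec n k := by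
    intro k
    have : ((z • 1 - H) * T) (basisVec n) k = basisVec n k := by rw [h2]; rfl
    rw [← this, ← hH.apply]
    rfl
  -- For `ψ = e^u T δ_n`, commuting `e^u` past the hops gives `(z - H) ψ = e^u δ_n + χ`, and `e^u
  -- δ_n = δ_n` as `u n = 0`. Each hop changes `u` by at most `η`, so `‖χ‖ ≤ c ‖ψ‖`. As `c < κ`, the
  -- resulting inequality `‖ψ‖ ≤ κ⁻¹ (1 + c ‖ψ‖)` can be solved for `‖ψ‖`.
  obtain ⟨χ, hχ, hχk⟩ := norm_sum_shift_le (U := U) (C := Real.exp η - 1)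
    (a := fun p k => b p k * ((Real.exp (u k - u (k + p)) - 1 : ℝ) : ℂ)) (fun p hp k => by
      rw [norm_mul, Complex.norm_real, Real.norm_eq_abs]
      exact (mul_le_of_le_one_left (abs_nonneg _) (hH.norm_le p k)).trans
        (abs_exp_sub_one_le_of_abs_le (hlip p hp k))) ψ
  have hmain : (z • 1 - H) ψ = basisVec n + χ := by
    refine lp.ext (funext fun k => ?_)
    show z * ψ k - H ψ k = basisVec n k + χ k
    have hb : basisVec n k = (Real.exp (u k) : ℂ) * basisVec n k := by
      rw [basisVec_apply]
      split_ifs with hk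
      · have : u k = 0 := by
          rw [hu, hk]
          simp only [sub_self, len_zero]
          rw [min_eq_left (len_nonneg _), mul_zero]
        rw [this]
        simp
      · simp
    rw [hb, ← heq k, hχk, hH.apply, hψk k, mul_sub, mul_add, Finset.mul_sum]
    have : ∑ p ∈ U, b p k * ψ (k + p) + ∑ p ∈ U, b p k *
        ((Real.exp (u k - u (k + p)) - 1 : ℝ) : ℂ) * ψ (k + p) =
        ∑ p ∈ U, (Real.exp (u k) : ℂ) * (b p k * φ (k + p)) := by
      rw [← Finset.sum_add_distrib]
      refine Finset.sum_congr rfl fun p _ => ?_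
      have hexp : (Real.exp (u k) : ℂ) = ((Real.exp (u k - u (k + p)) : ℝ) : ℂ) *
          ((Real.exp (u (k + p)) : ℝ) : ℂ) := by
        rw [← Complex.ofReal_mul, ← Real.exp_add, sub_add_cancel]
      rw [hψk, hexp]
      push_cast
      ring
    rw [← this]
    ring
  have hψT : ψ = T (basisVec n + χ) := by
    rw [← hmain]
    show ψ = (T * (z • 1 - H)) ψ
    rw [h1]
    rfl
  have hnorm : ‖ψ‖ ≤ κ⁻¹ * (1 + c * ‖ψ‖) := by
    calc ‖ψ‖ = ‖T (basisVec n + χ)‖ := congrArg _ hψT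
      _ ≤ ‖T‖ * ‖basisVec n + χ‖ := T.le_opNorm _
      _ ≤ κ⁻¹ * (1 + c * ‖ψ‖) := by
        refine mul_le_mul hT ((norm_add_le _ _).trans ?_) (norm_nonneg _) (inv_nonneg.2 hκ0.le)
        rw [norm_basisVec]
        exact add_le_add_right hχ 1
  have hψb : ‖ψ‖ ≤ (κ - c)⁻¹ := by
    rw [← div_eq_inv_mul, le_div_iff₀ hκ0] at hnorm
    rw [inv_eq_one_div, le_div_iff₀ (sub_pos.2 hκ)]
    linarith
  have hl := (norm_coord_le ψ l).trans hψb
  rw [hψk, norm_mul, Complex.norm_real, Real.norm_of_nonneg (Real.exp_pos _).le] at hl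
  have hul : u l = η * M := by rw [hu]; simp only [← hM, min_self]
  rw [hul] at hl
  rw [neg_mul, Real.exp_neg, ← div_eq_mul_inv, le_div_iff₀ (Real.exp_pos _), mul_comm]
  exact hl

/-- Resolvents of operators whose potentials agree on a large box are exponentially close near
the centre of the box. -/
theorem IsHopping.norm_entry_resolvent_sub_le {H H' : Hilb d →L[ℂ] Hilb d} {V V' : Lattice d → ℂ}
    {U : Finset (Lattice d)} {b : Lattice d → Lattice d → ℂ} (hH : IsHopping H V U b)
    (hH' : IsHopping H' V' U b) {T T' : Hilb d →L[ℂ] Hilb d} {z : ℂ}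
    (h1 : T * (z • 1 - H) = 1) (h2 : (z • 1 - H') * T' = 1) {C v η γ δ R : ℝ} (hC : 0 ≤ C)
    (hη : 0 ≤ η) (hγ : 0 ≤ γ) (hδ : 0 < δ)
    (hT : ∀ l n, ‖entry T l n‖ ≤ C * Real.exp (-(η + γ + δ) * len (l - n)))
    (hT' : ∀ l n, ‖entry T' l n‖ ≤ C * Real.exp (-(η + γ + δ) * len (l - n)))
    (hv : ∀ k, ‖V k - V' k‖ ≤ v) (hV : ∀ k, len k ≤ R → V k = V' k) (l n : Lattice d) :
    ‖entry T l n - entry T' l n‖ ≤ C ^ 2 * v * (∑' k : Lattice d, Real.exp (-δ * len k)) *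
      Real.exp (-(2 * η * R)) * Real.exp (η * (len l + len n)) *
      Real.exp (-γ * len (l - n)) := by
  have hv0 : 0 ≤ v := (norm_nonneg _).trans (hv 0)
  -- Second resolvent identity; `H - H'` is multiplication by `V - V'`, so only sites outside the
  -- ball of radius `R` contribute.
  have hdiff : T - T' = T * (H - H') * T' := by
    have : T * (H - H') * T' = T * ((z • 1 - H') * T') - T * (z • 1 - H) * T' := by
      noncomm_ring
    rw [this, h1, h2]
    simp
  have hact : ∀ φ k, (H - H') φ k = (V k - V' k) * φ k := by
    intro φ k
    show H φ k - H' φ k = _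
    rw [hH.apply, hH'.apply]
    ring
  have hsum : HasSum (fun k => entry T l k * ((V k - V' k) * entry T' k n))
      (entry T l n - entry T' l n) := by
    have := hasSum_entry T ((H - H') (T' (basisVec n))) l
    have he : entry T l n - entry T' l n = T ((H - H') (T' (basisVec n))) l := by
      show (T - T') (basisVec n) l = _
      rw [hdiff]
      rfl
    rw [he]
    refine this.congr_fun fun k => ?_
    rw [hact]
    rfl
  set E := C ^ 2 * v * Real.exp (-(2 * η * R)) * Real.exp (η * (len l + len n)) *
      Real.exp (-γ * len (l - n)) with hE
  have hE0 : 0 ≤ E := by positivity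
  have hS : HasSum (fun k : Lattice d => E * Real.exp (-δ * len (k - n)))
      (E * ∑' k : Lattice d, Real.exp (-δ * len k)) :=
    HasSum.mul_left _ ((Equiv.subRight n).hasSum_iff.2 (summable_exp_neg_len hδ).hasSum)
  have hbound : ∀ k, ‖entry T l k * ((V k - V' k) * entry T' k n)‖ ≤
      E * Real.exp (-δ * len (k - n)) := by
    intro k
    by_cases hk : len k ≤ R
    · rw [hV k hk]
      simp only [sub_self, zero_mul, mul_zero, norm_zero]
      positivity
    · rw [not_le] at hk
      rw [norm_mul, norm_mul]
      calc ‖entry T l k‖ * (‖V k - V' k‖ * ‖entry T' k n‖)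
          ≤ (C * Real.exp (-(η + γ + δ) * len (l - k))) * (v *
            (C * Real.exp (-(η + γ + δ) * len (k - n)))) :=
            mul_le_mul (hT l k) (mul_le_mul (hv k) (hT' k n) (norm_nonneg _) hv0)
              (by positivity) (by positivity)
        _ = C ^ 2 * v * Real.exp (-(η + γ + δ) * (len (l - k) + len (k - n))) := by
            rw [mul_add, Real.exp_add]
            ring
        -- The rate is spent in three parts. With `η`, the path from `l` through `k` to `n` has
        -- length at least `2R - len l - len n`. With `γ`, it is at least `len (l - n)` long. The
        -- share `δ` makes the sum over `k` converge.
        _ ≤ C ^ 2 * v * Real.exp (-(2 * η * R) + η * (len l + len n) + -γ * len (l - n) +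
            -δ * len (k - n)) := by
            refine mul_le_mul_of_nonneg_left (Real.exp_le_exp.2 ?_) (by positivity)
            have a1 := len_le_add_len_sub k l
            rw [len_sub_comm k l] at a1
            have a2 := len_le_add_len_sub k n
            have a3 := len_sub_le l k n
            have b1 := mul_le_mul_of_nonneg_left a3 hγ
            have b2 := mul_nonneg hδ.le (len_nonneg (l - k))
            have b3 := mul_nonneg hη (sub_nonneg.2 a1)
            have b4 := mul_nonneg hη (sub_nonneg.2 a2)
            have b5 := mul_nonneg hη (sub_nonneg.2 hk.le)
            nlinarith
        _ = E * Real.exp (-δ * len (k - n)) := by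
            rw [hE, Real.exp_add, Real.exp_add, Real.exp_add]
            ring
  rw [← hsum.tsum_eq]
  refine (tsum_of_norm_bounded hS hbound).trans (le_of_eq ?_)
  rw [hE]
  ring

end CombesThomas

/-! ### The hopping form of the Hamiltonian -/

section Hamiltonian

variable {d : ℕ}

/-- The nearest neighbours of the origin. -/
def unitSteps (d : ℕ) : Finset (Lattice d) :=
  (Finset.Icc (fun _ => -1) (fun _ => 1)).filter fun n => ∑ j, n j ^ 2 = 1

theorem mem_unitSteps {n : Lattice d} : n ∈ unitSteps d ↔ ∑ j, n j ^ 2 = 1 := by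
  rw [unitSteps, Finset.mem_filter, and_iff_right_iff_imp]
  intro h
  refine Finset.mem_Icc.2 ⟨fun j => ?_, fun j => ?_⟩ <;>
  · have := Finset.single_le_sum (f := fun j => n j ^ 2) (fun i _ => sq_nonneg (n i))
      (Finset.mem_univ j)
    simp only [h] at this
    nlinarith

theorem len_le_one_of_mem_unitSteps {n : Lattice d} (h : n ∈ unitSteps d) : len n ≤ 1 := by
  have h1 : ∑ j, |n j| ≤ ∑ j, n j ^ 2 := by
    refine Finset.sum_le_sum fun j _ => ?_
    rw [← sq_abs]
    exact Int.le_self_sq _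
  rw [mem_unitSteps.1 h] at h1
  unfold len
  exact_mod_cast h1

theorem card_unitSteps_le (d : ℕ) : (unitSteps d).card ≤ 2 * d := by
  classical
  have hsub : unitSteps d ⊆ (Finset.univ.image fun j : Fin d => (Pi.single j 1 : Lattice d)) ∪
      Finset.univ.image fun j : Fin d => (Pi.single j (-1) : Lattice d) := by
    intro n hn
    rw [mem_unitSteps] at hn
    obtain ⟨j, hj⟩ : ∃ j, n j ≠ 0 := by
      by_contra! h
      simp [h] at hn
    have hj1 : 0 < n j ^ 2 := by positivity
    have hsplit := Finset.add_sum_erase Finset.univ (fun i => n i ^ 2) (Finset.mem_univ j)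
    simp only [hn] at hsplit
    have hnn : 0 ≤ ∑ i ∈ Finset.univ.erase j, n i ^ 2 := Finset.sum_nonneg fun _ _ => sq_nonneg _
    have hz : ∑ i ∈ Finset.univ.erase j, n i ^ 2 = 0 := by omega
    have hsq : n j ^ 2 = 1 := by omega
    have hi : ∀ i, i ≠ j → n i = 0 := fun i hi => by
      have := (Finset.sum_eq_zero_iff_of_nonneg fun i _ => sq_nonneg (n i)).1 hz i (by simp [hi])
      exact pow_eq_zero_iff two_ne_zero |>.1 this
    have he : n = Pi.single j (n j) := by
      funext i
      by_cases h : i = j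
      · subst h; simp
      · rw [hi i h, Pi.single_eq_of_ne h]
    rcases mul_self_eq_one_iff.1 ((sq (n j)).symm.trans hsq) with h | h
    · exact Finset.mem_union_left _ (Finset.mem_image.2 ⟨j, Finset.mem_univ _, by rw [he, h]⟩)
    · exact Finset.mem_union_right _ (Finset.mem_image.2 ⟨j, Finset.mem_univ _, by rw [he, h]⟩)
  refine (Finset.card_le_card hsub).trans ((Finset.card_union_le _ _).trans ?_)
  have h1 := Finset.card_image_le (s := Finset.univ) (f := fun j : Fin d => (Pi.single j 1 : Lattice d))
  have h2 := Finset.card_image_le (s := Finset.univ)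
    (f := fun j : Fin d => (Pi.single j (-1) : Lattice d))
  rw [Finset.card_univ, Fintype.card_fin] at h1 h2
  omega

/-- The potential at the site `k` is read off from `𝔱_k⁻¹ ω` at the origin, hence the reflection `ω
(-k)`. It is harmless because `len` and the cube are symmetric. -/
theorem isHopping_hamiltonian (F : MagneticField d) (W : ℝ) (ω : Disorder d) :
    IsHopping (op (hamiltonian F W) ω) (fun k => ((W * (ω (-k) : ℝ) : ℝ) : ℂ)) (unitSteps d)
      fun p k => phase F (k + p) k := by
  classical
  refine ⟨fun p => len_le_one_of_mem_unitSteps, fun p k => (norm_phase _ _ _).le, fun φ k => ?_⟩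
  have h0 : (0 : Lattice d) ∉ unitSteps d := fun h => by simp [mem_unitSteps] at h
  have hS : ∀ ω, ∀ n ∉ insert 0 (unitSteps d), hamiltonianCore d W ω n = 0 := by
    intro ω n hn
    rw [Finset.mem_insert, not_or, mem_unitSteps] at hn
    show (if ∑ j, n j ^ 2 = 1 then (1 : ℂ) else 0) + (if n = 0 then _ else 0) = 0
    rw [if_neg hn.2, if_neg hn.1, add_zero]
  show rep F (hamiltonianCore d W) ω φ k = _
  rw [rep_apply, tsum_core_eq _ _ _ _ _ hS, Finset.sum_insert h0]
  congr 1
  · show ((if ∑ j, (0 : Lattice d) j ^ 2 = 1 then (1 : ℂ) else 0) +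
      (if (0 : Lattice d) = 0 then ((W * (ω (0 + -k) : ℝ) : ℝ) : ℂ) else 0)) *
      phase F (k + 0) k * φ (k + 0) = _
    rw [add_zero, phase_self, if_pos rfl, zero_add]
    simp
  · refine Finset.sum_congr rfl fun p hp => ?_
    show ((if ∑ j, p j ^ 2 = 1 then (1 : ℂ) else 0) + (if p = 0 then _ else 0)) * _ * _ = _
    have hp0 : p ≠ 0 := fun h => h0 (h ▸ hp)
    rw [if_pos (mem_unitSteps.1 hp), if_neg hp0, add_zero, one_mul]

end Hamiltonian

/-! ### The functional calculus as a superposition of resolvents -/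

section FunctionalCalculus

variable {A : Type*} [CStarAlgebra A]

theorem ne_of_le_infDist {σ : Set ℂ} {κ : ℝ} (hκ : 0 < κ) {z : ℂ} (hz : κ ≤ Metric.infDist z σ)
    {x : ℂ} (hx : x ∈ σ) : z ≠ x := by
  rintro rfl
  rw [Metric.infDist_zero_of_mem hx] at hz
  linarith

theorem norm_inv_sub_le_of_le_infDist {σ : Set ℂ} {κ : ℝ} (hκ : 0 < κ) {z : ℂ}
    (hz : κ ≤ Metric.infDist z σ) {x : ℂ} (hx : x ∈ σ) : ‖(z - x)⁻¹‖ ≤ κ⁻¹ := by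
  rw [norm_inv]
  refine inv_anti₀ hκ (hz.trans ?_)
  rw [← dist_eq_norm]
  exact Metric.infDist_le_dist_of_mem hx

theorem continuousOn_inv_sub {σ : Set ℂ} {κ : ℝ} (hκ : 0 < κ) {z : ℂ}
    (hz : κ ≤ Metric.infDist z σ) : ContinuousOn (fun x : ℂ => (z - x)⁻¹) σ :=
  (continuousOn_const.sub continuousOn_id).inv₀ fun _ hx =>
    sub_ne_zero.2 (ne_of_le_infDist hκ hz hx)

theorem norm_cfc_inv_sub_le (a : A) {κ : ℝ} (hκ : 0 < κ) {z : ℂ}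
    (hz : κ ≤ Metric.infDist z (spectrum ℂ a)) : ‖cfc (fun x : ℂ => (z - x)⁻¹) a‖ ≤ κ⁻¹ :=
  norm_cfc_le (inv_nonneg.2 hκ.le) fun _ hx => norm_inv_sub_le_of_le_infDist hκ hz hx

theorem cfc_sub_id (a : A) [IsStarNormal a] (z : ℂ) : cfc (fun x : ℂ => z - x) a = z • 1 - a := by
  rw [cfc_sub (fun _ : ℂ => z) (fun x => x) a, cfc_const z a, cfc_id' ℂ a,
    Algebra.algebraMap_eq_smul_one]

theorem cfc_inv_sub_mul (a : A) [IsStarNormal a] {κ : ℝ} (hκ : 0 < κ) {z : ℂ}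
    (hz : κ ≤ Metric.infDist z (spectrum ℂ a)) :
    cfc (fun x : ℂ => (z - x)⁻¹) a * (z • 1 - a) = 1 := by
  rw [← cfc_sub_id, ← cfc_mul _ _ a (continuousOn_inv_sub hκ hz), ← cfc_one ℂ a]
  refine cfc_congr fun x hx => ?_
  exact inv_mul_cancel₀ (sub_ne_zero.2 (ne_of_le_infDist hκ hz hx))

theorem mul_cfc_inv_sub (a : A) [IsStarNormal a] {κ : ℝ} (hκ : 0 < κ) {z : ℂ}
    (hz : κ ≤ Metric.infDist z (spectrum ℂ a)) :
    (z • 1 - a) * cfc (fun x : ℂ => (z - x)⁻¹) a = 1 := by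
  rw [← cfc_sub_id, ← cfc_mul _ _ a (by fun_prop) (continuousOn_inv_sub hκ hz), ← cfc_one ℂ a]
  refine cfc_congr fun x hx => ?_
  exact mul_inv_cancel₀ (sub_ne_zero.2 (ne_of_le_infDist hκ hz hx))

theorem isBounded_infDist_le {σ : Set ℂ} (hσ : IsCompact σ) (hne : σ.Nonempty) (r : ℝ) :
    Bornology.IsBounded {z : ℂ | Metric.infDist z σ ≤ r} := by
  obtain ⟨R, hR⟩ := hσ.isBounded.exists_norm_le
  refine isBounded_iff_forall_norm_le.2 ⟨r + R, fun z hz => ?_⟩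
  obtain ⟨x, hx, hzx⟩ := hσ.exists_infDist_eq_dist hne z
  have h1 : ‖z‖ ≤ ‖z - x‖ + ‖x‖ := by simpa using norm_add_le (z - x) x
  rw [← dist_eq_norm, ← hzx] at h1
  exact h1.trans (add_le_add hz (hR x hx))

/-- Any linear functional of `Φ(a)` is controlled by its values on the resolvents of `a` and by the
contour norm of `Φ`. -/
theorem exists_functional_cfc_le [Nontrivial A] {a : A} (ha : IsSelfAdjoint a) {κ₁ κ : ℝ}
    (h0 : 0 < κ₁) (h1 : κ₁ < κ) :
    ∃ K, 0 ≤ K ∧ ∀ Φ, AnalyticOnNhd ℂ Φ {z | Metric.infDist z (spectrum ℂ a) ≤ κ} →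
      ∀ (L : A →L[ℂ] ℂ) (B : ℝ), (∀ z, κ₁ ≤ Metric.infDist z (spectrum ℂ a) →
        ‖L (cfc (fun x : ℂ => (z - x)⁻¹) a)‖ ≤ B) →
      ‖L (cfc Φ a)‖ ≤ K * contourNorm (spectrum ℂ a) κ Φ * B := by
  have := ha.isStarNormal
  set σ := spectrum ℂ a with hσd
  have hσ : IsCompact σ := spectrum.isCompact a
  have hne : σ.Nonempty := spectrum.nonempty a
  set S := Complex.ofReal ⁻¹' σ with hS
  have hSσ : Complex.ofReal '' S = σ := by
    rw [hS, image_preimage_eq_iff]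
    intro x hx
    exact ⟨x.re, (ha.mem_spectrum_eq_re hx).symm⟩
  have hSc : IsCompact S := Complex.isometry_ofReal.isClosedEmbedding.isCompact_preimage hσ
  have hSne : S.Nonempty := by
    rw [← hSσ] at hne
    exact hne.of_image
  obtain ⟨κ₂, h12, h2⟩ := exists_between h1
  obtain ⟨c, hc, hcs, hcΦ⟩ := exists_cauchy_weight hσ hne h12 h2
  obtain ⟨C, hC, hsup⟩ := exists_sup_le_hausdorff_integral hSc hSne (h0.trans h1) h2
  rw [hSσ] at hsup
  have hcc : HasCompactSupport c := HasCompactSupport.of_support_subset_isCompact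
    (Metric.isCompact_of_isClosed_isBounded (isClosed_le (Metric.continuous_infDist_pt σ)
      continuous_const) (isBounded_infDist_le hσ hne κ₂)) fun z hz => (hcs z hz).2
  have hci : Integrable c := hc.integrable_of_hasCompactSupport hcc
  refine ⟨(∫ z, ‖c z‖) * C * (2 * Real.pi), by positivity, fun Φ hΦ L B hB => ?_⟩
  set g : ℂ → ℂ := fun z => c z * Φ z with hg
  have hgc : Continuous g := by
    rw [continuous_iff_continuousAt]
    intro z
    rcases lt_or_ge (Metric.infDist z σ) κ with hz | hz
    -- Analyticity gives continuity of `Φ` up to distance `κ`; from there on `c` vanishes in a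
    -- neighbourhood, whatever the values of `Φ`.
    · exact hc.continuousAt.mul (hΦ z hz.le).continuousAt
    · have hev : ∀ᶠ w in nhds z, κ₂ < Metric.infDist w σ :=
        (Metric.continuous_infDist_pt σ).continuousAt.eventually_const_lt (h2.trans_le hz)
      refine (continuousAt_const (y := (0 : ℂ))).congr ?_
      filter_upwards [hev] with w hw
      rw [hg]
      by_contra hne0
      have : c w ≠ 0 := fun h => hne0 (by simp [h])
      exact absurd (hcs w this).2 (not_le.2 hw)
  have hgs : ∀ z, g z ≠ 0 → κ₁ ≤ Metric.infDist z σ := fun z hz =>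
    (hcs z (left_ne_zero_of_mul hz)).1
  have hgi : Integrable g := hgc.integrable_of_hasCompactSupport hcc.mul_right
  -- As `g` vanishes within distance `κ₁` of the spectrum, the poles play no role. So `f` is
  -- continuous with an integrable bound uniform on the spectrum, and the functional calculus
  -- commutes with the integral over `z`.
  set f : ℂ → ℂ → ℂ := fun z x => g z * (z - x)⁻¹ with hf
  have hfc : ContinuousOn (Function.uncurry f) (univ ×ˢ σ) := by
    rintro ⟨z, x⟩ ⟨-, hx⟩
    refine ContinuousAt.continuousWithinAt ?_
    rcases lt_or_ge (Metric.infDist z σ) κ₁ with hz | hz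
    · have hev : ∀ᶠ p in nhds (z, x), Metric.infDist p.1 σ < κ₁ :=
        ((Metric.continuous_infDist_pt σ).comp continuous_fst).continuousAt.eventually_lt_const hz
      refine (continuousAt_const (y := (0 : ℂ))).congr ?_
      filter_upwards [hev] with p hp
      have : g p.1 = 0 := by
        by_contra h
        exact absurd (hgs _ h) (not_le.2 hp)
      simp [Function.uncurry, hf, this]
    · exact (hgc.comp continuous_fst).continuousAt.mul
        ((continuous_fst.sub continuous_snd).continuousAt.inv₀
          (sub_ne_zero.2 (ne_of_le_infDist h0 hz hx)))
  have hfb : ∀ z, ∀ x ∈ σ, ‖f z x‖ ≤ ‖g z‖ * κ₁⁻¹ := by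
    intro z x hx
    by_cases hz : g z = 0
    · simp [hf, hz]
    · rw [hf, norm_mul]
      exact mul_le_mul_of_nonneg_left (norm_inv_sub_le_of_le_infDist h0 (hgs z hz) hx)
        (norm_nonneg _)
  have hbi : HasFiniteIntegral (fun z => ‖g z‖ * κ₁⁻¹) :=
    (hgi.norm.mul_const κ₁⁻¹).hasFiniteIntegral
  have hcfc : cfc Φ a = ∫ z, cfc (f z) a := by
    rw [← cfc_integral f (fun z => ‖g z‖ * κ₁⁻¹) a hfc (.of_forall hfb) hbi]
    refine cfc_congr fun x hx => ?_
    rw [hcΦ Φ hΦ x (by rw [Metric.infDist_zero_of_mem hx]; exact h0)]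
    rfl
  have hint : Integrable (fun z => cfc (f z) a) :=
    integrable_cfc f (fun z => ‖g z‖ * κ₁⁻¹) a hfc (.of_forall hfb) hbi
  rw [hcfc, ← ContinuousLinearMap.integral_comp_comm L hint]
  set I := ∫ z in {z | Metric.infDist z σ = κ}, ‖Φ z‖ ∂(Measure.hausdorffMeasure 1) with hI
  have hcn : (2 * Real.pi) * contourNorm σ κ Φ = I := by
    rw [contourNorm, ← mul_assoc, mul_inv_cancel₀ (by positivity), one_mul]
  have hbound : ∀ z, ‖L (cfc (f z) a)‖ ≤ ‖c z‖ * (C * I * B) := by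
    intro z
    by_cases hz : g z = 0
    · have : f z = fun _ => 0 := by
        funext x
        simp [hf, hz]
      rw [this, cfc_const_zero, map_zero, norm_zero]
      -- The sign of `B` is known only once some admissible `z` exists, which `c z ≠ 0` provides.
      by_cases hcz : c z = 0
      · simp [hcz]
      · have hB0 : 0 ≤ B := (norm_nonneg _).trans (hB z (hcs z hcz).1)
        have hI0 : 0 ≤ I := integral_nonneg fun _ => norm_nonneg _
        positivity
    · have hcz := hcs z (left_ne_zero_of_mul hz)
      have hfz : cfc (f z) a = g z • cfc (fun x : ℂ => (z - x)⁻¹) a := by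
        rw [← cfc_smul (g z) _ a (continuousOn_inv_sub h0 hcz.1)]
        rfl
      rw [hfz, map_smul, norm_smul, hg, norm_mul, mul_assoc]
      refine mul_le_mul_of_nonneg_left ?_ (norm_nonneg _)
      have hs := hsup Φ hΦ z hcz.2
      exact mul_le_mul hs (hB z hcz.1) (norm_nonneg _) ((norm_nonneg _).trans hs)
  refine (norm_integral_le_of_norm_le (hci.norm.mul_const _) (.of_forall hbound)).trans ?_
  rw [integral_mul_const, ← hcn]
  exact le_of_eq (by ring)

end FunctionalCalculus

/-! ### Localised observables -/

section Localised

variable {d : ℕ} {F : MagneticField d}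

instance Disorder.instNonempty (d : ℕ) : Nonempty (Disorder d) := ⟨fun _ => ⟨0, by norm_num⟩⟩

instance Observables.nontrivial {X : Type*} [TopologicalSpace X] [AddAction (Lattice d) X]
    [ContinuousConstVAdd (Lattice d) X] [CompactSpace X] [Nonempty X] :
    Nontrivial (Observables F X) := by
  obtain ⟨ω⟩ := ‹Nonempty X›
  refine ⟨⟨1, 0, fun h => ?_⟩⟩
  have h1 : op (1 : Observables F X) ω = op (0 : Observables F X) ω := by rw [h]
  exact one_ne_zero (α := Hilb d →L[ℂ] Hilb d) h1

/-- Two configurations agree on the cube `{-𝒩, …, 𝒩}^d`. -/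
def AgreeOnCube (𝒩 : ℕ) (ω ω' : Disorder d) : Prop :=
  ∀ k : Lattice d, (∀ j, |k j| ≤ 𝒩) → ω k = ω' k

/-- The matrix elements of `T` decay at rate `ρ` off the diagonal and depend on the disorder
outside a cube only through terms that are exponentially small in the size of the cube. -/
structure IsLocalised (A ρ η γ : ℝ) (T : Disorder d → Hilb d →L[ℂ] Hilb d) : Prop where
  decay : ∀ ω l n, ‖entry (T ω) l n‖ ≤ A * Real.exp (-ρ * len (l - n))
  agree : ∀ (𝒩 : ℕ) ω ω', AgreeOnCube 𝒩 ω ω' → ∀ l n,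
    ‖entry (T ω) l n - entry (T ω') l n‖ ≤
      A * Real.exp (-(2 * η * 𝒩)) * Real.exp (η * (len l + len n)) * Real.exp (-γ * len (l - n))

theorem AgreeOnCube.eq_of_len_le {𝒩 : ℕ} {ω ω' : Disorder d} (h : AgreeOnCube 𝒩 ω ω')
    {k : Lattice d} (hk : len k ≤ 𝒩) : ω k = ω' k :=
  h k fun j => by
    have := (abs_coord_le_len k j).trans hk
    exact_mod_cast this

theorem abs_amplitude_sub_le (x y : Amplitude) : |(x : ℝ) - y| ≤ 1 := by
  obtain ⟨x, hx1, hx2⟩ := x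
  obtain ⟨y, hy1, hy2⟩ := y
  rw [abs_le]
  constructor <;> simp only <;> linarith

theorem op_inv_sub_mul (a : Observables F (Disorder d)) (R : Observables F (Disorder d)) {z : ℂ}
    (h : R * (z • 1 - a) = 1) (ω : Disorder d) : op R ω * (z • 1 - op a ω) = 1 := by
  rw [← op_one (F := F) ω, ← op_smul, ← op_sub, ← op_mul, h]

theorem op_mul_inv_sub (a : Observables F (Disorder d)) (R : Observables F (Disorder d)) {z : ℂ}
    (h : (z • 1 - a) * R = 1) (ω : Disorder d) : (z • 1 - op a ω) * op R ω = 1 := by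
  rw [← op_one (F := F) ω, ← op_smul, ← op_sub, ← op_mul, h]

/-- Of the total rate `η + 2δ`, one `δ` pays for the sum over sites in the resolvent identity. The
other survives as off-diagonal decay of the difference, to absorb derivatives later. The constant
does not depend on `z`. -/
theorem exists_isLocalised_of_inverse (F : MagneticField d) (W : ℝ) {κ η δ : ℝ} (hη : 0 ≤ η)
    (hδ : 0 < δ) (hκ : 2 * d * (Real.exp (η + δ + δ) - 1) < κ) :
    ∃ C, 0 ≤ C ∧ ∀ (H : Disorder d → Hilb d →L[ℂ] Hilb d) (z : ℂ)
      (T : Disorder d → Hilb d →L[ℂ] Hilb d),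
      (∀ ω, IsHopping (H ω) (fun k => ((W * (ω (-k) : ℝ) : ℝ) : ℂ)) (unitSteps d)
        fun p k => phase F (k + p) k) →
      (∀ ω, T ω * (z • 1 - H ω) = 1) → (∀ ω, (z • 1 - H ω) * T ω = 1) → (∀ ω, ‖T ω‖ ≤ κ⁻¹) →
      IsLocalised C (η + δ + δ) η δ T := by
  have he : 0 ≤ Real.exp (η + δ + δ) - 1 := by
    linarith [Real.add_one_le_exp (η + δ + δ)]
  have hcκ : (unitSteps d).card * (Real.exp (η + δ + δ) - 1) < κ :=
    lt_of_le_of_lt (mul_le_mul_of_nonneg_right (by exact_mod_cast card_unitSteps_le d) he) hκ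
  obtain ⟨C, hC⟩ : ∃ C, C = (κ - (unitSteps d).card * (Real.exp (η + δ + δ) - 1))⁻¹ := ⟨_, rfl⟩
  have hC0 : 0 ≤ C := hC ▸ inv_nonneg.2 (sub_nonneg.2 hcκ.le)
  obtain ⟨D, hD⟩ : ∃ D, D = C ^ 2 * |W| * (∑' k : Lattice d, Real.exp (-δ * len k)) := ⟨_, rfl⟩
  have hD0 : 0 ≤ D := hD ▸ mul_nonneg (by positivity) (tsum_nonneg fun _ => (Real.exp_pos _).le)
  refine ⟨C + D, by positivity, fun H z T hH h1 h2 hT => ?_⟩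
  have hdec : ∀ ω l n, ‖entry (T ω) l n‖ ≤ C * Real.exp (-(η + δ + δ) * len (l - n)) :=
    fun ω l n => hC ▸ (hH ω).norm_entry_resolvent_le (h1 ω) (h2 ω) (by positivity) (hT ω) hcκ l n
  refine ⟨fun ω l n => (hdec ω l n).trans ?_, fun 𝒩 ω ω' hω l n => ?_⟩
  · exact mul_le_mul_of_nonneg_right (le_add_of_nonneg_right hD0) (Real.exp_pos _).le
  · refine ((hH ω).norm_entry_resolvent_sub_le
      (hH ω') (v := |W|) (R := 𝒩) (h1 ω) (h2 ω') hC0 hη hδ.le hδ (hdec ω) (hdec ω') (fun k => ?_)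
      (fun k hk => ?_) l n).trans ?_
    · rw [← Complex.ofReal_sub, ← mul_sub, Complex.norm_real, Real.norm_eq_abs, abs_mul]
      exact mul_le_of_le_one_right (abs_nonneg _) (abs_amplitude_sub_le _ _)
    -- The ball `len k ≤ 𝒩` lies in the cube.
    · rw [hω.eq_of_len_le (by rwa [len_neg])]
    · refine mul_le_mul_of_nonneg_right (mul_le_mul_of_nonneg_right
        (mul_le_mul_of_nonneg_right ?_ (Real.exp_pos _).le) (Real.exp_pos _).le)
        (Real.exp_pos _).le
      exact hD ▸ le_add_of_nonneg_left hC0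

theorem exists_functional_cfc_hamiltonian_le (F : MagneticField d) (W : ℝ) {κ₁ κ : ℝ}
    (h0 : 0 < κ₁) (h1 : κ₁ < κ) :
    ∃ K, 0 ≤ K ∧ ∀ Φ, AnalyticOnNhd ℂ Φ
        {z | Metric.infDist z (spectrum ℂ (hamiltonian F W)) ≤ κ} →
      ∀ (L : Observables F (Disorder d) →L[ℂ] ℂ) (B : ℝ),
      (∀ (z : ℂ) (R : Observables F (Disorder d)),
        (∀ ω, op R ω * (z • 1 - op (hamiltonian F W) ω) = 1) →
        (∀ ω, (z • 1 - op (hamiltonian F W) ω) * op R ω = 1) →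
        (∀ ω, ‖op R ω‖ ≤ κ₁⁻¹) → ‖L R‖ ≤ B) →
      ‖L (cfc Φ (hamiltonian F W))‖ ≤
        K * contourNorm (spectrum ℂ (hamiltonian F W)) κ Φ * B := by
  have := (isSelfAdjoint_hamiltonian F W).isStarNormal
  exact (exists_functional_cfc_le (isSelfAdjoint_hamiltonian F W) h0 h1).imp fun K hK =>
    ⟨hK.1, fun Φ hΦ L B hB => hK.2 Φ hΦ L B fun z hz => hB z _
      (op_inv_sub_mul _ _ (cfc_inv_sub_mul (hamiltonian F W) h0 hz))
      (op_mul_inv_sub _ _ (mul_cfc_inv_sub (hamiltonian F W) h0 hz))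
      fun ω => (norm_op_le _ ω).trans (norm_cfc_inv_sub_le (hamiltonian F W) h0 hz)⟩

theorem contourNorm_nonneg (σ : Set ℂ) (κ : ℝ) (Φ : ℂ → ℂ) : 0 ≤ contourNorm σ κ Φ :=
  mul_nonneg (by positivity) (integral_nonneg fun _ => norm_nonneg _)

theorem mul_rearrange₄ (K c C e : ℝ) : K * c * (C * e) = K * C * c * e := by ring

theorem mul_rearrange₆ (K c C e e' e'' : ℝ) :
    K * c * (C * e * e' * e'') = K * C * c * e * e' * e'' := by ring

/-- Both clauses of `IsLocalised` bound a continuous linear functional: a matrix element, or the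
difference of matrix elements at two configurations. So they pass from the resolvents to `Φ(h)`. -/
theorem exists_isLocalised_cfc_hamiltonian (F : MagneticField d) (W : ℝ) {κ η δ : ℝ} (hη : 0 ≤ η)
    (hδ : 0 < δ) (hκ : 2 * d * (Real.exp (η + δ + δ) - 1) < κ) :
    ∃ K, 0 ≤ K ∧ ∀ Φ, AnalyticOnNhd ℂ Φ
        {z | Metric.infDist z (spectrum ℂ (hamiltonian F W)) ≤ κ} →
      IsLocalised (K * contourNorm (spectrum ℂ (hamiltonian F W)) κ Φ) (η + δ + δ) η δ
        (op (cfc Φ (hamiltonian F W))) := by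
  -- The resolvents enter at distance at least `κ₁ < κ`, still large enough for the Combes–Thomas
  -- rate; the gap to `κ` is needed to estimate `Φ` inside the contour.
  refine (exists_between hκ).elim fun κ₁ hκ₁ => ?_
  have h0 : 0 < κ₁ := lt_of_le_of_lt (mul_nonneg (by positivity)
    (by linarith [Real.add_one_le_exp (η + δ + δ)])) hκ₁.1
  refine (exists_isLocalised_of_inverse F W hη hδ hκ₁.1).elim fun C hC => ?_
  refine (exists_functional_cfc_hamiltonian_le F W h0 hκ₁.2).imp' (fun K => K * C) fun K hK =>
    ⟨mul_nonneg hK.1 hC.1, fun Φ hΦ => ⟨fun ω l n => ?_, fun 𝒩 ω ω' hω l n => ?_⟩⟩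
  · exact (hK.2 Φ hΦ (entryCLM F ω l n) _ fun z R hR1 hR2 hR =>
      (hC.2 (op (hamiltonian F W)) z (op R) (isHopping_hamiltonian F W) hR1 hR2 hR).decay
        ω l n).trans_eq (mul_rearrange₄ _ _ _ _)
  · exact (hK.2 Φ hΦ (entryCLM F ω l n - entryCLM F ω' l n) _ fun z R hR1 hR2 hR =>
      (hC.2 (op (hamiltonian F W)) z (op R) (isHopping_hamiltonian F W) hR1 hR2 hR).agree
        𝒩 ω ω' hω l n).trans_eq (mul_rearrange₆ _ _ _ _ _ _)

/-! ### Mixed derivatives -/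

theorem IsMixedDerivative.unique {α : Fin d → ℕ} {f g g' : Observables F (Disorder d)}
    (hg : IsMixedDerivative α f g) (hg' : IsMixedDerivative α f g') : g = g' :=
  kernel_injective fun ω n => by rw [hg, hg']

/-- Half of the decay absorbs the polynomial factor, the other half makes the kernel summable over
the lattice. -/
theorem IsLocalised.exists_isMixedDerivative {A ρ η γ : ℝ} {f : Observables F (Disorder d)}
    (hf : IsLocalised A ρ η γ (op f)) (hρ : 0 < ρ) (α : Fin d → ℕ) :
    ∃ g, IsMixedDerivative α f g := by
  obtain ⟨C, hC, hCα⟩ := exists_prod_pow_le_exp_len α (half_pos hρ)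
  have hA : 0 ≤ A := by
    have := (norm_nonneg _).trans (hf.decay (Classical.arbitrary _) 0 0)
    simpa [len_zero] using this
  refine exists_kernel_eq_of_summable
    (a := fun n ω => (∏ j, (Complex.I * (n j : ℂ)) ^ α j) * kernel f ω n)
    (fun n => continuous_const.mul (continuous_kernel f n))
    (b := fun n => C * A * Real.exp (-(ρ / 2) * len n)) (fun n => by positivity)
    (fun n ω => ?_) ((summable_exp_neg_len (half_pos hρ)).mul_left _)
  have h1 := hf.decay ω 0 n
  rw [← kernel_eq_entry, zero_sub, len_neg] at h1
  rw [norm_mul]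
  refine (mul_le_mul (hCα n) h1 (norm_nonneg _) (by positivity)).trans (le_of_eq ?_)
  rw [mul_mul_mul_comm, ← Real.exp_add]
  ring_nf

theorem IsMixedDerivative.entry_op {α : Fin d → ℕ} {f g : Observables F (Disorder d)}
    (hg : IsMixedDerivative α f g) (ω : Disorder d) (l n : Lattice d) :
    entry (op g ω) l n = (∏ j, (Complex.I * ((n - l) j : ℂ)) ^ α j) * entry (op f ω) l n := by
  rw [BrillouinTorus.entry_op, BrillouinTorus.entry_op, hg, mul_assoc]

/-- By covariance a derivative multiplies the matrix element at `(l, n)` by a polynomial in `n - l`,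
independent of the configuration. It costs the rate `δ` in both bounds, which uses up the residual
decay of the difference. -/
theorem exists_isLocalised_mixedDerivative (α : Fin d → ℕ) {δ : ℝ} (hδ : 0 < δ) :
    ∃ C, 0 ≤ C ∧ ∀ (A ρ η : ℝ) (f g : Observables F (Disorder d)), IsLocalised A (ρ + δ) η δ (op f) →
      IsMixedDerivative α f g → IsLocalised (C * A) ρ η 0 (op g) := by
  obtain ⟨C, hC, hCα⟩ := exists_prod_pow_le_exp_len α hδ
  refine ⟨C, hC, fun A ρ η f g hf hg => ⟨fun ω l n => ?_, fun 𝒩 ω ω' hω l n => ?_⟩⟩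
  · rw [hg.entry_op, norm_mul]
    refine (mul_le_mul (hCα _) (hf.decay ω l n) (norm_nonneg _) (by positivity)).trans
      (le_of_eq ?_)
    rw [len_sub_comm n l, mul_mul_mul_comm, ← Real.exp_add]
    ring_nf
  · rw [hg.entry_op, hg.entry_op, ← mul_sub, norm_mul]
    refine (mul_le_mul (hCα _) (hf.agree 𝒩 ω ω' hω l n) (norm_nonneg _) (by positivity)).trans
      (le_of_eq ?_)
    have : Real.exp (δ * len (l - n)) * Real.exp (-δ * len (l - n)) = 1 := by
      rw [← Real.exp_add]
      simp
    rw [len_sub_comm n l, neg_zero, zero_mul, Real.exp_zero, mul_one]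
    linear_combination (C * A * Real.exp (-(2 * η * 𝒩)) * Real.exp (η * (len l + len n))) * this

/-! ### Products of localised observables -/

theorem hasSum_exp_neg_len_sub {δ : ℝ} (hδ : 0 < δ) (l : Lattice d) :
    HasSum (fun m : Lattice d => Real.exp (-δ * len (l - m)))
      (∑' k : Lattice d, Real.exp (-δ * len k)) := by
  have := (Equiv.subLeft l).hasSum_iff.2 (summable_exp_neg_len (d := d) hδ).hasSum
  exact this

/-- The column `T δ_0` of a product of localised observables. -/
theorem exists_column_prod_le {η δ : ℝ} (hη : 0 ≤ η) (hδ : 0 < δ) (N : ℕ) :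
    ∃ K, 0 ≤ K ∧ ∀ (A : Fin N → ℝ) (T : Fin N → Disorder d → Hilb d →L[ℂ] Hilb d),
      (∀ j, IsLocalised (A j) (η + δ + δ) η 0 (T j)) →
      (∀ ω l, ‖entry (List.ofFn fun j => T j ω).prod l 0‖ ≤
        K * (∏ j, A j) * Real.exp (-(η + δ) * len l)) ∧
      ∀ (𝒩 : ℕ) ω ω', AgreeOnCube 𝒩 ω ω' → ∀ l,
        ‖entry (List.ofFn fun j => T j ω).prod l 0 - entry (List.ofFn fun j => T j ω').prod l 0‖ ≤
          K * (∏ j, A j) * Real.exp (-(2 * η * 𝒩)) * Real.exp (η * len l) := by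
  obtain ⟨S, hS⟩ : ∃ S, S = ∑' k : Lattice d, Real.exp (-δ * len k) := ⟨_, rfl⟩
  have hS0 : 0 ≤ S := hS ▸ tsum_nonneg fun _ => (Real.exp_pos _).le
  induction N with
  | zero =>
    refine ⟨1, zero_le_one, fun A T hf => ?_⟩
    simp only [List.ofFn_zero, List.prod_nil, Finset.univ_eq_empty, Finset.prod_empty]
    refine ⟨fun ω l => ?_, fun 𝒩 ω ω' _ l => ?_⟩
    · show ‖basisVec 0 l‖ ≤ _
      rw [basisVec_apply]
      split_ifs with h
      · simp [h, len_zero]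
      · rw [norm_zero]
        positivity
    · rw [sub_self, norm_zero]
      positivity
  | succ N ih =>
    obtain ⟨K, hK, ih⟩ := ih
    -- The factor `2 S` comes from the two terms of the telescoped difference, each summed over the
    -- intermediate site with `∑ e^(-δ len) = S`.
    refine ⟨2 * S * K, by positivity, fun A T hf => ?_⟩
    obtain ⟨ih1, ih2⟩ := ih (fun j => A j.succ) (fun j => T j.succ) fun j => hf j.succ
    obtain ⟨P, hP⟩ : ∃ P : Disorder d → Hilb d →L[ℂ] Hilb d,
        ∀ ω, (List.ofFn fun j : Fin N => T j.succ ω).prod = P ω := ⟨_, fun _ => rfl⟩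
    simp only [hP] at ih1 ih2
    have hA : ∀ j, 0 ≤ A j := fun j => by
      have := (norm_nonneg _).trans ((hf j).decay (Classical.arbitrary _) 0 0)
      simpa [len_zero] using this
    obtain ⟨A', hA'⟩ : ∃ A', A' = K * ∏ j : Fin N, A j.succ := ⟨_, rfl⟩
    rw [← hA'] at ih1 ih2
    have hA'0 : 0 ≤ A' := hA' ▸ mul_nonneg hK (Finset.prod_nonneg fun j _ => hA _)
    have hprod : 2 * S * K * ∏ j, A j = 2 * (A 0 * A' * S) := by
      rw [Fin.prod_univ_succ, hA']
      ring
    have hpos : 0 ≤ A 0 * A' * S := mul_nonneg (mul_nonneg (hA 0) hA'0) hS0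
    have hcol : ∀ ω l, HasSum (fun m => entry (T 0 ω) l m * entry (P ω) m 0)
        (entry (List.ofFn fun j => T j ω).prod l 0) := by
      intro ω l
      rw [List.ofFn_succ, List.prod_cons, hP]
      exact hasSum_entry (T 0 ω) (P ω (basisVec 0)) l
    rw [hprod]
    refine ⟨fun ω l => ?_, fun 𝒩 ω ω' hω l => ?_⟩
    · rw [← (hcol ω l).tsum_eq]
      refine (tsum_of_norm_bounded ((hasSum_exp_neg_len_sub hδ l).mul_left
        (A 0 * A' * Real.exp (-(η + δ) * len l))) fun m => ?_).trans ?_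
      · rw [norm_mul]
        refine (mul_le_mul ((hf 0).decay ω l m) (ih1 ω m) (norm_nonneg _)
          (mul_nonneg (hA 0) (Real.exp_pos _).le)).trans ?_
        rw [mul_mul_mul_comm, mul_assoc (A 0 * A'), ← Real.exp_add, ← Real.exp_add]
        refine mul_le_mul_of_nonneg_left (Real.exp_le_exp.2 ?_) (mul_nonneg (hA 0) hA'0)
        have := mul_nonneg (add_nonneg hη hδ.le) (sub_nonneg.2 (len_le_add_len_sub l m))
        linarith
      · rw [← hS]
        have := mul_nonneg hpos (Real.exp_pos (-(η + δ) * len l)).le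
        linarith
    -- Telescoping `T P - T' P' = (T - T') P + T' (P - P')`. The growth `e^(η len m)` is beaten in
    -- the first term by the decay of the column of `P`, in the second by that of `T'` in `l - m`,
    -- leaving `e^(η len l)`. This is why the column at the origin is followed and not all matrix
    -- elements.
    · have h1 : HasSum (fun m => (entry (T 0 ω) l m - entry (T 0 ω') l m) *
            entry (P ω) m 0 + entry (T 0 ω') l m *
            (entry (P ω) m 0 - entry (P ω') m 0))
          (entry (List.ofFn fun j => T j ω).prod l 0 - entry (List.ofFn fun j => T j ω').prod l 0) :=
        ((hcol ω l).sub (hcol ω' l)).congr_fun fun m => by ring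
      obtain ⟨E, hE⟩ : ∃ E, E = A 0 * A' * (Real.exp (-(2 * η * 𝒩)) * Real.exp (η * len l)) :=
        ⟨_, rfl⟩
      have hs0 : HasSum (fun m : Lattice d => Real.exp (-δ * len m)) S := hS ▸
        (summable_exp_neg_len hδ).hasSum
      rw [← h1.tsum_eq]
      refine (tsum_of_norm_bounded ((hs0.mul_left E).add
        ((hasSum_exp_neg_len_sub hδ l).mul_left E)) fun m => ?_).trans (le_of_eq ?_)
      · refine (norm_add_le _ _).trans (add_le_add ?_ ?_)
        · rw [norm_mul]
          refine (mul_le_mul ((hf 0).agree 𝒩 ω ω' hω l m) (ih1 ω m) (norm_nonneg _)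
            ((norm_nonneg _).trans ((hf 0).agree 𝒩 ω ω' hω l m))).trans (le_of_eq ?_)
          have : Real.exp (η * (len l + len m)) * Real.exp (-(η + δ) * len m) =
              Real.exp (η * len l) * Real.exp (-δ * len m) := by
            rw [← Real.exp_add, ← Real.exp_add]
            ring_nf
          rw [neg_zero, zero_mul, Real.exp_zero, mul_one, hE]
          linear_combination (A 0 * A' * Real.exp (-(2 * η * 𝒩))) * this
        · rw [norm_mul]
          refine (mul_le_mul ((hf 0).decay ω' l m) (ih2 𝒩 ω ω' hω m) (norm_nonneg _)
            (mul_nonneg (hA 0) (Real.exp_pos _).le)).trans ?_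
          have h2 : Real.exp (-(η + δ + δ) * len (l - m)) * Real.exp (η * len m) ≤
              Real.exp (η * len l) * Real.exp (-δ * len (l - m)) := by
            rw [← Real.exp_add, ← Real.exp_add]
            refine Real.exp_le_exp.2 ?_
            have h3 := len_le_add_len_sub m l
            rw [len_sub_comm m l] at h3
            have := mul_nonneg hη (sub_nonneg.2 h3)
            have := mul_nonneg hδ.le (len_nonneg (l - m))
            linarith
          have := mul_le_mul_of_nonneg_left h2 (mul_nonneg (mul_nonneg (hA 0) hA'0)
            (Real.exp_pos (-(2 * η * 𝒩))).le)
          refine le_trans (le_of_eq ?_) (this.trans (le_of_eq ?_))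
          · ring
          · rw [hE]
            ring
      · rw [hE, ← hS]
        ring

end Localised

/-! ### Comparison of the traces -/

section Traces

variable {d : ℕ} {F : MagneticField d}

instance Disorder.instBorelSpace (d : ℕ) : BorelSpace (Disorder d) :=
  inferInstanceAs (BorelSpace (Lattice d → Amplitude))

instance Disorder.instIsProbabilityMeasure (d : ℕ) : IsProbabilityMeasure (Disorder.prob d) :=
  inferInstanceAs (IsProbabilityMeasure (Measure.infinitePi fun _ : Lattice d => uniformLaw))

/-- The amplitudes of a configuration on the unit cell. -/
def cellValues (𝒩 : ℕ) (ω : Disorder d) : PeriodicDisorder.Cell d 𝒩 → Amplitude :=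
  fun c => ω fun j => (c j : ℤ)

/-- The periodic configuration that agrees with `ω` on the unit cell. -/
def periodize (𝒩 : ℕ) (ω : Disorder d) : Disorder d :=
  PeriodicDisorder.incl (PeriodicDisorder.ofCell (cellValues 𝒩 ω))

theorem measurable_cellValues (𝒩 : ℕ) :
    Measurable (cellValues 𝒩 : Disorder d → PeriodicDisorder.Cell d 𝒩 → Amplitude) :=
  measurable_pi_lambda _ fun c => measurable_pi_apply (fun j => (c j : ℤ) : Lattice d)

theorem measurable_incl (𝒩 : ℕ) :
    Measurable (PeriodicDisorder.incl : PeriodicDisorder d 𝒩 → Disorder d) :=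
  measurable_subtype_coe

theorem measurable_periodize (𝒩 : ℕ) : Measurable (periodize 𝒩 : Disorder d → Disorder d) :=
  (measurable_incl 𝒩).comp (PeriodicDisorder.measurable_ofCell.comp (measurable_cellValues 𝒩))

theorem map_cellValues (d 𝒩 : ℕ) : (Disorder.prob d).map (cellValues 𝒩) =
    Measure.pi fun _ : PeriodicDisorder.Cell d 𝒩 => uniformLaw := by
  rw [← Measure.infinitePi_eq_pi]
  refine Measure.map_infinitePi_infinitePi_of_inj (P := fun _ : Lattice d => uniformLaw)
    (f := fun (c : PeriodicDisorder.Cell d 𝒩) j => (c j : ℤ)) fun c c' h => ?_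
  exact funext fun j => Subtype.ext (congrFun h j)

theorem agreeOnCube_periodize (𝒩 : ℕ) (ω : Disorder d) : AgreeOnCube 𝒩 ω (periodize 𝒩 ω) := by
  intro k hk
  show ω k = ω fun j => Int.bmod (k j) (2 * 𝒩 + 1)
  congr 1
  funext j
  have := abs_le.1 (hk j)
  symm
  apply Int.bmod_eq_of_le <;> omega

/-- The amplitudes on the cell have under `P` the product law (`map_cellValues`), so the
periodization of a random configuration is distributed by the periodic measure. -/
theorem integral_periodicProb (𝒩 : ℕ) {G : Disorder d → ℂ} (hG : Measurable G) :
    ∫ y, G (PeriodicDisorder.incl y) ∂(PeriodicDisorder.prob d 𝒩) =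
      ∫ ω, G (periodize 𝒩 ω) ∂(Disorder.prob d) := by
  have hm : Measurable fun y : PeriodicDisorder d 𝒩 => G (PeriodicDisorder.incl y) :=
    hG.comp (measurable_incl 𝒩)
  rw [PeriodicDisorder.prob, integral_map PeriodicDisorder.measurable_ofCell.aemeasurable
    hm.aestronglyMeasurable, ← map_cellValues]
  exact integral_map (measurable_cellValues 𝒩).aemeasurable
    (hm.comp PeriodicDisorder.measurable_ofCell).aestronglyMeasurable

/-- The coupling argument: `ω` and its periodization agree on the cube, so the integrands are
pointwise within `D`. -/
theorem norm_integral_sub_periodicProb_le (𝒩 : ℕ) {G : Disorder d → ℂ} (hG : Continuous G)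
    {D : ℝ} (hD : ∀ ω ω', AgreeOnCube 𝒩 ω ω' → ‖G ω - G ω'‖ ≤ D) :
    ‖∫ ω, G ω ∂(Disorder.prob d) -
      ∫ y, G (PeriodicDisorder.incl y) ∂(PeriodicDisorder.prob d 𝒩)‖ ≤ D := by
  obtain ⟨C, hC⟩ := (isCompact_range hG).isBounded.exists_norm_le
  have hb : ∀ ω, ‖G ω‖ ≤ C := fun ω => hC _ ⟨ω, rfl⟩
  have h1 : Integrable G (Disorder.prob d) :=
    Integrable.of_bound hG.measurable.aestronglyMeasurable C (.of_forall hb)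
  have h2 : Integrable (fun ω => G (periodize 𝒩 ω)) (Disorder.prob d) :=
    Integrable.of_bound (hG.measurable.comp (measurable_periodize 𝒩)).aestronglyMeasurable C
      (.of_forall fun ω => hb _)
  rw [integral_periodicProb 𝒩 hG.measurable, ← integral_sub h1 h2]
  refine (norm_integral_le_of_norm_le_const
    (.of_forall fun ω => hD _ _ (agreeOnCube_periodize 𝒩 ω))).trans ?_
  simp

theorem op_prod_ofFn {X : Type*} [TopologicalSpace X] [AddAction (Lattice d) X]
    [ContinuousConstVAdd (Lattice d) X] [CompactSpace X] {N : ℕ} (f : Fin N → Observables F X)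
    (ω : X) : op (List.ofFn f).prod ω = (List.ofFn fun j => op (f j) ω).prod := by
  induction N with
  | zero => rfl
  | succ N ih => rw [List.ofFn_succ, List.ofFn_succ, List.prod_cons, List.prod_cons, op_mul, ih]

/-- Restriction leaves the operators at periodic configurations unchanged, so both traces integrate
the same continuous function on `Disorder d`. -/
theorem norm_trace_sub_trace_le {N : ℕ} (f : Fin N → Observables F (Disorder d)) (𝒩 : ℕ) {D : ℝ}
    (hD : ∀ ω ω', AgreeOnCube 𝒩 ω ω' → ‖entry (List.ofFn fun j => op (f j) ω).prod 0 0 -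
      entry (List.ofFn fun j => op (f j) ω').prod 0 0‖ ≤ D) :
    ‖trace (Disorder.prob d) (List.ofFn f).prod -
      trace (PeriodicDisorder.prob d 𝒩) (List.ofFn fun j => toPeriodic 𝒩 (f j)).prod‖ ≤ D := by
  have h1 : ∀ ω, kernel (List.ofFn f).prod ω 0 = entry (List.ofFn fun j => op (f j) ω).prod 0 0 :=
    fun ω => by rw [kernel_eq_entry, op_prod_ofFn]
  have h2 : ∀ y, kernel (List.ofFn fun j => toPeriodic 𝒩 (f j)).prod y 0 =
      entry (List.ofFn fun j => op (f j) (PeriodicDisorder.incl y)).prod 0 0 := fun y => by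
    rw [kernel_eq_entry, op_prod_ofFn]
    rfl
  have hc := continuous_kernel (List.ofFn f).prod 0
  simp only [h1] at hc
  simp only [trace, h1, h2]
  exact norm_integral_sub_periodicProb_le 𝒩 hc hD

theorem exists_trace_sub_trace_le {N : ℕ} (α : Fin N → Fin d → ℕ) {η δ : ℝ} (hη : 0 ≤ η)
    (hδ : 0 < δ) :
    ∃ B, 0 ≤ B ∧ ∀ (A : Fin N → ℝ) (f g : Fin N → Observables F (Disorder d)),
      (∀ j, IsLocalised (A j) (η + δ + δ) η δ (op (f j))) →
      (∀ j, IsMixedDerivative (α j) (f j) (g j)) → ∀ 𝒩 : ℕ,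
      ‖trace (Disorder.prob d) (List.ofFn g).prod -
        trace (PeriodicDisorder.prob d 𝒩) (List.ofFn fun j => toPeriodic 𝒩 (g j)).prod‖ ≤
        B * (∏ j, A j) * Real.exp (-(2 * η * 𝒩)) := by
  have hC := fun j => exists_isLocalised_mixedDerivative (F := F) (α j) hδ
  choose C hC0 hC using hC
  -- The derivatives have consumed one `δ`; the other is halved to give the two margins required for
  -- products.
  obtain ⟨K, hK, hcol⟩ := exists_column_prod_le (d := d) hη (half_pos hδ) N
  refine ⟨K * ∏ j, C j, mul_nonneg hK (Finset.prod_nonneg fun j _ => hC0 j),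
    fun A f g hf hg 𝒩 => norm_trace_sub_trace_le g 𝒩 fun ω ω' hω => ?_⟩
  have hloc : ∀ j, IsLocalised (C j * A j) (η + δ / 2 + δ / 2) η 0 (op (g j)) := fun j => by
    have := hC j (A j) (η + δ) η (f j) (g j) (hf j) (hg j)
    rwa [add_assoc η, add_halves]
  have := (hcol (fun j => C j * A j) (fun j => op (g j)) hloc).2 𝒩 ω ω' hω 0
  rw [len_zero, mul_zero, Real.exp_zero, mul_one, Finset.prod_mul_distrib, ← mul_assoc] at this
  exact this

end Traces

/-! ### The rates -/

/-- `sinh ξ = 2 sinh (ξ/2) cosh (ξ/2) ≥ e^(ξ/2) - e^(-ξ/2) ≥ e^(ξ/2) - 1`. It makes `ξ/2` a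
Combes–Thomas rate at distance `κ`. -/
theorem exp_half_sub_one_le_sinh {ξ : ℝ} (hξ : 0 ≤ ξ) : Real.exp (ξ / 2) - 1 ≤ Real.sinh ξ := by
  have h1 : Real.sinh ξ = 2 * Real.sinh (ξ / 2) * Real.cosh (ξ / 2) := by
    rw [← Real.sinh_two_mul]
    ring_nf
  have h2 := Real.one_le_cosh (ξ / 2)
  have h3 : 0 ≤ Real.sinh (ξ / 2) := Real.sinh_nonneg_iff.2 (by linarith)
  have h4 : Real.exp (ξ / 2) - Real.exp (-(ξ / 2)) = 2 * Real.sinh (ξ / 2) := by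
    rw [Real.sinh_eq]
    ring
  have h5 : Real.exp (-(ξ / 2)) ≤ 1 := Real.exp_le_one_iff.2 (by linarith)
  rw [h1]
  nlinarith

theorem two_mul_mul_exp_half_sub_one_lt {d : ℕ} (hd : 0 < d) {κ ξ : ℝ} (hξ : 0 ≤ ξ)
    (hξκ : ξ < Real.arsinh (κ / (2 * d))) : 2 * d * (Real.exp (ξ / 2) - 1) < κ := by
  have hd' : (0 : ℝ) < 2 * d := by positivity
  have h := Real.sinh_lt_sinh.2 hξκ
  rw [Real.sinh_arsinh, lt_div_iff₀ hd', mul_comm] at h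
  exact (mul_le_mul_of_nonneg_left (exp_half_sub_one_le_sinh hξ) hd'.le).trans_lt h

/-- The surplus rate `b - a` pays for the factor `x⁻¹`, by `e^(-y) ≤ y⁻¹`. -/
theorem exp_neg_mul_le_inv_mul_exp {a b x : ℝ} (hab : a < b) (hx : 0 < x) :
    Real.exp (-(b * x)) ≤ (b - a)⁻¹ * (x⁻¹ * Real.exp (-(a * x))) := by
  have hy : 0 < (b - a) * x := mul_pos (sub_pos.2 hab) hx
  have h1 : Real.exp (-((b - a) * x)) ≤ ((b - a) * x)⁻¹ := by
    rw [Real.exp_neg]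
    exact inv_anti₀ hy (by linarith [Real.add_one_le_exp ((b - a) * x)])
  have h2 : Real.exp (-(b * x)) = Real.exp (-((b - a) * x)) * Real.exp (-(a * x)) := by
    rw [← Real.exp_add]
    ring_nf
  rw [h2, ← mul_assoc, ← mul_inv]
  exact mul_le_mul_of_nonneg_right h1 (Real.exp_pos _).le

theorem mul_prod_mul_exp_le {B K ξ a b x : ℝ} {N : ℕ} (hB : 0 ≤ B) (hK : 0 ≤ K) (c : Fin N → ℝ)
    (hc : ∀ j, 0 ≤ c j) (hab : a * ξ < b) (hx : 0 < x) :
    B * (∏ j, K * c j) * Real.exp (-(b * x)) ≤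
      B * K ^ N * (b - a * ξ)⁻¹ * (∏ j, c j) * x⁻¹ * Real.exp (-a * ξ * x) := by
  have h := exp_neg_mul_le_inv_mul_exp hab hx
  have hp : 0 ≤ B * (K ^ N * ∏ j, c j) :=
    mul_nonneg hB (mul_nonneg (pow_nonneg hK N) (Finset.prod_nonneg fun j _ => hc j))
  have he : -a * ξ * x = -(a * ξ * x) := by ring
  rw [Finset.prod_mul_distrib, Finset.prod_const, Finset.card_univ, Fintype.card_fin, he]
  refine (mul_le_mul_of_nonneg_left h hp).trans (le_of_eq ?_)
  ring

theorem two_mul_sqrt_two_div_three_lt : 2 * Real.sqrt 2 / 3 < 24 / 25 := by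
  have : Real.sqrt 2 < 36 / 25 := (Real.sqrt_lt' (by norm_num)).2 (by norm_num)
  linarith

end BrillouinTorus

end

/-! ### Choice of the rates and conclusion -/

open BrillouinTorus in
theorem mainTheorem5 (d : ℕ) (hd : 0 < d) (F : MagneticField d) (W κ ξ : ℝ) (hξ : 0 < ξ)
    (hξκ : ξ < Real.arsinh (κ / (2 * d))) (N : ℕ) (α : Fin N → Fin d → ℕ) :
    ∃ B : ℝ, ∀ Φ : Fin N → ℂ → ℂ,
      (∀ j, AnalyticOnNhd ℂ (Φ j)
        {z | Metric.infDist z (spectrum ℂ (hamiltonian F W)) ≤ κ}) →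
      (∀ j, ∃! g, IsMixedDerivative (α j) (cfc (Φ j) (hamiltonian F W)) g) ∧
      ∀ f : Fin N → Observables F (Disorder d),
        (∀ j, IsMixedDerivative (α j) (cfc (Φ j) (hamiltonian F W)) (f j)) →
        ∀ 𝒩 : ℕ, 0 < 𝒩 →
          ‖trace (Disorder.prob d) (List.ofFn f).prod -
              trace (PeriodicDisorder.prob d 𝒩) (List.ofFn fun j => toPeriodic 𝒩 (f j)).prod‖ ≤
            B * (∏ j, contourNorm (spectrum ℂ (hamiltonian F W)) κ (Φ j)) * (𝒩 : ℝ)⁻¹ *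
              Real.exp (-(2 * Real.sqrt 2 / 3) * ξ * 𝒩) := by
  -- With `η = 12ξ/25` and `δ = ξ/100` the total rate `η + 2δ` is exactly `ξ/2`, while `2η = 24ξ/25`
  -- still exceeds `(2√2/3) ξ`.
  have hrate : 2 * d * (Real.exp (12 / 25 * ξ + ξ / 100 + ξ / 100) - 1) < κ := by
    convert two_mul_mul_exp_half_sub_one_lt hd hξ.le hξκ using 4
    ring
  have hη : 0 ≤ 12 / 25 * ξ := by positivity
  have hδ : 0 < ξ / 100 := by positivity
  refine (exists_isLocalised_cfc_hamiltonian F W hη hδ hrate).elim fun K hK => ?_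
  refine (exists_trace_sub_trace_le (F := F) α hη hδ).elim fun B hB => ?_
  refine ⟨B * K ^ N * (2 * (12 / 25 * ξ) - 2 * Real.sqrt 2 / 3 * ξ)⁻¹, fun Φ hΦ =>
    ⟨fun j => ?_, fun f hf 𝒩 h𝒩 => ?_⟩⟩
  · exact existsUnique_of_exists_of_unique
      ((hK.2 (Φ j) (hΦ j)).exists_isMixedDerivative (by positivity) (α j))
      fun g g' hg hg' => hg.unique hg'
  · exact (hB.2 _ _ f (fun j => hK.2 (Φ j) (hΦ j)) hf 𝒩).trans
      (mul_prod_mul_exp_le hB.1 hK.1 _ (fun j => contourNorm_nonneg _ _ _)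
        (by linarith [mul_lt_mul_of_pos_right two_mul_sqrt_two_div_three_lt hξ])
        (Nat.cast_pos.2 h𝒩))
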